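/- **Setting.** Let $\mathfrak g$ be a finite-dimensional simple complex Lie algebra, $\mathfrak h\subset\mathfrak g$ a Cartan subalgebra, $i:\mathfrak h\to\mathfrak g$ the inclusion, and $\Omega\in(S^2\mathfrak g)^{\mathfrak g}$ the Casimir element of the Killing form. A *classical dynamical $r$-matrix with spectral parameter* is a meromorphic function $r:\mathfrak h^*\times\mathbb C\to\mathfrak g\otimes\mathfrak g$ such that, as identities of meromorphic functions, (a) $[x\otimes1+1\otimes x,\,r(q,z)]=0$ for $x\in\mathfrak h$; (b) $r(q,z)+r^{21}(q,-z)=0$; (c) $r(q,\cdot)$ has a simple pole at $z=0$ with residue $\Omega$; (d) with $z_{ij}=z_i-z_j$, a basis $(x_k)$ of $\mathfrak h$ and the corresponding coordinates on $\mathfrak h^*$, $$\sum_k\Big(x_k^{(1)}\partial_k r^{23}(q,z_{23})-x_k^{(2)}\partial_k r^{13}(q,z_{13})+x_k^{(3)}\partial_k r^{12}(q,z_{12})\Big)+[r^{12}(q,z_{12}),r^{13}(q,z_{13})]+[r^{12}(q,z_{12}),r^{23}(q,z_{23})]+[r^{13}(q,z_{13}),r^{23}(q,z_{23})]=0 .$$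 Let $U\subset\mathfrak h^*$ be the open set of those $q$ such that, for all $q'$ near $q$, $r(q',\cdot)$ has no poles in a common punctured disc around $0$. For a finite-dimensional complex vector space $V$ let $LV$ be the space of Laurent series $\sum_{n\ge -N}v_nz^n$ with $v_n\in V$, convergent in some annulus $0<|z|<\rho$ ($N$ and $\rho$ may depend on the series). $L\mathfrak g$ is a Lie algebra with the pointwise bracket; its restricted dual is $L\mathfrak g^*:=L(\mathfrak g^*)$, with the pairing $\langle M,Y\rangle=\operatorname{Res}_{z=0}\langle M(z),Y(z)\rangle\,dz$. For $M\in L\mathfrak g^*$ and small $z\ne0$ put $$(R_qM)(z)=\mathrm{p.v.}\,\frac1{2\pi i}\oint_{|w|=|z|}\langle M(w)\otimes 1,\ r(q,w-z)\rangle\,dw\in\mathfrak g .$$ Write $\mathcal X_a$ for the derivative with respect to $q$ along the constant vector field $a\in\mathfrak h^*$. On $T^*\mathfrak h^*\times\mathfrak g^*=\mathfrak h^*\times\mathfrak h\times\mathfrak g^*\ni(q,p,\xi)$ take the product of the canonical Poisson structure, normalized by $\{p_i,q_j\}=\delta_{ij}$, and the Lie–Poisson structure $\{a,b\}(\xi)=\langle\xi,[a,b]\rangle$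 ($a,b\in\mathfrak g$); the flow of a Hamiltonian $F$ is given by $\frac{d}{dt}G(\phi_t)=\{G,F\}(\phi_t)$. Let $$L(q,p,\xi)(z)=p+(r_-^\#(q)\xi)(z),\qquad \langle\eta,(r_-^\#(q)\xi)(z)\rangle=\langle\eta\otimes\xi,\ r(q,z)\rangle\quad(\eta\in\mathfrak g^*).$$ **Theorem A.** Let $r$ be a classical dynamical $r$-matrix with spectral parameter. (1) For $q\in U$ the function $L(q,p,\xi)$ is an element of $L\mathfrak g$: its Laurent expansion at $0$ converges to it in $0<|z|<\rho$ whenever $r(q,\cdot)$ has no pole there. At all points at which the values of $r$ that occur are regular, with $L_1=L\otimes 1$, $L_2=1\otimes L$, $$\begin{aligned}\{L_1(z),L_2(w)\}&=-[r^{12}(q,z-w),L_1(z)]+[r^{21}(q,w-z),L_2(w)]-\mathcal X_{i^*\xi}r(q,z-w)\\&=-[r^{12}(q,z-w),\,L_1(z)+L_2(w)]-\mathcal X_{i^*\xi}r(q,z-w).\end{aligned}$$ (2) Let $f:L\mathfrak g\to\mathbb C$ be smooth in the complex sense (i.e. smooth on each of the Banach spaces $\{\sum_{k\ge-N}v_kz^k:\sum_k\|v_k\|\rho^{k}<\infty\}$,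 of which $L\mathfrak g$ is the inductive limit), with differential $df(X)\in L\mathfrak g^*$ for every $X\in L\mathfrak g$, and ad-invariant: $\langle df(X),[Y,X]\rangle=0$ for all $X,Y\in L\mathfrak g$. Then $L^*f=f\circ L$ is differentiable on $U\times\mathfrak h\times\mathfrak g^*$, and along every integral curve $\phi_t=(q_t,p_t,\xi_t)$ of its Hamiltonian flow in this set, $t\mapsto L(\phi_t)\in L\mathfrak g$ is differentiable and $$\frac{d}{dt}L(\phi_t)=\big[R_{q_t}(df(L(\phi_t))),\,L(\phi_t)\big]+(\mathcal X_{i^*\xi_t}R)_{q_t}\big(df(L(\phi_t))\big),$$ where in the last term $R_q$ is differentiated with respect to $q$ with its argument $df(L(\phi_t))$ held fixed. This holds at every $z$ with $0<|z|<\rho$ whenever $r(q_t,\cdot)$ has no pole in $0<|\zeta|<2\rho$ and the series $df(L(\phi_t))$ converges in $0<|w|<\rho$; there, in particular, the principal value and its derivative exist. -/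

import Mathlib

open Filter Topology
open scoped TensorProduct ContDiff

/-! ## Linear coordinates

Analysis on finite-dimensional complex vector spaces is done in linear coordinates. The notions
defined this way do not depend on the choice of the basis. -/

section Coordinates

variable (V : Type*) [AddCommGroup V] [Module ℂ V] [FiniteDimensional ℂ V]

/-- The coordinates of the vectors of `V` in a fixed basis. -/
noncomputable def coords : V ≃ₗ[ℂ] (Fin (Module.finrank ℂ V) → ℂ) :=
  (Module.finBasis ℂ V).equivFun

variable {V}
variable {W : Type*} [AddCommGroup W] [Module ℂ W] [FiniteDimensional ℂ W]

/-- The function `F : V → W`, written in coordinates. -/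
noncomputable def inCoords (F : V → W) :
    (Fin (Module.finrank ℂ V) → ℂ) → (Fin (Module.finrank ℂ W) → ℂ) :=
  fun c => coords W (F ((coords V).symm c))

/-- `F` is holomorphic (analytic) at `x`. -/
def HolAt (F : V → W) (x : V) : Prop := AnalyticAt ℂ (inCoords F) (coords V x)

/-- A meromorphic function: near each point a quotient of holomorphic functions. Its values on the
zero set of the denominator are irrelevant; its regular points are those at which it is
holomorphic. -/
def IsMeromorphicFun (F : V → W) : Prop :=
  ∀ x : V, ∃ (N : V → W) (d : V → ℂ), HolAt N x ∧ HolAt d x ∧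
    (¬ ∀ᶠ c in 𝓝 (coords V x), d ((coords V).symm c) = 0) ∧
    ∀ᶠ c in 𝓝 (coords V x), d ((coords V).symm c) ≠ 0 →
      F ((coords V).symm c) = (d ((coords V).symm c))⁻¹ • N ((coords V).symm c)

/-- The derivative at `0` of a curve in `V` with a complex parameter. -/
noncomputable def derivZero (c : ℂ → V) : V :=
  (coords V).symm (deriv (fun s => coords V (c s)) 0)

end Coordinates

/-! ## Convergent Laurent series -/

section Loops

variable (V : Type*) [AddCommGroup V] [Module ℂ V] [FiniteDimensional ℂ V]

variable {V} in
/-- The Laurent series `∑ c n z ^ n` converges (absolutely) in the annulus `0 < |z| < ρ`. -/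
def ConvergesOn (c : ℤ → V) (ρ : ℝ) : Prop :=
  ∀ s : ℝ, 0 < s → s < ρ → Summable fun n : ℤ => ‖coords V (c n)‖ * s ^ n

/-- The space `LV` of Laurent series `∑_{n ≥ -N} c n z ^ n` with coefficients in `V` which
converge in some annulus `0 < |z| < ρ`; `N` and `ρ` may depend on the series. -/
def loopSubmodule : Submodule ℂ (ℤ → V) where
  carrier := {c | (∃ N : ℤ, ∀ n < N, c n = 0) ∧ ∃ ρ : ℝ, 0 < ρ ∧ ConvergesOn c ρ}
  zero_mem' := ⟨⟨0, fun _ _ => rfl⟩, 1, one_pos, fun s _ _ => by simp⟩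
  add_mem' := by
    rintro a b ⟨⟨N, hN⟩, ρ, hρ, ha⟩ ⟨⟨M, hM⟩, σ, hσ, hb⟩
    refine ⟨⟨min N M, fun n hn => ?_⟩, min ρ σ, lt_min hρ hσ, fun s hs hsm => ?_⟩
    · simp [hN n (lt_of_lt_of_le hn (min_le_left _ _)),
        hM n (lt_of_lt_of_le hn (min_le_right _ _))]
    · refine Summable.of_nonneg_of_le (fun n => by positivity) (fun n => ?_)
        ((ha s hs (lt_of_lt_of_le hsm (min_le_left _ _))).add
          (hb s hs (lt_of_lt_of_le hsm (min_le_right _ _))))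
      rw [← add_mul, Pi.add_apply, map_add]
      exact mul_le_mul_of_nonneg_right (norm_add_le _ _) (by positivity)
  smul_mem' := by
    rintro k a ⟨⟨N, hN⟩, ρ, hρ, ha⟩
    refine ⟨⟨N, fun n hn => by simp [hN n hn]⟩, ρ, hρ, fun s hs hsm => ?_⟩
    simpa [norm_smul, mul_assoc] using (ha s hs hsm).mul_left ‖k‖

abbrev Loop : Type _ := loopSubmodule V

variable {V}

/-- The Laurent series `X` converges at `z`, with sum `v`. -/
def Loop.HasValue (X : Loop V) (z : ℂ) (v : V) : Prop :=
  HasSum (fun n : ℤ => z ^ n • coords V (X.1 n)) (coords V v)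

/-- The value at `z` of a Laurent series. -/
noncomputable def Loop.eval (X : Loop V) (z : ℂ) : V :=
  (coords V).symm (∑' n : ℤ, z ^ n • coords V (X.1 n))

open Classical in
/-- The Laurent expansion at `0` of a function (and `0` if there is none in `LV`). -/
noncomputable def Loop.ofFun (F : ℂ → V) : Loop V :=
  if h : ∃ X : Loop V, ∀ᶠ z in 𝓝[≠] (0 : ℂ), X.HasValue z (F z) then h.choose else 0

variable (V) in
/-- The Banach space `ℓ¹(ℕ, V)`, with the vectors of `V` given by their coordinates. -/
abbrev SeqSpace : Type := lp (fun _ : ℕ => Fin (Module.finrank ℂ V) → ℂ) 1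

theorem Loop.step_mem (N : ℕ) {ρ : ℝ} (hρ : 0 < ρ) (x : SeqSpace V) :
    (fun k : ℤ => if -(N : ℤ) ≤ k then
      ((ρ : ℂ) ^ (k + N))⁻¹ • (coords V).symm (x (k + N).toNat) else 0) ∈ loopSubmodule V := by
  refine ⟨⟨-(N : ℤ), fun n hn => if_neg (not_le.mpr hn)⟩, ρ, hρ, fun s hs hsρ => ?_⟩
  have h1 : Summable fun n : ℕ => ‖x n‖ := by
    simpa using (lp.memℓp x).summable (by norm_num)
  have h2 : Summable fun n : ℕ => s ^ (-(N : ℤ)) * ‖x n‖ := h1.mul_left _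
  have hinj : Function.Injective fun n : ℕ => (n : ℤ) - N := fun a b h => by
    simpa using h
  rw [← hinj.summable_iff]
  · refine Summable.of_nonneg_of_le (fun n => mul_nonneg (norm_nonneg _) (by positivity))
      (fun n => ?_) h2
    have hn : -(N : ℤ) ≤ (n : ℤ) - N := by omega
    simp only [Function.comp, if_pos hn, sub_add_cancel, Int.toNat_natCast, map_smul,
      LinearEquiv.apply_symm_apply, norm_smul, norm_inv,
      norm_zpow, Complex.norm_real, Real.norm_of_nonneg hρ.le]
    have h3 : s ^ ((n : ℤ) - N) = s ^ n * s ^ (-(N : ℤ)) := by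
      rw [sub_eq_add_neg, zpow_add₀ hs.ne', zpow_natCast]
    have h4 : (ρ ^ (n : ℤ))⁻¹ * s ^ n ≤ 1 := by
      rw [zpow_natCast, inv_mul_le_iff₀ (by positivity), mul_one]
      exact pow_le_pow_left₀ hs.le hsρ.le n
    rw [h3]
    calc (ρ ^ (n : ℤ))⁻¹ * ‖x n‖ * (s ^ n * s ^ (-(N : ℤ)))
        = ((ρ ^ (n : ℤ))⁻¹ * s ^ n) * (s ^ (-(N : ℤ)) * ‖x n‖) := by ring
      _ ≤ 1 * (s ^ (-(N : ℤ)) * ‖x n‖) := by gcongr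
      _ = _ := one_mul _
  · intro k hk
    have : ¬ -(N : ℤ) ≤ k := fun h => hk ⟨(k + N).toNat, by simp; omega⟩
    simp [if_neg this]

/-- `LV` is the increasing union of the Banach spaces of the series `∑_{k ≥ -N} c k z ^ k` with
`∑ ‖c k‖ ρ ^ (k + N) < ∞`, for `N` in `ℕ` and `ρ > 0`. This is the inclusion of such a space, which
is identified with `ℓ¹(ℕ, V)` by `x n = ρ ^ n c (n - N)`. -/
noncomputable def Loop.step (N : ℕ) {ρ : ℝ} (hρ : 0 < ρ) (x : SeqSpace V) : Loop V :=
  ⟨fun k : ℤ => if -(N : ℤ) ≤ k then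
      ((ρ : ℂ) ^ (k + N))⁻¹ • (coords V).symm (x (k + N).toNat) else 0,
    Loop.step_mem N hρ x⟩

/-- Smoothness of a function on `LV`, an inductive limit of Banach spaces with compact connecting
maps: smoothness on every step. -/
def Loop.Smooth (f : Loop V → ℂ) : Prop :=
  ∀ (N : ℕ) (ρ : ℝ) (hρ : 0 < ρ), ContDiff ℂ ∞ fun x : SeqSpace V => f (Loop.step N hρ x)

/-- The curve `c` in `LV` has derivative `c'` at `t`: near `t` it is a curve in one of the steps,
differentiable there with derivative `c'`. -/
def Loop.HasDerivAtLoop (c : ℝ → Loop V) (c' : Loop V) (t : ℝ) : Prop :=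
  ∃ (N : ℕ) (ρ : ℝ) (hρ : 0 < ρ) (γ : ℝ → SeqSpace V) (γ' : SeqSpace V),
    (∀ᶠ s in 𝓝 t, Loop.step N hρ (γ s) = c s) ∧ Loop.step N hρ γ' = c' ∧ HasDerivAt γ γ' t

/-- The pairing `⟨M, Y⟩ = ∮ ⟨M(z), Y(z)⟩ dz / (2 π i) = Res_{z = 0} ⟨M(z), Y(z)⟩ dz` of the
restricted dual `LV* = L(V*)` with `LV`; the sum has finitely many nonzero terms. -/
noncomputable def Loop.pairing (M : Loop (Module.Dual ℂ V)) (Y : Loop V) : ℂ :=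
  ∑ᶠ n : ℤ, M.1 (-1 - n) (Y.1 n)

/-- `df X` in the restricted dual is the differential of `f` at `X`, for all `X` in `LV`. -/
def Loop.IsDifferential (f : Loop V → ℂ) (df : Loop V → Loop (Module.Dual ℂ V)) : Prop :=
  ∀ X Y : Loop V, HasDerivAt (fun s : ℂ => f (X + s • Y)) (Loop.pairing (df X) Y) 0

end Loops

section LieAlgebra

variable {g : Type*} [LieRing g] [LieAlgebra ℂ g] [FiniteDimensional ℂ g]

theorem exists_norm_coords_lie_le : ∃ K : ℝ, 0 ≤ K ∧
    ∀ x y : g, ‖coords g ⁅x, y⁆‖ ≤ K * (‖coords g x‖ * ‖coords g y‖) := by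
  refine ⟨∑ i, ∑ j, ‖coords g ⁅Module.finBasis ℂ g i, Module.finBasis ℂ g j⁆‖,
    Finset.sum_nonneg fun _ _ => Finset.sum_nonneg fun _ _ => norm_nonneg _, fun x y => ?_⟩
  have hexp : ∀ v : g, v = ∑ i, coords g v i • Module.finBasis ℂ g i := fun v =>
    ((Module.finBasis ℂ g).sum_equivFun v).symm
  have h : coords g ⁅x, y⁆ = ∑ i, ∑ j, (coords g x i * coords g y j) •
      coords g ⁅Module.finBasis ℂ g i, Module.finBasis ℂ g j⁆ := by
    conv_lhs => rw [hexp x, hexp y]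
    simp only [sum_lie, lie_sum, smul_lie, lie_smul, map_sum, map_smul, smul_smul, Finset.smul_sum]
    rw [Finset.sum_comm]
    simp only [mul_comm]
  rw [h, Finset.sum_mul]
  refine (norm_sum_le _ _).trans (Finset.sum_le_sum fun i _ => ?_)
  rw [Finset.sum_mul]
  refine (norm_sum_le _ _).trans (Finset.sum_le_sum fun j _ => ?_)
  rw [norm_smul, norm_mul, mul_comm]
  gcongr
  · exact norm_le_pi_norm (coords g x) i
  · exact norm_le_pi_norm (coords g y) j

theorem Loop.lie_mem (X Y : Loop g) :
    (fun n : ℤ => ∑ᶠ i : ℤ, ⁅X.1 i, Y.1 (n - i)⁆) ∈ loopSubmodule g := by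
  obtain ⟨X, ⟨N, hN⟩, ρ, hρ, hX⟩ := X
  obtain ⟨Y, ⟨M, hM⟩, σ, hσ, hY⟩ := Y
  obtain ⟨K, hK, hlie⟩ := exists_norm_coords_lie_le (g := g)
  refine ⟨⟨N + M, fun n hn => ?_⟩, min ρ σ, lt_min hρ hσ, fun s hs hsm => ?_⟩
  · refine (finsum_congr fun i => ?_).trans finsum_zero
    rcases lt_or_ge i N with h | h
    · simp [hN i h]
    · simp [hM (n - i) (by omega)]
  · have hx := hX s hs (lt_of_lt_of_le hsm (min_le_left _ _))
    have hy := hY s hs (lt_of_lt_of_le hsm (min_le_right _ _))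
    have hxy := hx.mul_of_nonneg hy (fun n => by positivity) (fun n => by positivity)
    let e : ℤ × ℤ ≃ ℤ × ℤ :=
      ⟨fun p => (p.2, p.1 - p.2), fun p => (p.1 + p.2, p.1), fun p => by simp, fun p => by simp⟩
    have hxy' : Summable fun p : ℤ × ℤ => (‖coords g (X p.2)‖ * s ^ p.2) *
        (‖coords g (Y (p.1 - p.2))‖ * s ^ (p.1 - p.2)) :=
      (e.summable_iff (f := fun p : ℤ × ℤ =>
        (‖coords g (X p.1)‖ * s ^ p.1) * (‖coords g (Y p.2)‖ * s ^ p.2))).mpr hxy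
    have hK' := hxy'.mul_left K
    refine Summable.of_nonneg_of_le (fun n => by positivity) (fun n => ?_) hK'.prod
    have hn : ∀ i : ℤ, ‖coords g ⁅X i, Y (n - i)⁆‖ * s ^ n ≤
        K * ((‖coords g (X i)‖ * s ^ i) * (‖coords g (Y (n - i))‖ * s ^ (n - i))) := fun i => by
      have h1 : s ^ n = s ^ i * s ^ (n - i) := by
        rw [← zpow_add₀ hs.ne']; congr 1; ring
      calc ‖coords g ⁅X i, Y (n - i)⁆‖ * s ^ n
          ≤ K * (‖coords g (X i)‖ * ‖coords g (Y (n - i))‖) * s ^ n := by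
            gcongr; exact hlie _ _
        _ = _ := by rw [h1]; ring
    have hfib : Summable fun i : ℤ =>
        K * ((‖coords g (X i)‖ * s ^ i) * (‖coords g (Y (n - i))‖ * s ^ (n - i))) :=
      hK'.prod_factor n
    have hs1 : Summable fun i : ℤ => ‖coords g ⁅X i, Y (n - i)⁆‖ * s ^ n :=
      Summable.of_nonneg_of_le (fun i => by positivity) hn hfib
    have hs2 : Summable fun i : ℤ => ‖coords g ⁅X i, Y (n - i)⁆‖ :=
      (summable_mul_right_iff (by positivity : s ^ n ≠ 0)).mp hs1
    have hfin : (Function.support fun i : ℤ => ⁅X i, Y (n - i)⁆).Finite := by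
      refine (Set.finite_Icc N (n - M)).subset fun i hi => ?_
      by_contra hcon
      rw [Set.mem_Icc, not_and_or, not_le, not_le] at hcon
      refine hi ?_
      rcases hcon with h | h
      · simp [hN i h]
      · simp [hM (n - i) (by omega)]
    have hsum : coords g (∑ᶠ i : ℤ, ⁅X i, Y (n - i)⁆) = ∑' i : ℤ, coords g ⁅X i, Y (n - i)⁆ := by
      rw [tsum_eq_finsum (hfin.subset fun i hi h => hi (by simp [h]))]
      exact (coords g).toLinearMap.toAddMonoidHom.map_finsum hfin
    calc ‖coords g (∑ᶠ i : ℤ, ⁅X i, Y (n - i)⁆)‖ * s ^ n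
        ≤ (∑' i : ℤ, ‖coords g ⁅X i, Y (n - i)⁆‖) * s ^ n := by
          rw [hsum]; gcongr; exact norm_tsum_le_tsum_norm hs2
      _ = ∑' i : ℤ, ‖coords g ⁅X i, Y (n - i)⁆‖ * s ^ n := tsum_mul_right.symm
      _ ≤ _ := hs1.tsum_le_tsum hn hfib

/-- The bracket of the loop algebra `Lg`, `[X, Y](z) = [X(z), Y(z)]`, in terms of the
coefficients. -/
noncomputable instance Loop.instBracket : Bracket (Loop g) (Loop g) where
  bracket X Y := ⟨fun n : ℤ => ∑ᶠ i : ℤ, ⁅X.1 i, Y.1 (n - i)⁆, Loop.lie_mem X Y⟩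

/-- A function on `Lg` with differential `df` is ad-invariant if `⟨df(X), [Y, X]⟩ = 0` for all
`X`, `Y` in `Lg`. -/
def Loop.AdInvariant (df : Loop g → Loop (Module.Dual ℂ g)) : Prop :=
  ∀ X Y : Loop g, Loop.pairing (df X) ⁅Y, X⁆ = 0

/-! ## Tensors -/

/-- `a ⊗ b ↦ ξ(a) b`. -/
noncomputable def contrFst (ξ : Module.Dual ℂ g) : g ⊗[ℂ] g →ₗ[ℂ] g :=
  (TensorProduct.lid ℂ g).toLinearMap ∘ₗ LinearMap.rTensor g ξ

/-- `a ⊗ b ↦ ξ(b) a`. -/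
noncomputable def contrSnd (ξ : Module.Dual ℂ g) : g ⊗[ℂ] g →ₗ[ℂ] g :=
  (TensorProduct.rid ℂ g).toLinearMap ∘ₗ LinearMap.lTensor g ξ

/-- `s²¹`, i.e. `a ⊗ b ↦ b ⊗ a`. -/
noncomputable def flipTensor (s : g ⊗[ℂ] g) : g ⊗[ℂ] g := TensorProduct.comm ℂ g g s

/-- `[s, X₁] = [s, X ⊗ 1]`, i.e. `a ⊗ b ↦ [a, X] ⊗ b`. -/
noncomputable def lieSlotOne (s : g ⊗[ℂ] g) (X : g) : g ⊗[ℂ] g :=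
  -LinearMap.rTensor g (LieAlgebra.ad ℂ g X : g →ₗ[ℂ] g) s

/-- `[s, X₂] = [s, 1 ⊗ X]`, i.e. `a ⊗ b ↦ a ⊗ [b, X]`. -/
noncomputable def lieSlotTwo (s : g ⊗[ℂ] g) (X : g) : g ⊗[ℂ] g :=
  -LinearMap.lTensor g (LieAlgebra.ad ℂ g X : g →ₗ[ℂ] g) s

/-- `[s¹², t¹³]`: `(a ⊗ b, c ⊗ d) ↦ [a, c] ⊗ b ⊗ d`. -/
noncomputable def lie1213 (s t : g ⊗[ℂ] g) : g ⊗[ℂ] (g ⊗[ℂ] g) :=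
  TensorProduct.map₂ (LieModule.toEnd ℂ g g : g →ₗ[ℂ] g →ₗ[ℂ] g) (TensorProduct.mk ℂ g g) s t

/-- `[s¹², t²³]`: `(a ⊗ b, c ⊗ d) ↦ a ⊗ [b, c] ⊗ d`. -/
noncomputable def lie1223 (s t : g ⊗[ℂ] g) : g ⊗[ℂ] (g ⊗[ℂ] g) :=
  LinearMap.lTensor g
    ((LinearMap.rTensorHom g ∘ₗ (LieModule.toEnd ℂ g g : g →ₗ[ℂ] g →ₗ[ℂ] g)).flip t) s

/-- `[s¹³, t²³]`: `(a ⊗ b, c ⊗ d) ↦ a ⊗ c ⊗ [b, d]`. -/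
noncomputable def lie1323 (s t : g ⊗[ℂ] g) : g ⊗[ℂ] (g ⊗[ℂ] g) :=
  LinearMap.lTensor g
    ((LinearMap.lTensorHom g ∘ₗ (LieModule.toEnd ℂ g g : g →ₗ[ℂ] g →ₗ[ℂ] g)).flip t) s

/-- `x⁽¹⁾ s²³`: `a ⊗ b ↦ x ⊗ a ⊗ b`. -/
noncomputable def putFirst (x : g) (s : g ⊗[ℂ] g) : g ⊗[ℂ] (g ⊗[ℂ] g) := x ⊗ₜ[ℂ] s

/-- `x⁽²⁾ s¹³`: `a ⊗ b ↦ a ⊗ x ⊗ b`. -/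
noncomputable def putSecond (x : g) (s : g ⊗[ℂ] g) : g ⊗[ℂ] (g ⊗[ℂ] g) :=
  LinearMap.lTensor g (TensorProduct.mk ℂ g g x) s

/-- `x⁽³⁾ s¹²`: `a ⊗ b ↦ a ⊗ b ⊗ x`. -/
noncomputable def putThird (x : g) (s : g ⊗[ℂ] g) : g ⊗[ℂ] (g ⊗[ℂ] g) :=
  LinearMap.lTensor g ((TensorProduct.mk ℂ g g).flip x) s

variable (g) in
/-- The Casimir element `Ω = ∑ eᵢ ⊗ eⁱ`, for dual bases with respect to the Killing form. -/
noncomputable def casimir [LieAlgebra.IsSimple ℂ g] : g ⊗[ℂ] g :=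
  ∑ i, Module.finBasis ℂ g i ⊗ₜ[ℂ]
    (killingForm ℂ g).dualBasis (LieAlgebra.IsKilling.killingForm_nondegenerate ℂ g)
      (Module.finBasis ℂ g) i

/-! ## Dynamical r-matrices -/

variable {H : LieSubalgebra ℂ g}

/-- `𝒳_a r (q, z)`: the derivative of `r` with respect to `q` along the constant vector field
`a` on `h*`. -/
noncomputable def derivBase (r : Module.Dual ℂ H × ℂ → g ⊗[ℂ] g) (a q : Module.Dual ℂ H) (z : ℂ) :
    g ⊗[ℂ] g :=
  derivZero fun s => r (q + s • a, z)

/-- The set of `q` in `h*` such that, for `q'` near `q`, `r(q', ·)` has no pole in a common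
punctured disc around `0`. For meromorphic `r` it is open and dense. -/
def baseDomain (r : Module.Dual ℂ H × ℂ → g ⊗[ℂ] g) : Set (Module.Dual ℂ H) :=
  {q | ∃ δ : ℝ, 0 < δ ∧ ∀ᶠ c in 𝓝 (coords (Module.Dual ℂ H) q), ∀ z : ℂ, 0 < ‖z‖ → ‖z‖ < δ →
    HolAt r ((coords (Module.Dual ℂ H)).symm c, z)}

/-- `r(q, ·)` has no pole in `|z| < ρ` other than `0`. -/
def RegularBelow (r : Module.Dual ℂ H × ℂ → g ⊗[ℂ] g) (q : Module.Dual ℂ H) (ρ : ℝ) : Prop :=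
  ∀ z : ℂ, 0 < ‖z‖ → ‖z‖ < ρ → HolAt r (q, z)

/-- `Alt(d_h r)` at `(q, z₁, z₂, z₃)`, with `zᵢⱼ = zᵢ - zⱼ`, is
`∑ᵢ xᵢ⁽¹⁾ ∂ᵢ r²³(q, z₂₃) - ∑ᵢ xᵢ⁽²⁾ ∂ᵢ r¹³(q, z₁₃) + ∑ᵢ xᵢ⁽³⁾ ∂ᵢ r¹²(q, z₁₂)`, for a basis `xᵢ` of
`h` and the corresponding linear coordinates on `h*`. -/
noncomputable def altDeriv (r : Module.Dual ℂ H × ℂ → g ⊗[ℂ] g) (q : Module.Dual ℂ H)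
    (z₁ z₂ z₃ : ℂ) : g ⊗[ℂ] (g ⊗[ℂ] g) :=
  ∑ i, (putFirst (Module.finBasis ℂ H i : g)
        (derivBase r ((Module.finBasis ℂ H).coord i) q (z₂ - z₃))
      - putSecond (Module.finBasis ℂ H i : g)
        (derivBase r ((Module.finBasis ℂ H).coord i) q (z₁ - z₃))
      + putThird (Module.finBasis ℂ H i : g)
        (derivBase r ((Module.finBasis ℂ H).coord i) q (z₁ - z₂)))

/-- Classical dynamical r-matrices with spectral parameter associated with `h ⊂ g`. The identities
are identities of meromorphic functions, i.e. they are required at regular points. -/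
structure IsDynamicalRMatrix [LieAlgebra.IsSimple ℂ g] (H : LieSubalgebra ℂ g)
    (r : Module.Dual ℂ H × ℂ → g ⊗[ℂ] g) : Prop where
  meromorphic : IsMeromorphicFun r
  /-- `[x ⊗ 1 + 1 ⊗ x, r(q, z)] = 0` for `x` in `h`. -/
  zeroWeight : ∀ (q : Module.Dual ℂ H) (z : ℂ), HolAt r (q, z) → ∀ x ∈ H, ⁅x, r (q, z)⁆ = 0
  /-- `r(q, z) + r²¹(q, -z) = 0`. -/
  unitarity : ∀ (q : Module.Dual ℂ H) (z : ℂ), HolAt r (q, z) → HolAt r (q, -z) →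
    r (q, z) + flipTensor (r (q, -z)) = 0
  /-- `r(q, ·)` has a simple pole at `0`, with residue `Ω`. -/
  residue : ∀ q ∈ baseDomain r, Tendsto (fun z : ℂ => coords (g ⊗[ℂ] g) (z • r (q, z))) (𝓝[≠] 0)
    (𝓝 (coords (g ⊗[ℂ] g) (casimir g)))
  /-- The classical dynamical Yang-Baxter equation. -/
  cdybe : ∀ (q : Module.Dual ℂ H) (z₁ z₂ z₃ : ℂ), HolAt r (q, z₁ - z₂) →
    HolAt r (q, z₁ - z₃) → HolAt r (q, z₂ - z₃) →
    altDeriv r q z₁ z₂ z₃ + lie1213 (r (q, z₁ - z₂)) (r (q, z₁ - z₃))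
      + lie1223 (r (q, z₁ - z₂)) (r (q, z₂ - z₃))
      + lie1323 (r (q, z₁ - z₃)) (r (q, z₂ - z₃)) = 0

/-! ## The phase space -/

/-- The phase space `T*h* × g* = h* × h × g*`, with points `(q, p, ξ)`. -/
abbrev Phase (H : LieSubalgebra ℂ g) : Type _ := Module.Dual ℂ H × H × Module.Dual ℂ g

/-- `i*ξ`, the restriction of `ξ` in `g*` to `h`. -/
def restrictDual (H : LieSubalgebra ℂ g) (ξ : Module.Dual ℂ g) : Module.Dual ℂ H :=
  ξ ∘ₗ (H.subtype : H →ₗ[ℂ] g)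

/-- The derivative of `F` at `x` in the direction `v`. -/
noncomputable def dirDeriv (F : Phase H → ℂ) (x v : Phase H) : ℂ :=
  deriv (fun s : ℂ => F (x + s • v)) 0

/-- `∂F/∂qᵢ`, for the linear coordinates `qᵢ` on `h*` given by a basis of `h`. -/
noncomputable def dQ (F : Phase H → ℂ) (x : Phase H) (i : Fin (Module.finrank ℂ H)) : ℂ :=
  dirDeriv F x ((Module.finBasis ℂ H).coord i, 0, 0)

/-- `∂F/∂pᵢ`, for the coordinates `pᵢ` on `h` dual to the `qᵢ`. -/
noncomputable def dP (F : Phase H → ℂ) (x : Phase H) (i : Fin (Module.finrank ℂ H)) : ℂ :=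
  dirDeriv F x (0, Module.finBasis ℂ H i, 0)

/-- `∂F/∂ξ`, a vector of `g = (g*)*`. -/
noncomputable def gradXi (F : Phase H → ℂ) (x : Phase H) : g :=
  ∑ a, dirDeriv F x (0, 0, (Module.finBasis ℂ g).coord a) • Module.finBasis ℂ g a

/-- The product of the canonical Poisson structure on `T*h*`, with `{pᵢ, qⱼ} = δᵢⱼ`, and the plus
Lie-Poisson structure on `g*`, with `{a, b}(ξ) = ξ([a, b])` for `a`, `b` in `g = (g*)*`. -/
noncomputable def poisson (F G : Phase H → ℂ) (x : Phase H) : ℂ :=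
  ∑ i, (dP F x i * dQ G x i - dQ F x i * dP G x i) + x.2.2 ⁅gradXi F x, gradXi G x⁆

/-- `{F₁, G₂} = ∑_{a, b} {Fᵃ, Gᵇ} e_a ⊗ e_b`, for functions `F = ∑ Fᵃ e_a` and `G = ∑ Gᵇ e_b` with
values in `g`. -/
noncomputable def poissonTensor (F G : Phase H → g) (x : Phase H) : g ⊗[ℂ] g :=
  ∑ a, ∑ b, poisson (fun y => (Module.finBasis ℂ g).coord a (F y))
      (fun y => (Module.finBasis ℂ g).coord b (G y)) x •
    (Module.finBasis ℂ g a ⊗ₜ[ℂ] Module.finBasis ℂ g b)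

/-- `φ` satisfies Hamilton's equations at time `t` for the Hamiltonian `F`:
`dℓ(φ)/dt = {ℓ, F}(φ)` for all linear functions `ℓ` on the phase space. -/
def SatisfiesHamiltonAt (F : Phase H → ℂ) (φ : ℝ → Phase H) (t : ℝ) : Prop :=
  ∀ l : Module.Dual ℂ (Phase H), HasDerivAt (fun s => l (φ s)) (poisson l F (φ t)) t

/-! ## The Lax map and the operator `R` -/

/-- `L(q, p, ξ)(z) = p + (r₋^#(q) ξ)(z)`, where `⟨η, (r₋^#(q) ξ)(z)⟩ = ⟨η ⊗ ξ, r(q, z)⟩`. -/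
noncomputable def laxAt (r : Module.Dual ℂ H × ℂ → g ⊗[ℂ] g) (x : Phase H) (z : ℂ) : g :=
  (x.2.1 : g) + contrSnd x.2.2 (r (x.1, z))

/-- The Lax map with values in the loop algebra. -/
noncomputable def lax (r : Module.Dual ℂ H × ℂ → g ⊗[ℂ] g) (x : Phase H) : Loop g :=
  Loop.ofFun (laxAt r x)

/-- `1 / (2 π i)` times the integral of `⟨M(w) ⊗ 1, r(q, w - z)⟩ dw` over the part `|w - z| > ε` of
the circle `|w| = |z|`, positively oriented (in coordinates). -/
noncomputable def truncatedIntegral (r : Module.Dual ℂ H × ℂ → g ⊗[ℂ] g) (q : Module.Dual ℂ H)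
    (M : Loop (Module.Dual ℂ g)) (z : ℂ) (ε : ℝ) : Fin (Module.finrank ℂ g) → ℂ :=
  (2 * Real.pi * Complex.I : ℂ)⁻¹ • circleIntegral (fun w =>
    if ε < ‖w - z‖ then coords g (contrFst (M.eval w) (r (q, w - z))) else 0) 0 ‖z‖

/-- `(R_q M)(z) = v`, where `(R_q M)(z)` is the principal value of the integral of
`⟨M(w) ⊗ 1, r(q, w - z)⟩ dw / (2 π i)` over the circle `|w| = |z|`. -/
def HasValueR (r : Module.Dual ℂ H × ℂ → g ⊗[ℂ] g) (q : Module.Dual ℂ H)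
    (M : Loop (Module.Dual ℂ g)) (z : ℂ) (v : g) : Prop :=
  Tendsto (truncatedIntegral r q M z) (𝓝[>] 0) (𝓝 (coords g v))

/-- `(R_q M)(z)`. -/
noncomputable def opR (r : Module.Dual ℂ H × ℂ → g ⊗[ℂ] g) (q : Module.Dual ℂ H)
    (M : Loop (Module.Dual ℂ g)) (z : ℂ) : g :=
  (coords g).symm (limUnder (𝓝[>] (0 : ℝ)) (truncatedIntegral r q M z))

/-- `((𝒳_a R)(M))(z)` at `q`: the derivative of `q ↦ (R_q M)(z)` along `a`, for fixed `M`. -/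
noncomputable def derivOpR (r : Module.Dual ℂ H × ℂ → g ⊗[ℂ] g) (a q : Module.Dual ℂ H)
    (M : Loop (Module.Dual ℂ g)) (z : ℂ) : g :=
  derivZero fun s => opR r (q + s • a) M z

end LieAlgebra

/-!
Write `L = p + ⟨1 ⊗ ξ, r⟩` for the Lax map. Its Poisson brackets involve only the values and the
first derivatives of `r`, and the Yang-Baxter equation, contracted with `ξ` in the third tensor
factor, is the fundamental Poisson bracket relation at `p = 0`; the terms in `p` vanish because `r`
has weight zero.

For the flow of `f ∘ L`, write `M = df(L)`. The differential of `f ∘ L` at a point is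
`v ↦ Res ⟨M(w), L'(v)(w)⟩ dw`, so that `dL(z)/dt` is the integral over `|w| = σ < |z|` of the
fundamental bracket contracted with `M(w)`. Ad-invariance of `f` says that `M(w)` annihilates all
brackets with `L(w)`; one of the three terms of the bracket disappears, and the other two are
`[∮ ⟨M(w) ⊗ 1, r(w - z)⟩ dw, L(z)]` and the derivative of `∮ ⟨M(w) ⊗ 1, r(w - z)⟩ dw` along `i*ξ`.
Moving the contour to the principal value on `|w| = |z|` costs half of the residue at `w = z`, that
is `⟨M(z) ⊗ 1, Ω⟩ / 2`. This does not depend on `q`, and it commutes with `L(z)`, since `Ω`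
identifies `g*` with `g` through the Killing form and `M(z)` annihilates the brackets with `L(z)`.
-/

/-! ### Contractions of tensors -/

section TensorAlgebra

variable {g : Type*} [LieRing g] [LieAlgebra ℂ g]

@[simp] theorem contrFst_tmul (ξ : Module.Dual ℂ g) (a b : g) :
    contrFst ξ (a ⊗ₜ b) = ξ a • b := by
  simp [contrFst]

@[simp] theorem contrSnd_tmul (ξ : Module.Dual ℂ g) (a b : g) :
    contrSnd ξ (a ⊗ₜ b) = ξ b • a := by
  simp [contrSnd]

theorem apply_contrSnd (η ζ : Module.Dual ℂ g) (s : g ⊗[ℂ] g) :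
    η (contrSnd ζ s) = ζ (contrFst η s) := by
  induction s with
  | zero => simp
  | tmul a b => simp [mul_comm]
  | add a b ha hb => simp [ha, hb]

theorem contrSnd_flipTensor (ζ : Module.Dual ℂ g) (s : g ⊗[ℂ] g) :
    contrSnd ζ (flipTensor s) = contrFst ζ s := by
  unfold flipTensor
  induction s with
  | zero => simp
  | tmul a b => simp
  | add a b ha hb => simp [ha, hb]

variable (g) in
/-- The contraction of the first tensor factor, as a bilinear map. -/
noncomputable def contrFstHom : Module.Dual ℂ g →ₗ[ℂ] g ⊗[ℂ] g →ₗ[ℂ] g :=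
  LinearMap.compRight ℂ (TensorProduct.lid ℂ g).toLinearMap ∘ₗ LinearMap.rTensorHom g

variable (g) in
/-- The contraction of the second tensor factor, as a bilinear map. -/
noncomputable def contrSndHom : Module.Dual ℂ g →ₗ[ℂ] g ⊗[ℂ] g →ₗ[ℂ] g :=
  LinearMap.compRight ℂ (TensorProduct.rid ℂ g).toLinearMap ∘ₗ LinearMap.lTensorHom g

@[simp] theorem contrSndHom_apply (ξ : Module.Dual ℂ g) (s : g ⊗[ℂ] g) :
    contrSndHom g ξ s = contrSnd ξ s := rfl

@[simp] theorem contrSnd_zero_left (s : g ⊗[ℂ] g) : contrSnd (0 : Module.Dual ℂ g) s = 0 := by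
  rw [← contrSndHom_apply, map_zero, LinearMap.zero_apply]

theorem contrSnd_lieSlotOne (ζ : Module.Dual ℂ g) (s : g ⊗[ℂ] g) (X : g) :
    contrSnd ζ (lieSlotOne s X) = ⁅contrSnd ζ s, X⁆ := by
  unfold lieSlotOne
  induction s with
  | zero => simp
  | tmul a b => simp [← smul_neg]
  | add a b ha hb => simp only [map_add, neg_add, add_lie, ha, hb]

theorem contrSnd_lieSlotTwo_eq_zero {ζ : Module.Dual ℂ g} {X : g} (h : ∀ y : g, ζ ⁅y, X⁆ = 0)
    (s : g ⊗[ℂ] g) : contrSnd ζ (lieSlotTwo s X) = 0 := by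
  have h' (y : g) : ζ ⁅X, y⁆ = 0 := by rw [← lie_skew, map_neg, h, neg_zero]
  unfold lieSlotTwo
  induction s with
  | zero => simp
  | tmul a b => simp [h']
  | add a b ha hb => simp only [map_add, neg_add, ha, hb, add_zero]

/-- `a ⊗ b ⊗ c ↦ ξ(c) a ⊗ b`. -/
noncomputable def contrThird (ξ : Module.Dual ℂ g) : g ⊗[ℂ] (g ⊗[ℂ] g) →ₗ[ℂ] g ⊗[ℂ] g :=
  LinearMap.lTensor g (contrSnd ξ)

theorem contrThird_putFirst (ξ : Module.Dual ℂ g) (x : g) (s : g ⊗[ℂ] g) :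
    contrThird ξ (putFirst x s) = x ⊗ₜ contrSnd ξ s := by
  simp [contrThird, putFirst]

theorem contrThird_putSecond (ξ : Module.Dual ℂ g) (x : g) (s : g ⊗[ℂ] g) :
    contrThird ξ (putSecond x s) = contrSnd ξ s ⊗ₜ x := by
  unfold contrThird putSecond
  induction s with
  | zero => simp
  | tmul a b => simp [TensorProduct.smul_tmul]
  | add a b ha hb => simp only [map_add, ha, hb, TensorProduct.add_tmul]

theorem contrThird_putThird (ξ : Module.Dual ℂ g) (x : g) (s : g ⊗[ℂ] g) :
    contrThird ξ (putThird x s) = ξ x • s := by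
  unfold contrThird putThird
  induction s with
  | zero => simp
  | tmul a b => simp
  | add a b ha hb => simp only [map_add, ha, hb, smul_add]

theorem contrThird_lie1213 (ξ : Module.Dual ℂ g) (s t : g ⊗[ℂ] g) :
    contrThird ξ (lie1213 s t) = lieSlotOne s (contrSnd ξ t) := by
  unfold contrThird lie1213 lieSlotOne
  induction s with
  | zero => simp
  | add a b ha hb => simp only [map_add, LinearMap.add_apply, ha, hb, neg_add]
  | tmul a b =>
    induction t with
    | zero => simp
    | add c d hc hd =>
      simp only [map_add, LinearMap.rTensor_add, LinearMap.add_apply, hc, hd, neg_add]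
    | tmul c d =>
      have hskew : ⁅a, c⁆ ⊗ₜ[ℂ] b = -(⁅c, a⁆ ⊗ₜ[ℂ] b) := by
        rw [← lie_skew a c, TensorProduct.neg_tmul]
      simp [hskew, LinearMap.rTensor_smul]

theorem contrThird_lie1223 (ξ : Module.Dual ℂ g) (s t : g ⊗[ℂ] g) :
    contrThird ξ (lie1223 s t) = lieSlotTwo s (contrSnd ξ t) := by
  unfold contrThird lie1223 lieSlotTwo
  induction s with
  | zero => simp
  | add a b ha hb => simp only [map_add, ha, hb, neg_add]
  | tmul a b =>
    induction t with
    | zero => simp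
    | add c d hc hd =>
      simp only [map_add, LinearMap.lTensor_add, LinearMap.add_apply, hc, hd, neg_add]
    | tmul c d =>
      have hskew : a ⊗ₜ[ℂ] ⁅b, c⁆ = -(a ⊗ₜ[ℂ] ⁅c, b⁆) := by
        rw [← lie_skew b c, TensorProduct.tmul_neg]
      simp [hskew]

theorem apply_contrSnd_contrThird_lie1323 (ξ η ζ : Module.Dual ℂ g) (s t : g ⊗[ℂ] g) :
    η (contrSnd ζ (contrThird ξ (lie1323 s t))) = ξ ⁅contrFst η s, contrFst ζ t⁆ := by
  unfold contrThird lie1323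
  induction s with
  | zero => simp
  | add a b ha hb => simp only [map_add, ha, hb, add_lie]
  | tmul a b =>
    induction t with
    | zero => simp
    | add c d hc hd =>
      simp only [map_add, LinearMap.lTensor_add, LinearMap.add_apply, hc, hd, lie_add]
    | tmul c d =>
      simp
      ring

theorem lie_tensor_eq_neg_lieSlot_add (s : g ⊗[ℂ] g) (x : g) :
    ⁅x, s⁆ = -(lieSlotOne s x + lieSlotTwo s x) := by
  unfold lieSlotOne lieSlotTwo
  induction s with
  | zero => simp
  | tmul a b => simp [add_comm]
  | add a b ha hb => simp only [map_add, lie_add, ha, hb]; abel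

theorem lieSlotOne_add (s : g ⊗[ℂ] g) (x y : g) :
    lieSlotOne s (x + y) = lieSlotOne s x + lieSlotOne s y := by
  simp only [lieSlotOne, map_add, LinearMap.rTensor_add, LinearMap.add_apply, neg_add]

theorem lieSlotTwo_add (s : g ⊗[ℂ] g) (x y : g) :
    lieSlotTwo s (x + y) = lieSlotTwo s x + lieSlotTwo s y := by
  simp only [lieSlotTwo, map_add, LinearMap.lTensor_add, LinearMap.add_apply, neg_add]

variable [FiniteDimensional ℂ g]

theorem sum_apply_contrSnd_coord_smul (η : Module.Dual ℂ g) (s : g ⊗[ℂ] g) :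
    ∑ a, η (contrSnd ((Module.finBasis ℂ g).coord a) s) • Module.finBasis ℂ g a
      = contrFst η s := by
  simp only [apply_contrSnd]
  exact (Module.finBasis ℂ g).sum_repr _

theorem sum_coord_contrSnd_coord_smul_tmul (s : g ⊗[ℂ] g) :
    ∑ a, ∑ b, ((Module.finBasis ℂ g).coord a (contrSnd ((Module.finBasis ℂ g).coord b) s)) •
      (Module.finBasis ℂ g a ⊗ₜ[ℂ] Module.finBasis ℂ g b) = s := by
  induction s with
  | zero => simp
  | add s t hs ht => simp only [map_add, add_smul, Finset.sum_add_distrib, hs, ht]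
  | tmul x y =>
    conv_rhs => rw [← (Module.finBasis ℂ g).sum_repr x, ← (Module.finBasis ℂ g).sum_repr y]
    rw [Finset.sum_comm]
    simp only [contrSnd_tmul, map_smul, Module.Basis.coord_apply, TensorProduct.sum_tmul,
      TensorProduct.tmul_sum, TensorProduct.smul_tmul_smul, smul_eq_mul, mul_comm]

variable [LieAlgebra.IsSimple ℂ g]

theorem killingForm_contrFst_casimir (ζ : Module.Dual ℂ g) :
    killingForm ℂ g (contrFst ζ (casimir g)) = ζ := by
  refine (Module.finBasis ℂ g).ext fun j => ?_
  simp [casimir, LinearMap.BilinForm.apply_dualBasis_left]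

theorem lie_contrFst_casimir_eq_zero {ζ : Module.Dual ℂ g} {X : g} (h : ∀ y : g, ζ ⁅y, X⁆ = 0) :
    ⁅contrFst ζ (casimir g), X⁆ = 0 := by
  refine (LieAlgebra.IsKilling.killingForm_nondegenerate ℂ g).1 _ fun y => ?_
  rw [LieModule.traceForm_apply_lie_apply]
  calc killingForm ℂ g (contrFst ζ (casimir g)) ⁅X, y⁆ = ζ ⁅X, y⁆ := by
        rw [killingForm_contrFst_casimir]
    _ = 0 := by rw [← lie_skew, map_neg, h, neg_zero]

end TensorAlgebra

/-! ### The Poisson brackets of maps of Lax type -/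

section PoissonAlgebra

variable {g : Type*} [LieRing g] [LieAlgebra ℂ g] {H : LieSubalgebra ℂ g}

theorem hasDerivAt_const_add_smul {E : Type*} [NormedAddCommGroup E] [NormedSpace ℂ E] (x v : E) :
    HasDerivAt (fun s : ℂ => x + s • v) v 0 := by
  simpa using ((hasDerivAt_id (0 : ℂ)).smul_const v).const_add x

theorem dirDeriv_dual (l : Module.Dual ℂ (Phase H)) (x v : Phase H) : dirDeriv l x v = l v := by
  simp [dirDeriv]

/-- The derivative of `(q, p, ξ) ↦ p + ⟨1 ⊗ ξ, r(q)⟩` at a point with `g*`-component `ξ` where `r`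
has the value `s` and the derivative `ds`. -/
noncomputable def laxDeriv (ξ : Module.Dual ℂ g) (s : g ⊗[ℂ] g)
    (ds : Module.Dual ℂ H →ₗ[ℂ] g ⊗[ℂ] g) : Phase H →ₗ[ℂ] g :=
  (H.subtype : H →ₗ[ℂ] g) ∘ₗ LinearMap.fst ℂ _ _ ∘ₗ LinearMap.snd ℂ _ _
    + (contrSndHom g).flip s ∘ₗ LinearMap.snd ℂ _ _ ∘ₗ LinearMap.snd ℂ _ _
    + contrSnd ξ ∘ₗ ds ∘ₗ LinearMap.fst ℂ _ _

theorem laxDeriv_apply (ξ : Module.Dual ℂ g) (s : g ⊗[ℂ] g)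
    (ds : Module.Dual ℂ H →ₗ[ℂ] g ⊗[ℂ] g) (v : Phase H) :
    laxDeriv ξ s ds v = (v.2.1 : g) + contrSnd v.2.2 s + contrSnd ξ (ds v.1) := rfl

variable [FiniteDimensional ℂ g]

theorem poisson_congr {F F' G G' : Phase H → ℂ} {x : Phase H}
    (hF : ∀ v, dirDeriv F x v = dirDeriv F' x v) (hG : ∀ v, dirDeriv G x v = dirDeriv G' x v) :
    poisson F G x = poisson F' G' x := by
  simp only [poisson, dP, dQ, gradXi, hF, hG]

/-- The tensor `{L₁, L₂}` of the Poisson brackets of two maps with derivatives `laxDeriv ξ s ds` and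
`laxDeriv ξ t dt`. -/
noncomputable def laxBracket (ξ : Module.Dual ℂ g) (s t : g ⊗[ℂ] g)
    (ds dt : Module.Dual ℂ H →ₗ[ℂ] g ⊗[ℂ] g) : g ⊗[ℂ] g :=
  ∑ i, ((Module.finBasis ℂ H i : g) ⊗ₜ contrSnd ξ (dt ((Module.finBasis ℂ H).coord i))
    - contrSnd ξ (ds ((Module.finBasis ℂ H).coord i)) ⊗ₜ (Module.finBasis ℂ H i : g))
    + contrThird ξ (lie1323 s t)

theorem poisson_laxDeriv (η ζ : Module.Dual ℂ g) (x : Phase H) (s t : g ⊗[ℂ] g)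
    (ds dt : Module.Dual ℂ H →ₗ[ℂ] g ⊗[ℂ] g) :
    poisson (η ∘ₗ laxDeriv x.2.2 s ds) (ζ ∘ₗ laxDeriv x.2.2 t dt) x
      = η (contrSnd ζ (laxBracket x.2.2 s t ds dt)) := by
  simp only [poisson, dP, dQ, gradXi, dirDeriv_dual, LinearMap.comp_apply, laxDeriv_apply, map_zero,
    contrSnd_zero_left, add_zero, zero_add, ZeroMemClass.coe_zero, sum_apply_contrSnd_coord_smul,
    laxBracket, map_add, map_sum, map_sub, contrSnd_tmul, apply_contrSnd_contrThird_lie1323,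
    map_smul, smul_eq_mul]
  congr! 2
  ring

theorem poissonTensor_eq_laxBracket {F G : Phase H → g} {x : Phase H} {s t : g ⊗[ℂ] g}
    {ds dt : Module.Dual ℂ H →ₗ[ℂ] g ⊗[ℂ] g}
    (hF : ∀ (η : Module.Dual ℂ g) v, dirDeriv (fun y => η (F y)) x v
      = η (laxDeriv x.2.2 s ds v))
    (hG : ∀ (η : Module.Dual ℂ g) v, dirDeriv (fun y => η (G y)) x v
      = η (laxDeriv x.2.2 t dt v)) :
    poissonTensor F G x = laxBracket x.2.2 s t ds dt := by
  rw [← sum_coord_contrSnd_coord_smul_tmul (laxBracket x.2.2 s t ds dt)]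
  refine Finset.sum_congr rfl fun a _ => Finset.sum_congr rfl fun b _ => ?_
  rw [← poisson_laxDeriv]
  congr 1
  exact poisson_congr
    (fun v => (hF _ v).trans
      (dirDeriv_dual ((Module.finBasis ℂ g).coord a ∘ₗ laxDeriv x.2.2 s ds) x v).symm)
    (fun v => (hG _ v).trans
      (dirDeriv_dual ((Module.finBasis ℂ g).coord b ∘ₗ laxDeriv x.2.2 t dt) x v).symm)

theorem sum_apply_finBasis_smul_coord (ξ : Module.Dual ℂ g) :
    ∑ i, ξ (Module.finBasis ℂ H i : g) • (Module.finBasis ℂ H).coord i = restrictDual H ξ :=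
  (Module.finBasis ℂ H).sum_dual_apply_smul_coord (restrictDual H ξ)

/-- The contraction of the Yang-Baxter equation `hyb` with `ξ` in the third factor. -/
theorem laxBracket_eq_of_yangBaxter {p : H} (ξ : Module.Dual ℂ g) {s t u : g ⊗[ℂ] g}
    {ds dt du : Module.Dual ℂ H →ₗ[ℂ] g ⊗[ℂ] g} (hu : ⁅(p : g), u⁆ = 0)
    (hyb : (∑ i, (putFirst (Module.finBasis ℂ H i : g) (dt ((Module.finBasis ℂ H).coord i))
        - putSecond (Module.finBasis ℂ H i : g) (ds ((Module.finBasis ℂ H).coord i))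
        + putThird (Module.finBasis ℂ H i : g) (du ((Module.finBasis ℂ H).coord i))))
      + lie1213 u s + lie1223 u t + lie1323 s t = 0) :
    laxBracket ξ s t ds dt = -(lieSlotOne u (p + contrSnd ξ s) + lieSlotTwo u (p + contrSnd ξ t))
      - du (restrictDual H ξ) := by
  have hcontr := congrArg (contrThird ξ) hyb
  simp only [map_add, map_sum, map_sub, map_zero, contrThird_putFirst, contrThird_putSecond,
    contrThird_putThird, contrThird_lie1213, contrThird_lie1223] at hcontr
  have hdu : du (restrictDual H ξ)
      = ∑ i, ξ (Module.finBasis ℂ H i : g) • du ((Module.finBasis ℂ H).coord i) := by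
    simp only [← sum_apply_finBasis_smul_coord, map_sum, map_smul]
  rw [lie_tensor_eq_neg_lieSlot_add, neg_eq_zero] at hu
  rw [Finset.sum_add_distrib, ← hdu] at hcontr
  rw [laxBracket, lieSlotOne_add, lieSlotTwo_add, eq_comm, ← sub_eq_zero, ← neg_eq_zero, ← hcontr,
    ← sub_eq_zero, ← hu]
  abel

end PoissonAlgebra

/-! ### Laurent series on circles -/

section Laurent

open Complex Metric

variable {E : Type*} [NormedAddCommGroup E] [NormedSpace ℂ E]
  {E₁ E₂ : Type*} [NormedAddCommGroup E₁] [NormedSpace ℂ E₁]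
  [NormedAddCommGroup E₂] [NormedSpace ℂ E₂]

theorem hasSum_int_iff_hasSum_nat {E : Type*} [AddCommMonoid E] [TopologicalSpace E]
    {f : ℤ → E} {N : ℤ} (h : ∀ k < -N, f k = 0) {a : E} :
    HasSum f a ↔ HasSum (fun n : ℕ => f (n - N)) a := by
  have hinj : Function.Injective fun n : ℕ => (n : ℤ) - N := fun a b h => by simpa using h
  refine (hinj.hasSum_iff fun k hk => h k ?_).symm
  by_contra! hle
  exact hk ⟨(k + N).toNat, by simp only; lia⟩

theorem hasSum_zpow_smul_of_hasSum_pow_smul {a : ℕ → E} {z : ℂ} (hz : z ≠ 0) {v : E}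
    (h : HasSum (fun n : ℕ => z ^ n • a n) (z • v)) :
    HasSum (fun k : ℤ => z ^ k • if -1 ≤ k then a (k + 1).toNat else 0) v := by
  rw [hasSum_int_iff_hasSum_nat (N := 1) fun k hk => by rw [if_neg (not_le.mpr hk), smul_zero]]
  rw [← inv_smul_smul₀ hz v]
  refine (h.const_smul z⁻¹).congr_fun fun n => ?_
  rw [if_pos (by lia), sub_add_cancel, Int.toNat_natCast, smul_smul, zpow_sub₀ hz, zpow_natCast,
    zpow_one, div_eq_inv_mul]

theorem exists_laurent_of_bounded_smul [CompleteSpace E] {F : ℂ → E} {R : ℝ}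
    (hd : ∀ z, 0 < ‖z‖ → ‖z‖ < R → DifferentiableAt ℂ F z) {C : ℝ}
    (hb : ∀ᶠ z in 𝓝[≠] (0 : ℂ), ‖z • F z‖ ≤ C) :
    ∃ c : ℤ → E, (∀ n < -1, c n = 0) ∧
      ∀ z, 0 < ‖z‖ → ‖z‖ < R → HasSum (fun n : ℤ => z ^ n • c n) (F z) := by
  rcases le_or_gt R 0 with hR | hR
  · exact ⟨0, fun _ _ => rfl, fun z h0 h1 => absurd (h0.trans h1) (not_lt.mpr hR)⟩
  set G : ℂ → E := fun z => z • F z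
  set G₁ := Function.update G 0 (limUnder (𝓝[≠] 0) G) with hG₁
  have hd₁ : DifferentiableOn ℂ G₁ (ball 0 R) := by
    refine differentiableOn_update_limUnder_of_isLittleO (ball_mem_nhds 0 hR) (fun z hz => ?_)
      (IsBoundedUnder.isLittleO_sub_self_inv ⟨C + ‖G 0‖, ?_⟩)
    · exact (differentiableAt_id.smul (hd z (norm_pos_iff.mpr hz.2)
        (mem_ball_zero_iff.mp hz.1))).differentiableWithinAt
    · exact eventually_map.mpr (hb.mono fun z hz => norm_sub_le_of_le hz le_rfl)
  refine ⟨fun k => if -1 ≤ k then ((((k + 1).toNat).factorial : ℂ)⁻¹ •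
    iteratedDeriv (k + 1).toNat G₁ 0) else 0, fun n hn => if_neg (not_le.mpr hn), fun z h0 h1 => ?_⟩
  have hz0 : z ≠ 0 := norm_pos_iff.mp h0
  refine hasSum_zpow_smul_of_hasSum_pow_smul
    (a := fun n => (n.factorial : ℂ)⁻¹ • iteratedDeriv n G₁ 0) hz0 ?_
  have htaylor := hasSum_taylorSeries_on_ball hd₁ (mem_ball_zero_iff.mpr h1)
  rw [hG₁, Function.update_of_ne hz0] at htaylor
  exact htaylor.congr_fun fun n => by rw [sub_zero, smul_comm]

theorem norm_deriv_circleMap (c : ℂ) (R θ : ℝ) : ‖deriv (circleMap c R) θ‖ = |R| := by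
  simp

theorem continuous_deriv_circleMap (c : ℂ) (R : ℝ) : Continuous (deriv (circleMap c R)) :=
  (contDiff_circleMap c R).continuous_deriv le_rfl

theorem hasSum_circleIntegral {ι : Type*} [Countable ι] {f : ι → ℂ → E} {F : ℂ → E}
    {s : ℝ} (hs : 0 ≤ s) {u : ι → ℝ} (hu : Summable u)
    (hc : ∀ n, ContinuousOn (f n) (sphere 0 s)) (hb : ∀ n, ∀ z ∈ sphere (0 : ℂ) s, ‖f n z‖ ≤ u n)
    (hF : ∀ z ∈ sphere (0 : ℂ) s, HasSum (fun n => f n z) (F z)) :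
    HasSum (fun n => ∮ z in C(0, s), f n z) (∮ z in C(0, s), F z) := by
  have hm : ∀ θ, circleMap 0 s θ ∈ sphere (0 : ℂ) s := circleMap_mem_sphere _ hs
  refine intervalIntegral.hasSum_integral_of_dominated_convergence (fun n _ => s * u n)
    (fun n => ((hc n).circleIntegrable hs).out.aestronglyMeasurable_restrict_uIoc)
    (fun n => .of_forall fun θ _ => ?_) (.of_forall fun θ _ => hu.mul_left _)
    intervalIntegrable_const (.of_forall fun θ _ => (hF _ (hm θ)).const_smul _)
  rw [norm_smul, norm_deriv_circleMap, abs_of_nonneg hs]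
  exact mul_le_mul_of_nonneg_left (hb n _ (hm θ)) hs

theorem circleIntegral_clm_comp_comm [CompleteSpace E₁] [CompleteSpace E₂] (A : E₁ →L[ℂ] E₂)
    {f : ℂ → E₁} {c : ℂ} {R : ℝ} (hf : CircleIntegrable f c R) :
    (∮ z in C(c, R), A (f z)) = A (∮ z in C(c, R), f z) := by
  unfold circleIntegral
  rw [← ContinuousLinearMap.intervalIntegral_comp_comm _ hf.out]
  simp only [map_smul]

theorem circleIntegral_zpow {s : ℝ} (hs : s ≠ 0) (n : ℤ) :
    (∮ z in C(0, s), z ^ n) = if n = -1 then 2 * Real.pi * I else 0 := by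
  split_ifs with h
  · subst h
    simpa using circleIntegral.integral_sub_center_inv (0 : ℂ) hs
  · simpa using circleIntegral.integral_sub_zpow_of_ne h 0 0 s

theorem norm_zpow_smul_of_mem_sphere {s : ℝ} {z : ℂ} (hz : z ∈ sphere (0 : ℂ) s) (n : ℤ) (v : E) :
    ‖z ^ n • v‖ = ‖v‖ * s ^ n := by
  rw [norm_smul, norm_zpow, mem_sphere_zero_iff_norm.mp hz, mul_comm]

theorem continuousOn_zpow_sphere {s : ℝ} (hs : s ≠ 0) (n : ℤ) :
    ContinuousOn (fun z : ℂ => z ^ n) (sphere 0 s) := fun z hz =>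
  (continuousAt_zpow₀ z n (Or.inl (ne_of_mem_sphere hz hs))).continuousWithinAt

theorem zpow_le_zpow_add_zpow {a b x : ℝ} (ha : 0 < a) (hax : a ≤ x) (hxb : x ≤ b) (n : ℤ) :
    x ^ n ≤ a ^ n + b ^ n := by
  have hx : 0 < x := ha.trans_le hax
  rcases le_total 0 n with hn | hn
  · exact (zpow_le_zpow_left₀ hn hx.le hxb).trans (le_add_of_nonneg_left (zpow_nonneg ha.le n))
  · refine le_add_of_le_of_nonneg ?_ (zpow_nonneg (hx.le.trans hxb) n)
    have := zpow_le_zpow_left₀ (neg_nonneg.mpr hn) ha.le hax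
    rwa [zpow_neg, zpow_neg, inv_le_inv₀ (zpow_pos ha n) (zpow_pos hx n)] at this

/-- The Laurent series with coefficients `c` converges absolutely on the circle `|z| = s`, and its
sum is `F` there. -/
structure HasLaurentSumOn (c : ℤ → E) (F : ℂ → E) (s : ℝ) : Prop where
  summable : Summable fun n => ‖c n‖ * s ^ n
  hasSum : ∀ z ∈ sphere (0 : ℂ) s, HasSum (fun n : ℤ => z ^ n • c n) (F z)

namespace HasLaurentSumOn

variable {c : ℤ → E} {F : ℂ → E} {s : ℝ}

theorem continuousOn [CompleteSpace E] (h : HasLaurentSumOn c F s) (hs : s ≠ 0) :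
    ContinuousOn F (sphere 0 s) :=
  (continuousOn_tsum (f := fun (n : ℤ) (z : ℂ) => z ^ n • c n)
    (fun n => (continuousOn_zpow_sphere hs n).smul continuousOn_const) h.summable
    fun n _ hz => (norm_zpow_smul_of_mem_sphere hz n _).le).congr
      fun z hz => (h.hasSum z hz).tsum_eq.symm

theorem norm_le (h : HasLaurentSumOn c F s) {z : ℂ} (hz : z ∈ sphere (0 : ℂ) s) :
    ‖F z‖ ≤ ∑' n, ‖c n‖ * s ^ n := by
  rw [← (h.hasSum z hz).tsum_eq]
  exact tsum_of_norm_bounded h.summable.hasSum fun n => (norm_zpow_smul_of_mem_sphere hz n _).le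

theorem circleIntegral_zpow_smul [CompleteSpace E] (h : HasLaurentSumOn c F s) (hs : 0 < s)
    (n : ℤ) : (∮ z in C(0, s), z ^ n • F z) = (2 * Real.pi * I : ℂ) • c (-1 - n) := by
  have hsum := hasSum_circleIntegral (f := fun m z => z ^ n • z ^ m • c m)
    (F := fun z => z ^ n • F z) hs.le (h.summable.mul_left (s ^ n))
    (fun m => (continuousOn_zpow_sphere hs.ne' n).smul
      ((continuousOn_zpow_sphere hs.ne' m).smul continuousOn_const))
    (fun m z hz => by
      rw [norm_zpow_smul_of_mem_sphere hz, norm_zpow_smul_of_mem_sphere hz, mul_comm])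
    (fun z hz => (h.hasSum z hz).const_smul _)
  have hterm : ∀ m, (∮ z in C(0, s), z ^ n • z ^ m • c m)
      = if m = -1 - n then (2 * Real.pi * I : ℂ) • c (-1 - n) else 0 := fun m => by
    have hadd : (∮ z in C(0, s), z ^ n • z ^ m • c m) = ∮ z in C(0, s), z ^ (n + m) • c m :=
      circleIntegral.integral_congr hs.le fun z hz => by
        simp only [smul_smul, zpow_add₀ (ne_of_mem_sphere hz hs.ne')]
    rw [hadd, circleIntegral.integral_smul_const, circleIntegral_zpow hs.ne']
    by_cases hm : m = -1 - n
    · subst hm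
      simp
    · rw [if_neg hm, if_neg (by lia), zero_smul]
  simp only [hterm] at hsum
  exact hsum.unique (hasSum_ite_eq _ _)

theorem hasSum_circleIntegral_bilin [CompleteSpace E₁] [CompleteSpace E₂]
    (B : E →L[ℂ] E₁ →L[ℂ] E₂) {d : ℤ → E₁} {G : ℂ → E₁} (hF : HasLaurentSumOn c F s)
    (hG : HasLaurentSumOn d G s) (hs : 0 < s) :
    HasSum (fun n : ℤ => (2 * Real.pi * I : ℂ) • B (c n) (d (-1 - n)))
      (∮ z in C(0, s), B (F z) (G z)) := by
  have hcont : ∀ n : ℤ, ContinuousOn (fun z => z ^ n • G z) (sphere 0 s) := fun n =>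
    (continuousOn_zpow_sphere hs.ne' n).smul (hG.continuousOn hs.ne')
  have hbound : ∀ n, ∀ z ∈ sphere (0 : ℂ) s, ‖B (c n) (z ^ n • G z)‖
      ≤ ‖B‖ * (∑' n, ‖d n‖ * s ^ n) * (‖c n‖ * s ^ n) := fun n z hz =>
    calc ‖B (c n) (z ^ n • G z)‖ ≤ ‖B‖ * ‖c n‖ * ‖z ^ n • G z‖ := B.le_opNorm₂ _ _
      _ = ‖B‖ * ‖c n‖ * (‖G z‖ * s ^ n) := by rw [norm_zpow_smul_of_mem_sphere hz]
      _ ≤ ‖B‖ * ‖c n‖ * ((∑' n, ‖d n‖ * s ^ n) * s ^ n) := by gcongr; exact hG.norm_le hz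
      _ = _ := by ring
  have h := hasSum_circleIntegral (f := fun (n : ℤ) z => B (c n) (z ^ n • G z))
    (F := fun z => B (F z) (G z)) hs.le (hF.summable.mul_left _)
    (fun n => (B (c n)).continuous.comp_continuousOn (hcont n)) hbound
    (fun z hz => by simpa using (B.flip (G z)).hasSum (hF.hasSum z hz))
  refine h.congr_fun fun n => ?_
  rw [circleIntegral_clm_comp_comm _ ((hcont n).circleIntegrable hs.le),
    hG.circleIntegral_zpow_smul hs, map_smul]

end HasLaurentSumOn

theorem differentiableAt_of_hasLaurentSumOn [CompleteSpace E] {c : ℤ → E} {F : ℂ → E} {ρ : ℝ}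
    (h : ∀ s, 0 < s → s < ρ → HasLaurentSumOn c F s) {z : ℂ} (h0 : 0 < ‖z‖) (h1 : ‖z‖ < ρ) :
    DifferentiableAt ℂ F z := by
  obtain ⟨a, ha0, ha⟩ := exists_between h0
  obtain ⟨b, hb, hb1⟩ := exists_between h1
  set U : Set ℂ := {w | a < ‖w‖ ∧ ‖w‖ < b}
  have hU : IsOpen U := (isOpen_lt continuous_const continuous_norm).inter
    (isOpen_lt continuous_norm continuous_const)
  have hsum := (h a ha0 (ha.trans h1)).summable.add (h b (h0.trans hb) hb1).summable
  have hd : DifferentiableOn ℂ (fun w => ∑' n : ℤ, w ^ n • c n) U := by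
    refine differentiableOn_tsum_of_summable_norm hsum (fun n w hw => ?_) hU fun n w hw => ?_
    · exact ((differentiableAt_zpow.mpr (Or.inl (norm_pos_iff.mp (ha0.trans hw.1)))).smul_const
        _).differentiableWithinAt
    · rw [norm_smul, norm_zpow, mul_comm, ← mul_add]
      exact mul_le_mul_of_nonneg_left (zpow_le_zpow_add_zpow ha0 hw.1.le hw.2.le n)
        (norm_nonneg _)
  refine (hd.differentiableAt (hU.mem_nhds ⟨ha, hb⟩)).congr_of_eventuallyEq ?_
  filter_upwards [hU.mem_nhds ⟨ha, hb⟩] with w hw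
  exact ((h ‖w‖ (ha0.trans hw.1) (hw.2.trans hb1)).hasSum w
    (mem_sphere_zero_iff_norm.mpr rfl)).tsum_eq.symm

end Laurent

/-! ### Principal values on circles -/

section PrincipalValue

open Complex Metric MeasureTheory

variable {E : Type*} [NormedAddCommGroup E]

theorem ae_circleMap_ne {z : ℂ} (hz : z ≠ 0) : ∀ᵐ θ : ℝ, circleMap 0 ‖z‖ θ ≠ z :=
  ((Set.countable_singleton z).preimage_circleMap 0 (norm_ne_zero_iff.mpr hz)).ae_notMem volume

theorem measurableSet_lt_norm_circleMap_sub (c z : ℂ) (R ε : ℝ) :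
    MeasurableSet {θ : ℝ | ε < ‖circleMap c R θ - z‖} :=
  (isOpen_lt continuous_const ((continuous_circleMap c R).sub continuous_const).norm).measurableSet

theorem circleIntegrable_truncate {k : ℂ → E} {c : ℂ} {R : ℝ} (hk : CircleIntegrable k c R)
    (z : ℂ) (ε : ℝ) : CircleIntegrable (fun w => if ε < ‖w - z‖ then k w else 0) c R := by
  rw [CircleIntegrable, intervalIntegrable_iff] at hk ⊢
  exact (hk.indicator (measurableSet_lt_norm_circleMap_sub c z R ε)).congr
    (ae_of_all _ fun _ => rfl)

theorem circleIntegrable_truncate_inv (c z : ℂ) (R : ℝ) {ε : ℝ} (hε : 0 < ε) :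
    CircleIntegrable (fun w => if ε < ‖w - z‖ then (w - z)⁻¹ else 0) c R := by
  refine (intervalIntegrable_const (c := ε⁻¹)).mono_fun (Measurable.aestronglyMeasurable ?_)
    (ae_of_all _ fun θ => ?_)
  · exact Measurable.ite (measurableSet_lt_norm_circleMap_sub c z R ε)
      ((measurable_circleMap c R).sub_const z).inv measurable_const
  · beta_reduce
    rw [Real.norm_of_nonneg (inv_nonneg.mpr hε.le)]
    split_ifs with h
    · rw [norm_inv]
      exact inv_anti₀ hε h.le
    · simpa using hε.le

variable [NormedSpace ℂ E]

theorem tendsto_circleIntegral_truncate {k : ℂ → E} {z : ℂ} (hz : z ≠ 0)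
    (hk : CircleIntegrable k 0 ‖z‖) :
    Tendsto (fun ε : ℝ => ∮ w in C(0, ‖z‖), if ε < ‖w - z‖ then k w else 0) (𝓝[>] 0)
      (𝓝 (∮ w in C(0, ‖z‖), k w)) := by
  refine intervalIntegral.tendsto_integral_filter_of_dominated_convergence
    (fun θ => ‖deriv (circleMap 0 ‖z‖) θ • k (circleMap 0 ‖z‖ θ)‖)
    (.of_forall fun ε => (circleIntegrable_truncate hk z ε).out.aestronglyMeasurable_restrict_uIoc)
    (.of_forall fun ε => .of_forall fun θ _ => ?_) hk.out.norm ?_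
  · beta_reduce
    split_ifs with h
    · exact le_rfl
    · rw [smul_zero, norm_zero]
      exact norm_nonneg _
  · filter_upwards [ae_circleMap_ne hz] with θ hθ _
    refine tendsto_const_nhds.congr' ?_
    filter_upwards [nhdsWithin_le_nhds (Iio_mem_nhds (norm_pos_iff.mpr (sub_ne_zero.mpr hθ)))]
      with ε hε
    rw [if_pos (Set.mem_Iio.mp hε)]

/-- The substitution `w ↦ z ^ 2 / w`, the reflection of the circle `|w| = |z|` in its diameter
through `z`. -/
theorem circleIntegral_eq_circleIntegral_reflect {z : ℂ} (hz : z ≠ 0) (f : ℂ → E) :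
    (∮ w in C(0, ‖z‖), f w) = ∮ w in C(0, ‖z‖), (z / w) ^ 2 • f (z ^ 2 / w) := by
  set F : ℝ → E := fun θ => deriv (circleMap 0 ‖z‖) θ • f (circleMap 0 ‖z‖ θ) with hF
  have hper : Function.Periodic F (2 * Real.pi) := fun θ => by
    simp only [hF, deriv_circleMap, periodic_circleMap 0 ‖z‖ θ]
  have hreflect : ∀ θ, circleMap 0 ‖z‖ (2 * arg z - θ) = z ^ 2 / circleMap 0 ‖z‖ θ := fun θ => by
    rw [eq_div_iff (circleMap_ne_center (norm_ne_zero_iff.mpr hz))]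
    conv_rhs => rw [← norm_mul_exp_arg_mul_I z]
    simp only [circleMap, zero_add]
    rw [mul_mul_mul_comm, ← exp_add, mul_pow, ← exp_nat_mul, ← sq]
    congr 2
    push_cast
    ring
  have hpoint : ∀ θ, F (2 * arg z - θ) = deriv (circleMap 0 ‖z‖) θ •
      (z / circleMap 0 ‖z‖ θ) ^ 2 • f (z ^ 2 / circleMap 0 ‖z‖ θ) := fun θ => by
    have h0 : circleMap 0 ‖z‖ θ ≠ 0 := circleMap_ne_center (norm_ne_zero_iff.mpr hz)
    simp only [hF, deriv_circleMap, hreflect, smul_smul]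
    congr 1
    field_simp
  calc (∮ w in C(0, ‖z‖), f w) = ∫ θ in (0 : ℝ)..2 * Real.pi, F θ := rfl
    _ = ∫ θ in (0 : ℝ)..2 * Real.pi, F (2 * arg z - θ) := by
      rw [intervalIntegral.integral_comp_sub_left F (2 * arg z)]
      simpa using hper.intervalIntegral_add_eq 0 (2 * arg z - 2 * Real.pi)
    _ = ∮ w in C(0, ‖z‖), (z / w) ^ 2 • f (z ^ 2 / w) := by
      simp only [hpoint, circleIntegral]

theorem circleIntegral_truncate_inv {z : ℂ} (hz : z ≠ 0) {ε : ℝ} (hε : 0 < ε) :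
    (∮ w in C(0, ‖z‖), if ε < ‖w - z‖ then (w - z)⁻¹ else 0)
      = 2⁻¹ * ∮ w in C(0, ‖z‖), if ε < ‖w - z‖ then w⁻¹ else 0 := by
  have hz' : 0 < ‖z‖ := norm_pos_iff.mpr hz
  have hreflect : Set.EqOn
      (fun w => (z / w) ^ 2 • if ε < ‖z ^ 2 / w - z‖ then (z ^ 2 / w - z)⁻¹ else 0)
      (fun w => (if ε < ‖w - z‖ then w⁻¹ else 0) - if ε < ‖w - z‖ then (w - z)⁻¹ else 0)
      (sphere 0 ‖z‖) := fun w hw => by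
    have hw0 : w ≠ 0 := ne_of_mem_sphere hw hz'.ne'
    have hsub : z ^ 2 / w - z = -(z / w) * (w - z) := by field_simp; ring
    have hnorm : ‖z ^ 2 / w - z‖ = ‖w - z‖ := by
      rw [hsub, norm_mul, norm_neg, norm_div, mem_sphere_zero_iff_norm.mp hw, div_self hz'.ne',
        one_mul]
    simp only [hnorm]
    split_ifs with h
    · have hne : w - z ≠ 0 := norm_pos_iff.mp (hε.trans h)
      rw [hsub, smul_eq_mul]
      field_simp
      ring
    · simp
  have hinv : CircleIntegrable (fun w : ℂ => w⁻¹) 0 ‖z‖ :=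
    (by simpa using continuousOn_zpow_sphere hz'.ne' (-1) :
      ContinuousOn (fun w : ℂ => w⁻¹) (sphere 0 ‖z‖)).circleIntegrable hz'.le
  have hsymm := circleIntegral_eq_circleIntegral_reflect hz
    fun w => if ε < ‖w - z‖ then (w - z)⁻¹ else 0
  rw [circleIntegral.integral_congr hz'.le hreflect, circleIntegral.integral_sub
    (circleIntegrable_truncate hinv z ε) (circleIntegrable_truncate_inv 0 z ‖z‖ hε)] at hsymm
  linear_combination 2⁻¹ * hsymm

theorem tendsto_circleIntegral_truncate_inv {z : ℂ} (hz : z ≠ 0) :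
    Tendsto (fun ε : ℝ => ∮ w in C(0, ‖z‖), if ε < ‖w - z‖ then (w - z)⁻¹ else 0) (𝓝[>] 0)
      (𝓝 (Real.pi * I)) := by
  have hz' : 0 < ‖z‖ := norm_pos_iff.mpr hz
  have hcont : ContinuousOn (fun w : ℂ => w ^ (-1 : ℤ)) (sphere 0 ‖z‖) :=
    continuousOn_zpow_sphere hz'.ne' (-1)
  have h := (tendsto_circleIntegral_truncate hz (hcont.circleIntegrable hz'.le)).const_mul 2⁻¹
  rw [circleIntegral_zpow hz'.ne', if_pos rfl,
    show (2⁻¹ : ℂ) * (2 * Real.pi * I) = Real.pi * I by ring] at h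
  refine h.congr' ?_
  filter_upwards [self_mem_nhdsWithin] with ε hε
  simp only [circleIntegral_truncate_inv hz hε, zpow_neg_one]

theorem tendsto_circleIntegral_truncate_pole [CompleteSpace E] {h k : ℂ → E} {z : ℂ} (hz : z ≠ 0)
    (A : E) (hk : ContinuousOn k (sphere 0 ‖z‖))
    (heq : ∀ w ∈ sphere (0 : ℂ) ‖z‖, w ≠ z → h w = (w - z)⁻¹ • A + k w) :
    Tendsto (fun ε : ℝ => ∮ w in C(0, ‖z‖), if ε < ‖w - z‖ then h w else 0) (𝓝[>] 0)
      (𝓝 ((∮ w in C(0, ‖z‖), k w) + (Real.pi * I : ℂ) • A)) := by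
  have hki : CircleIntegrable k 0 ‖z‖ := hk.circleIntegrable (norm_nonneg z)
  refine ((tendsto_circleIntegral_truncate hz hki).add
    ((tendsto_circleIntegral_truncate_inv hz).smul_const A)).congr' ?_
  filter_upwards [self_mem_nhdsWithin] with ε hε
  rw [← circleIntegral.integral_smul_const, ← circleIntegral.integral_add
    (circleIntegrable_truncate hki z ε)
    ((circleIntegrable_truncate_inv 0 z ‖z‖ hε).fun_smul_continuousOn continuousOn_const)]
  refine circleIntegral.integral_congr (norm_nonneg z) fun w hw => ?_
  split_ifs with hlt
  · rw [heq w hw (sub_ne_zero.mp (norm_pos_iff.mp (lt_trans hε hlt))), add_comm]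
  · simp

theorem exists_differentiableOn_sub_pole [CompleteSpace E] {h : ℂ → E} {z : ℂ} {A : E}
    {U : Set ℂ} (hU : U ∈ 𝓝 z) (hd : DifferentiableOn ℂ h (U \ {z}))
    (hA : Tendsto (fun w => (w - z) • h w) (𝓝[≠] z) (𝓝 A)) :
    ∃ k : ℂ → E, DifferentiableOn ℂ k U ∧ ∀ w ≠ z, k w = h w - (w - z)⁻¹ • A := by
  set G : ℂ → E := Function.update (fun w => (w - z) • h w) z A
  have hGne : ∀ w ≠ z, G w = (w - z) • h w := fun w hw => Function.update_of_ne hw _ _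
  have hGz : G z = A := Function.update_self _ _ _
  have hGd : DifferentiableOn ℂ G U :=
    (differentiableOn_compl_singleton_and_continuousAt_iff hU).mp
      ⟨((differentiableOn_id.sub_const z).smul hd).congr fun w hw => hGne w hw.2,
        continuousAt_update_same.mpr hA⟩
  refine ⟨dslope G z, (differentiableOn_dslope hU).mpr hGd, fun w hw => ?_⟩
  rw [dslope_of_ne _ hw, slope_def_module, hGne w hw, hGz, smul_sub,
    inv_smul_smul₀ (sub_ne_zero.mpr hw)]

theorem differentiableOn_sub_inv_smul {z : ℂ} {s : Set ℂ} (A : E) (hs : ∀ w ∈ s, w ≠ z) :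
    DifferentiableOn ℂ (fun w => (w - z)⁻¹ • A) s := fun w hw =>
  (((differentiableAt_id.sub_const z).inv
    (sub_ne_zero.mpr (hs w hw))).smul_const A).differentiableWithinAt

/-- Moving the contour to a smaller circle costs half of the residue at `z`. -/
theorem tendsto_circleIntegral_truncate_inner [CompleteSpace E] {h : ℂ → E} {z : ℂ} {A : E}
    {ρ σ : ℝ} (hzρ : ‖z‖ < ρ) (hσ : 0 < σ) (hσz : σ < ‖z‖)
    (hd : ∀ w, 0 < ‖w‖ → ‖w‖ < ρ → w ≠ z → DifferentiableAt ℂ h w)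
    (hA : Tendsto (fun w => (w - z) • h w) (𝓝[≠] z) (𝓝 A)) :
    Tendsto (fun ε : ℝ => ∮ w in C(0, ‖z‖), if ε < ‖w - z‖ then h w else 0) (𝓝[>] 0)
      (𝓝 ((∮ w in C(0, σ), h w) + (Real.pi * I : ℂ) • A)) := by
  set U : Set ℂ := {w | 0 < ‖w‖ ∧ ‖w‖ < ρ}
  have hU : IsOpen U := (isOpen_lt continuous_const continuous_norm).inter
    (isOpen_lt continuous_norm continuous_const)
  obtain ⟨k, hkd, hk⟩ := exists_differentiableOn_sub_pole (U := U)
    (hU.mem_nhds ⟨hσ.trans hσz, hzρ⟩)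
    (fun w hw => (hd w hw.1.1 hw.1.2 hw.2).differentiableWithinAt) hA
  have hkat : ∀ w, 0 < ‖w‖ → ‖w‖ < ρ → DifferentiableAt ℂ k w := fun w h0 h1 =>
    hkd.differentiableAt (hU.mem_nhds ⟨h0, h1⟩)
  have hann : (∮ w in C(0, ‖z‖), k w) = ∮ w in C(0, σ), k w := by
    have hanndiff : ∀ w ∈ closedBall (0 : ℂ) ‖z‖ \ ball 0 σ, DifferentiableAt ℂ k w := fun w hw =>
      hkat w (hσ.trans_le (by simpa using hw.2)) ((mem_closedBall_zero_iff.mp hw.1).trans_lt hzρ)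
    exact circleIntegral_eq_of_differentiable_on_annulus_off_countable hσ hσz.le
      Set.countable_empty (fun w hw => (hanndiff w hw).continuousAt.continuousWithinAt)
      fun w hw => hanndiff w ⟨ball_subset_closedBall hw.1.1,
        fun hmem => hw.1.2 (ball_subset_closedBall hmem)⟩
  have hne : ∀ w ∈ closedBall (0 : ℂ) σ, w ≠ z := fun w hw =>
    ne_of_mem_of_not_mem hw fun hz => (mem_closedBall_zero_iff.mp hz).not_gt hσz
  have hpole := differentiableOn_sub_inv_smul A hne
  have hzero : (∮ w in C(0, σ), (w - z)⁻¹ • A) = 0 :=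
    (DiffContOnCl.mk (hpole.mono ball_subset_closedBall)
      (hpole.continuousOn.mono closure_ball_subset_closedBall)).circleIntegral_eq_zero hσ.le
  have hinner : (∮ w in C(0, σ), k w) = ∮ w in C(0, σ), h w := by
    rw [circleIntegral.integral_congr hσ.le fun w hw => hk w (hne w (sphere_subset_closedBall hw)),
      circleIntegral.integral_sub, hzero, sub_zero]
    · refine ContinuousOn.circleIntegrable hσ.le fun w hw => ?_
      have hw' := mem_sphere_zero_iff_norm.mp hw
      exact (hd w (hw' ▸ hσ) (hw' ▸ hσz.trans hzρ)
        (hne w (sphere_subset_closedBall hw))).continuousAt.continuousWithinAt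
    · exact (hpole.continuousOn.mono sphere_subset_closedBall).circleIntegrable hσ.le
  rw [← hinner, ← hann]
  refine tendsto_circleIntegral_truncate_pole (norm_pos_iff.mp (hσ.trans hσz)) A (fun w hw => ?_)
    fun w _ hw => by rw [hk w hw]; abel
  have hw' := mem_sphere_zero_iff_norm.mp hw
  exact (hkat w (hw' ▸ hσ.trans hσz) (hw' ▸ hzρ)).continuousAt.continuousWithinAt

end PrincipalValue

/-! ### Integrals depending on a parameter -/

section ParametricIntegral

open MeasureTheory

theorem continuous_prodMk_comp {P F : Type*} [TopologicalSpace P] [TopologicalSpace F]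
    {Φ : P × ℂ → F} {γ : ℝ → ℂ} (hγ : Continuous γ) {y : P} (h : ∀ θ, ContinuousAt Φ (y, γ θ)) :
    Continuous fun θ => Φ (y, γ θ) :=
  continuous_iff_continuousAt.mpr fun θ => ContinuousAt.comp (f := fun θ => (y, γ θ)) (h θ)
    (continuous_const.prodMk hγ).continuousAt

variable {P E E' : Type*} [NormedAddCommGroup P] [NormedSpace ℂ P]
  [NormedAddCommGroup E] [NormedSpace ℂ E]
  [NormedAddCommGroup E'] [NormedSpace ℂ E']

theorem hasFDerivAt_prodMk_of_differentiableAt {Φ : P × ℂ → E} {y : P} {z : ℂ}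
    (h : DifferentiableAt ℂ Φ (y, z)) :
    HasFDerivAt (fun y => Φ (y, z)) ((fderiv ℂ Φ (y, z)).comp (ContinuousLinearMap.inl ℂ P ℂ)) y :=
  h.hasFDerivAt.comp y (hasFDerivAt_prodMk_left y z)

variable [CompleteSpace E]

theorem differentiableAt_fderiv_prodMk {Φ : P × ℂ → E} {y : P} {z : ℂ}
    (h : AnalyticAt ℂ Φ (y, z)) (v : P) :
    DifferentiableAt ℂ (fun u => fderiv ℂ (fun y => Φ (y, u)) y v) z := by
  have hpair : DifferentiableAt ℂ (fun u : ℂ => (y, u)) z :=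
    (differentiableAt_const y).prodMk differentiableAt_id
  refine DifferentiableAt.congr_of_eventuallyEq
    ((h.fderiv.differentiableAt.fun_comp' z hpair).clm_apply (differentiableAt_const (v, (0 : ℂ))))
    ?_
  filter_upwards [hpair.continuousAt.eventually h.eventually_analyticAt] with u hu
  rw [(hasFDerivAt_prodMk_of_differentiableAt hu.differentiableAt).fderiv]
  simp

theorem exists_eventually_norm_fderiv_lt {Φ : P × ℂ → E} {γ : ℝ → ℂ} (hγ : Continuous γ) {y₀ : P}
    (h : ∀ θ, AnalyticAt ℂ Φ (y₀, γ θ)) {s : Set ℝ} (hs : IsCompact s) :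
    ∃ C, ∀ᶠ y in 𝓝 y₀, ∀ θ ∈ s, AnalyticAt ℂ Φ (y, γ θ) ∧ ‖fderiv ℂ Φ (y, γ θ)‖ < C := by
  obtain ⟨C, hC⟩ := hs.exists_bound_of_continuousOn
    (continuous_prodMk_comp hγ fun θ => (h θ).fderiv.continuousAt).continuousOn
  refine ⟨C + 1, hs.eventually_forall_of_forall_eventually fun θ hθ => ?_⟩
  have hcont : Tendsto (fun p : P × ℝ => (p.1, γ p.2)) (𝓝 (y₀, θ)) (𝓝 (y₀, γ θ)) :=
    (continuous_fst.prodMk (hγ.comp continuous_snd)).tendsto (y₀, θ)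
  exact hcont.eventually ((h θ).eventually_analyticAt.and
    ((h θ).fderiv.continuousAt.norm.eventually (gt_mem_nhds ((hC θ hθ).trans_lt (lt_add_one C)))))

theorem hasFDerivAt_integral_of_analyticAt {Φ : P × ℂ → E} {γ : ℝ → ℂ} (hγ : Continuous γ)
    {K : ℝ → E →L[ℂ] E'} (hK : Continuous K) {a b : ℝ} {y₀ : P}
    (h : ∀ θ, AnalyticAt ℂ Φ (y₀, γ θ)) :
    HasFDerivAt (fun y => ∫ θ in a..b, K θ (Φ (y, γ θ)))
      (∫ θ in a..b, (K θ).comp ((fderiv ℂ Φ (y₀, γ θ)).comp (ContinuousLinearMap.inl ℂ P ℂ)))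
      y₀ := by
  have hcompact : IsCompact (Set.uIcc a b) := isCompact_uIcc
  have hsub : Set.uIoc a b ⊆ Set.uIcc a b := Set.uIoc_subset_uIcc
  obtain ⟨D, hD⟩ := hcompact.exists_bound_of_continuousOn hK.continuousOn
  obtain ⟨C, hC⟩ := exists_eventually_norm_fderiv_lt hγ h hcompact
  refine intervalIntegral.hasFDerivAt_integral_of_dominated_of_fderiv_le
    (F' := fun y θ => (K θ).comp ((fderiv ℂ Φ (y, γ θ)).comp (ContinuousLinearMap.inl ℂ P ℂ)))
    (bound := fun _ => D * (C * ‖ContinuousLinearMap.inl ℂ P ℂ‖)) hC ?_ ?_ ?_ ?_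
    intervalIntegrable_const ?_
  · filter_upwards [hC] with y hy
    refine ContinuousOn.aestronglyMeasurable (fun θ hθ => ?_) measurableSet_uIoc
    exact (hK.continuousAt.clm_apply (ContinuousAt.comp (f := fun θ => (y, γ θ)) (g := Φ)
      (hy θ (hsub hθ)).1.continuousAt
      (continuous_const.prodMk hγ).continuousAt)).continuousWithinAt
  · exact (hK.clm_apply (continuous_prodMk_comp hγ fun θ =>
      (h θ).continuousAt)).intervalIntegrable a b
  · exact (hK.clm_comp ((continuous_prodMk_comp hγ fun θ =>
      (h θ).fderiv.continuousAt).clm_comp continuous_const)).aestronglyMeasurable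
  · refine ae_of_all _ fun θ hθ y hy => (ContinuousLinearMap.opNorm_comp_le _ _).trans ?_
    refine mul_le_mul (hD θ (hsub hθ)) ((ContinuousLinearMap.opNorm_comp_le _ _).trans ?_)
      (norm_nonneg _) ((norm_nonneg _).trans (hD θ (hsub hθ)))
    exact mul_le_mul_of_nonneg_right (hy θ (hsub hθ)).2.le (norm_nonneg _)
  · exact ae_of_all _ fun θ hθ y hy => (K θ).hasFDerivAt.comp y
      (hasFDerivAt_prodMk_of_differentiableAt (hy θ (hsub hθ)).1.differentiableAt)

theorem fderiv_integral_apply_of_analyticAt [CompleteSpace E'] {Φ : P × ℂ → E} {γ : ℝ → ℂ}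
    (hγ : Continuous γ) {K : ℝ → E →L[ℂ] E'} (hK : Continuous K) {a b : ℝ} {y₀ : P}
    (h : ∀ θ, AnalyticAt ℂ Φ (y₀, γ θ)) (v : P) :
    fderiv ℂ (fun y => ∫ θ in a..b, K θ (Φ (y, γ θ))) y₀ v
      = ∫ θ in a..b, K θ (fderiv ℂ (fun y => Φ (y, γ θ)) y₀ v) := by
  have hc : Continuous fun θ =>
      (K θ).comp ((fderiv ℂ Φ (y₀, γ θ)).comp (ContinuousLinearMap.inl ℂ P ℂ)) :=
    hK.clm_comp ((continuous_prodMk_comp hγ fun θ =>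
      (h θ).fderiv.continuousAt).clm_comp continuous_const)
  rw [(hasFDerivAt_integral_of_analyticAt hγ hK h).fderiv,
    ContinuousLinearMap.intervalIntegral_apply (hc.intervalIntegrable a b)]
  refine intervalIntegral.integral_congr fun θ _ => ?_
  rw [(hasFDerivAt_prodMk_of_differentiableAt (h θ).differentiableAt).fderiv]
  rfl

end ParametricIntegral

/-! ### Geometric sequences in `ℓ¹` -/

section GeometricSequences

variable (E : Type*) [NormedAddCommGroup E] [NormedSpace ℂ E]

/-- The map `v ↦ (tⁿ v)ₙ` from `E` to `ℓ¹(E)`, for `|t| < 1`. Applied to Cauchy's formula it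
produces all Laurent coefficients of a function at once. -/
noncomputable def geomSeq (t : ℂ) : E →L[ℂ] lp (fun _ : ℕ => E) 1 :=
  ∑' n : ℕ, t ^ n • lp.singleContinuousLinearMap ℂ (fun _ : ℕ => E) 1 n

variable {E}

theorem norm_pow_smul_single_le {t : ℂ} {q : ℝ} (ht : ‖t‖ ≤ q) (n : ℕ) :
    ‖t ^ n • lp.singleContinuousLinearMap ℂ (fun _ : ℕ => E) 1 n‖ ≤ q ^ n := by
  have hq : 0 ≤ q := (norm_nonneg t).trans ht
  refine ContinuousLinearMap.opNorm_le_bound _ (pow_nonneg hq n) fun v => ?_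
  rw [smul_apply, lp.singleContinuousLinearMap_apply, norm_smul, norm_pow,
    lp.norm_single one_pos]
  gcongr

variable [CompleteSpace E]

theorem geomSeq_apply {t : ℂ} (ht : ‖t‖ < 1) (v : E) (n : ℕ) : geomSeq E t v n = t ^ n • v := by
  have hs : Summable fun n : ℕ => t ^ n • lp.singleContinuousLinearMap ℂ (fun _ : ℕ => E) 1 n :=
    Summable.of_norm_bounded (summable_geometric_of_lt_one (norm_nonneg t) ht)
      (norm_pow_smul_single_le le_rfl)
  have h1 : HasSum _ (geomSeq E t v) := (ContinuousLinearMap.apply ℂ _ v).hasSum hs.hasSum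
  have h2 : HasSum _ (geomSeq E t v n) := (lp.evalCLM ℂ (fun _ : ℕ => E) 1 n).hasSum h1
  refine h2.unique ?_
  convert hasSum_ite_eq n (t ^ n • v) using 2 with m
  change t ^ m • (lp.single 1 m v : lp (fun _ : ℕ => E) 1) n = _
  rcases eq_or_ne m n with rfl | hmn
  · simp
  · rw [lp.single_apply_ne _ _ _ hmn.symm, if_neg hmn, smul_zero]

theorem continuousOn_geomSeq {q : ℝ} (hq : q < 1) :
    ContinuousOn (geomSeq E) (Metric.closedBall 0 q) := by
  rcases lt_or_ge q 0 with hq0 | hq0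
  · rw [Metric.closedBall_eq_empty.mpr hq0]
    exact continuousOn_empty _
  · exact continuousOn_tsum (fun n => (continuous_pow n).continuousOn.smul continuousOn_const)
      (summable_geometric_of_lt_one hq0 hq)
      fun n _ ht => norm_pow_smul_single_le (mem_closedBall_zero_iff.mp ht) n

theorem exists_clm_hasSum_smul {a : ℕ → ℂ} (ha : Summable fun n => ‖a n‖) :
    ∃ T : lp (fun _ : ℕ => E) 1 →L[ℂ] E, ∀ x : lp (fun _ : ℕ => E) 1,
      HasSum (fun n => a n • x n) (T x) := by
  have hbound : ∀ (x : lp (fun _ : ℕ => E) 1) (n : ℕ), ‖a n • x n‖ ≤ ‖a n‖ * ‖x‖ := fun x n => by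
    rw [norm_smul]
    exact mul_le_mul_of_nonneg_left (lp.norm_apply_le_norm one_ne_zero x n) (norm_nonneg _)
  have hsum : ∀ x : lp (fun _ : ℕ => E) 1, Summable fun n => a n • x n := fun x =>
    Summable.of_norm_bounded (ha.mul_right ‖x‖) (hbound x)
  let T : lp (fun _ : ℕ => E) 1 →ₗ[ℂ] E :=
    { toFun := fun x => ∑' n, a n • x n
      map_add' := fun x y => by
        rw [← (hsum x).tsum_add (hsum y)]
        exact tsum_congr fun n => smul_add _ _ _
      map_smul' := fun c x => by
        rw [RingHom.id_apply, ← (hsum x).tsum_const_smul c]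
        exact tsum_congr fun n => smul_comm _ _ _ }
  refine ⟨T.mkContinuous (∑' n, ‖a n‖) fun x => ?_, fun x => (hsum x).hasSum⟩
  rw [← tsum_mul_right]
  exact tsum_of_norm_bounded (ha.mul_right ‖x‖).hasSum (hbound x)

end GeometricSequences

/-! ### Values of Laurent series -/

section LoopValues

open Metric Complex

theorem hasLaurentSumOn_of_hasSum {n : ℕ} {c : ℤ → Fin n → ℂ} {F : ℂ → Fin n → ℂ} {s : ℝ}
    (hs : 0 ≤ s) (h : ∀ z ∈ sphere (0 : ℂ) s, HasSum (fun k : ℤ => z ^ k • c k) (F z)) :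
    HasLaurentSumOn c F s := by
  refine ⟨?_, h⟩
  have hmem : (s : ℂ) ∈ sphere (0 : ℂ) s := by
    rw [mem_sphere_zero_iff_norm, norm_real, Real.norm_of_nonneg hs]
  refine (summable_norm_iff.mpr (h s hmem).summable).congr fun k => ?_
  rw [norm_smul, norm_zpow, norm_real, Real.norm_of_nonneg hs, mul_comm]

variable {V : Type*} [AddCommGroup V] [Module ℂ V] [FiniteDimensional ℂ V]

theorem Loop.HasValue.summable {X : Loop V} {z : ℂ} {v : V} (h : X.HasValue z v) :
    Summable fun k : ℤ => ‖coords V (X.1 k)‖ * ‖z‖ ^ k := by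
  refine (summable_norm_iff.mpr (HasSum.summable h)).congr fun k => ?_
  rw [norm_smul, norm_zpow, mul_comm]

theorem Loop.hasValue_eval {X : Loop V} {z : ℂ}
    (h : Summable fun k : ℤ => ‖coords V (X.1 k)‖ * ‖z‖ ^ k) : X.HasValue z (X.eval z) := by
  have hs : Summable fun k : ℤ => z ^ k • coords V (X.1 k) := by
    refine Summable.of_norm (h.congr fun k => ?_)
    rw [norm_smul, norm_zpow, mul_comm]
  unfold Loop.HasValue Loop.eval
  rw [LinearEquiv.apply_symm_apply]
  exact hs.hasSum

theorem Loop.HasValue.eval_eq {X : Loop V} {z : ℂ} {v : V} (h : X.HasValue z v) :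
    X.eval z = v := by
  unfold Loop.eval
  rw [HasSum.tsum_eq h, LinearEquiv.symm_apply_apply]

theorem Loop.hasLaurentSumOn {X : Loop V} {F : ℂ → V} {s : ℝ} (hs : 0 ≤ s)
    (h : ∀ z ∈ sphere (0 : ℂ) s, X.HasValue z (F z)) :
    HasLaurentSumOn (fun k => coords V (X.1 k)) (fun z => coords V (F z)) s :=
  hasLaurentSumOn_of_hasSum hs h

theorem exists_pos_forall_of_eventually_punctured {p : ℂ → Prop}
    (h : ∀ᶠ z in 𝓝[≠] (0 : ℂ), p z) : ∃ ε > 0, ∀ z : ℂ, 0 < ‖z‖ → ‖z‖ < ε → p z := by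
  rw [eventually_nhdsWithin_iff, Metric.eventually_nhds_iff] at h
  obtain ⟨ε, hε, h⟩ := h
  exact ⟨ε, hε, fun z h0 h1 => h (by simpa using h1) (norm_pos_iff.mp h0)⟩

theorem eventually_punctured_of_forall {p : ℂ → Prop} {ε : ℝ} (hε : 0 < ε)
    (h : ∀ z : ℂ, 0 < ‖z‖ → ‖z‖ < ε → p z) : ∀ᶠ z in 𝓝[≠] (0 : ℂ), p z := by
  rw [eventually_nhdsWithin_iff, Metric.eventually_nhds_iff]
  exact ⟨ε, hε, fun z h1 h0 => h z (norm_pos_iff.mpr h0) (by simpa using h1)⟩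

theorem Loop.eq_of_hasValue {X Y : Loop V} {F : ℂ → V}
    (hX : ∀ᶠ z in 𝓝[≠] (0 : ℂ), X.HasValue z (F z))
    (hY : ∀ᶠ z in 𝓝[≠] (0 : ℂ), Y.HasValue z (F z)) : X = Y := by
  obtain ⟨ε, hε, h⟩ := exists_pos_forall_of_eventually_punctured (hX.and hY)
  have hs : 0 < ε / 2 := half_pos hε
  have hmem : ∀ z ∈ sphere (0 : ℂ) (ε / 2), X.HasValue z (F z) ∧ Y.HasValue z (F z) :=
    fun z hz => by
      rw [mem_sphere_zero_iff_norm] at hz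
      exact h z (hz ▸ hs) (hz ▸ half_lt_self hε)
  refine Subtype.ext (funext fun k => (coords V).injective ?_)
  have hcoeff := ((Loop.hasLaurentSumOn hs.le fun z hz => (hmem z hz).1).circleIntegral_zpow_smul
    hs (-1 - k)).symm.trans ((Loop.hasLaurentSumOn hs.le fun z hz =>
      (hmem z hz).2).circleIntegral_zpow_smul hs (-1 - k))
  simpa using smul_right_injective _ two_pi_I_ne_zero hcoeff

theorem Loop.ofFun_eq {X : Loop V} {F : ℂ → V}
    (hX : ∀ᶠ z in 𝓝[≠] (0 : ℂ), X.HasValue z (F z)) : Loop.ofFun F = X := by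
  have h : ∃ X : Loop V, ∀ᶠ z in 𝓝[≠] (0 : ℂ), X.HasValue z (F z) := ⟨X, hX⟩
  rw [Loop.ofFun, dif_pos h]
  exact Loop.eq_of_hasValue h.choose_spec hX

theorem exists_loop_of_bounded_smul {F : ℂ → V} {R : ℝ} (hR : 0 < R)
    (hd : ∀ z, 0 < ‖z‖ → ‖z‖ < R → DifferentiableAt ℂ (fun z => coords V (F z)) z) {C : ℝ}
    (hb : ∀ᶠ z in 𝓝[≠] (0 : ℂ), ‖z • coords V (F z)‖ ≤ C) :
    ∃ X : Loop V, (∀ n < -1, X.1 n = 0) ∧ ∀ z, 0 < ‖z‖ → ‖z‖ < R → X.HasValue z (F z) := by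
  obtain ⟨c, hc0, hc⟩ := exists_laurent_of_bounded_smul hd hb
  have hmem : (fun n => (coords V).symm (c n)) ∈ loopSubmodule V := by
    refine ⟨⟨-1, fun n hn => by simp [hc0 n hn]⟩, R, hR, fun s hs hsR => ?_⟩
    have hsum := (hasLaurentSumOn_of_hasSum hs.le fun z hz => by
      rw [mem_sphere_zero_iff_norm] at hz
      exact hc z (hz ▸ hs) (hz ▸ hsR)).summable
    simpa using hsum
  refine ⟨⟨_, hmem⟩, fun n hn => by simp [hc0 n hn], fun z h0 h1 => ?_⟩
  unfold Loop.HasValue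
  simpa using hc z h0 h1

theorem Loop.hasValue_of_eventually {X : Loop V} {F : ℂ → V} {R : ℝ}
    (hd : ∀ z, 0 < ‖z‖ → ‖z‖ < R → DifferentiableAt ℂ (fun z => coords V (F z)) z) {C : ℝ}
    (hb : ∀ᶠ z in 𝓝[≠] (0 : ℂ), ‖z • coords V (F z)‖ ≤ C)
    (hX : ∀ᶠ z in 𝓝[≠] (0 : ℂ), X.HasValue z (F z)) {z : ℂ} (h0 : 0 < ‖z‖) (h1 : ‖z‖ < R) :
    X.HasValue z (F z) := by
  have hR := h0.trans h1
  obtain ⟨Y, -, hY⟩ := exists_loop_of_bounded_smul hR hd hb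
  rw [Loop.eq_of_hasValue hX (eventually_punctured_of_forall hR hY)]
  exact hY z h0 h1

theorem Loop.norm_smul_coords_le {X : Loop V} (hX : ∀ n < -1, X.1 n = 0) {s : ℝ}
    (hs : Summable fun k : ℤ => ‖coords V (X.1 k)‖ * s ^ k) {z : ℂ} (h0 : 0 < ‖z‖) (h1 : ‖z‖ ≤ s)
    {v : V} (hv : X.HasValue z v) :
    ‖z • coords V v‖ ≤ s * ∑' k : ℤ, ‖coords V (X.1 k)‖ * s ^ k := by
  have hs0 := h0.trans_le h1
  rw [← (HasSum.const_smul z hv).tsum_eq]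
  refine tsum_of_norm_bounded (hs.hasSum.mul_left s) fun k => ?_
  rcases lt_or_ge k (-1) with hk | hk
  · simp [hX k hk]
  calc ‖z • z ^ k • coords V (X.1 k)‖ = ‖coords V (X.1 k)‖ * ‖z‖ ^ (k + 1) := by
        rw [norm_smul, norm_smul, norm_zpow, zpow_add_one₀ h0.ne']
        ring
    _ ≤ ‖coords V (X.1 k)‖ * s ^ (k + 1) := by
        gcongr
        exact zpow_le_zpow_left₀ (by lia) h0.le h1
    _ = s * (‖coords V (X.1 k)‖ * s ^ k) := by
        rw [zpow_add_one₀ hs0.ne']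
        ring

theorem Loop.step_one_apply_of_lt {ρ : ℝ} (hρ : 0 < ρ) (x : SeqSpace V) {n : ℤ} (hn : n < -1) :
    (Loop.step 1 hρ x).1 n = 0 := by
  have h : ¬ -((1 : ℕ) : ℤ) ≤ n := by push_cast; lia
  simp only [Loop.step, if_neg h]

theorem Loop.step_one_hasValue_iff {ρ : ℝ} (hρ : 0 < ρ) (x : SeqSpace V) (z : ℂ) (v : V) :
    (Loop.step 1 hρ x).HasValue z v ↔
      HasSum (fun n : ℕ => (z ^ ((n : ℤ) - 1) * ((ρ : ℂ) ^ n)⁻¹) • x n) (coords V v) := by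
  unfold Loop.HasValue
  rw [hasSum_int_iff_hasSum_nat (N := 1) fun k hk => by
    rw [Loop.step_one_apply_of_lt hρ x hk, map_zero, smul_zero]]
  refine iff_of_eq (congrArg (HasSum · _) (funext fun n => ?_))
  have hn : -((1 : ℕ) : ℤ) ≤ (n : ℤ) - 1 := by push_cast; lia
  simp only [Loop.step, if_pos hn, map_smul, LinearEquiv.apply_symm_apply, smul_smul]
  simp

theorem Loop.step_add_smul (N : ℕ) {ρ : ℝ} (hρ : 0 < ρ) (x y : SeqSpace V) (s : ℂ) :
    Loop.step N hρ (x + s • y) = Loop.step N hρ x + s • Loop.step N hρ y := by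
  refine Subtype.ext (funext fun k => ?_)
  by_cases h : -(N : ℤ) ≤ k
  · have hcoeff : (x + s • y : SeqSpace V) (k + N).toNat
        = x (k + N).toNat + s • y (k + N).toNat := rfl
    simp only [Loop.step, Submodule.coe_add, Submodule.coe_smul, Pi.add_apply, Pi.smul_apply,
      if_pos h, hcoeff, map_add, map_smul, smul_add, smul_comm s]
  · simp [Loop.step, h]

end LoopValues

/-! ### Laurent coefficients depending on a parameter -/

section CoefficientSequences

open Metric Complex

variable (E : Type*) [NormedAddCommGroup E] [NormedSpace ℂ E]

/-- The kernel of Cauchy's formula with values in `ℓ¹`: integrated against the values of a function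
on the circle of radius `s`, it gives the sequence `(ρⁿ c_{n-1})ₙ` of its rescaled Laurent
coefficients, see `integral_coeffKernel_apply`. -/
noncomputable def coeffKernel (ρ s θ : ℝ) : E →L[ℂ] lp (fun _ : ℕ => E) 1 :=
  (2 * Real.pi * I : ℂ)⁻¹ • deriv (circleMap 0 s) θ • geomSeq E (ρ / circleMap 0 s θ)

variable {E} [CompleteSpace E]

theorem norm_div_circleMap {ρ s : ℝ} (hρ : 0 ≤ ρ) (hρs : ρ < s) (θ : ℝ) :
    ‖(ρ : ℂ) / circleMap 0 s θ‖ = ρ / s := by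
  rw [norm_div, norm_real, Real.norm_of_nonneg hρ, norm_circleMap_zero,
    abs_of_pos (hρ.trans_lt hρs)]

theorem continuous_coeffKernel {ρ s : ℝ} (hρ : 0 ≤ ρ) (hρs : ρ < s) :
    Continuous (coeffKernel E ρ s) := by
  have hs : 0 < s := hρ.trans_lt hρs
  refine ((continuous_deriv_circleMap 0 s).smul ?_).const_smul ((2 * Real.pi * I : ℂ)⁻¹)
  refine (continuousOn_geomSeq ((div_lt_one hs).mpr hρs)).comp_continuous
    (continuous_const.div (continuous_circleMap 0 s) fun θ => circleMap_ne_center hs.ne')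
    fun θ => ?_
  rw [mem_closedBall_zero_iff, norm_div_circleMap hρ hρs]

theorem coeffKernel_apply {ρ s : ℝ} (hρ : 0 ≤ ρ) (hρs : ρ < s) (θ : ℝ) (v : E) (n : ℕ) :
    coeffKernel E ρ s θ v n = ((2 * Real.pi * I : ℂ)⁻¹ * (ρ : ℂ) ^ n) •
      (deriv (circleMap 0 s) θ • circleMap 0 s θ ^ (-(n : ℤ)) • v) := by
  have hlt : ‖(ρ : ℂ) / circleMap 0 s θ‖ < 1 := by
    rw [norm_div_circleMap hρ hρs]
    exact (div_lt_one (hρ.trans_lt hρs)).mpr hρs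
  change (2 * Real.pi * I : ℂ)⁻¹ • deriv (circleMap 0 s) θ • geomSeq E _ v n = _
  rw [geomSeq_apply hlt, smul_smul, smul_smul, smul_smul, smul_smul, div_pow, zpow_neg,
    zpow_natCast]
  congr 1
  ring

theorem integral_coeffKernel_apply {ρ s : ℝ} (hρ : 0 ≤ ρ) (hρs : ρ < s) {c : ℤ → E} {F : ℂ → E}
    (h : HasLaurentSumOn c F s) (n : ℕ) :
    (∫ θ in (0 : ℝ)..2 * Real.pi, coeffKernel E ρ s θ (F (circleMap 0 s θ))) n
      = (ρ : ℂ) ^ n • c (n - 1) := by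
  have hs : 0 < s := hρ.trans_lt hρs
  have hcont : Continuous fun θ => coeffKernel E ρ s θ (F (circleMap 0 s θ)) :=
    (continuous_coeffKernel hρ hρs).clm_apply ((h.continuousOn hs.ne').comp_continuous
      (continuous_circleMap 0 s) fun θ => circleMap_mem_sphere 0 hs.le θ)
  have hcauchy : (∫ θ in (0 : ℝ)..2 * Real.pi, deriv (circleMap 0 s) θ •
      circleMap 0 s θ ^ (-(n : ℤ)) • F (circleMap 0 s θ)) = (2 * Real.pi * I : ℂ) • c (n - 1) := by
    rw [show (n : ℤ) - 1 = -1 - -n by ring]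
    exact h.circleIntegral_zpow_smul hs (-n)
  calc _ = ∫ θ in (0 : ℝ)..2 * Real.pi, coeffKernel E ρ s θ (F (circleMap 0 s θ)) n :=
        ((lp.evalCLM ℂ (fun _ : ℕ => E) 1 n).intervalIntegral_comp_comm
          (hcont.intervalIntegrable 0 (2 * Real.pi))).symm
    _ = (ρ : ℂ) ^ n • c (n - 1) := by
        simp only [coeffKernel_apply hρ hρs]
        rw [intervalIntegral.integral_smul, hcauchy, smul_smul, mul_right_comm,
          inv_mul_cancel₀ two_pi_I_ne_zero, one_mul]

variable {V : Type*} [AddCommGroup V] [Module ℂ V] [FiniteDimensional ℂ V]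

theorem Loop.step_one_hasValue_of_hasSum {ρ : ℝ} (hρ : 0 < ρ)
    {c : ℤ → Fin (Module.finrank ℂ V) → ℂ} (hc : ∀ n < -1, c n = 0) {x : SeqSpace V}
    (hx : ∀ n : ℕ, x n = (ρ : ℂ) ^ n • c (n - 1)) {z : ℂ} {v : V}
    (h : HasSum (fun n : ℤ => z ^ n • c n) (coords V v)) :
    (Loop.step 1 hρ x).HasValue z v := by
  rw [hasSum_int_iff_hasSum_nat (N := 1) fun k hk => by rw [hc k hk, smul_zero]] at h
  refine (Loop.step_one_hasValue_iff hρ x z v).mpr (h.congr_fun fun n => ?_)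
  rw [hx, smul_smul, mul_assoc, inv_mul_cancel₀ (pow_ne_zero _ (ofReal_ne_zero.mpr hρ.ne')),
    mul_one]

/-- Evaluation at `z` is a continuous linear map on `SeqSpace V`, so that it can be exchanged with
differentiation. -/
theorem Loop.step_one_hasValue_fderiv {P : Type*} [NormedAddCommGroup P] [NormedSpace ℂ P] {ρ : ℝ}
    (hρ : 0 < ρ) {Γ : P → SeqSpace V} {Γ' : P →L[ℂ] SeqSpace V} {y₀ : P}
    (hΓ : HasFDerivAt Γ Γ' y₀) {z : ℂ} (h0 : 0 < ‖z‖) (h1 : ‖z‖ < ρ)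
    {Φ : P → Fin (Module.finrank ℂ V) → ℂ}
    (hval : ∀ᶠ y in 𝓝 y₀, (Loop.step 1 hρ (Γ y)).HasValue z ((coords V).symm (Φ y))) (v : P) :
    (Loop.step 1 hρ (Γ' v)).HasValue z ((coords V).symm (fderiv ℂ Φ y₀ v)) := by
  have hsum : Summable fun n : ℕ => ‖z ^ ((n : ℤ) - 1) * ((ρ : ℂ) ^ n)⁻¹‖ := by
    have hq : ‖z‖ / ρ < 1 := (div_lt_one hρ).mpr h1
    refine ((summable_geometric_of_lt_one (by positivity) hq).mul_left ‖z‖⁻¹).congr fun n => ?_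
    rw [norm_mul, norm_zpow, norm_inv, norm_pow, norm_real, Real.norm_of_nonneg hρ.le,
      zpow_sub₀ h0.ne', zpow_natCast, zpow_one, div_pow]
    ring
  obtain ⟨T, hT⟩ := exists_clm_hasSum_smul (E := Fin (Module.finrank ℂ V) → ℂ) hsum
  simp only [Loop.step_one_hasValue_iff, LinearEquiv.apply_symm_apply] at hval ⊢
  have heq : Φ =ᶠ[𝓝 y₀] T ∘ Γ := hval.mono fun y hy => hy.unique (hT (Γ y))
  rw [((T.hasFDerivAt.comp y₀ hΓ).congr_of_eventuallyEq heq).fderiv]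
  exact hT _

/-- A family of functions with at most simple poles at `0`, depending holomorphically on a
parameter, is a differentiable map to one of the Banach spaces of which `Loop V` is the union. -/
theorem exists_hasFDerivAt_step_one {P : Type*} [NormedAddCommGroup P] [NormedSpace ℂ P]
    {Φ : P × ℂ → Fin (Module.finrank ℂ V) → ℂ} {y₀ : P} {δ : ℝ} (hδ : 0 < δ)
    (hA : ∀ᶠ y in 𝓝 y₀, ∀ z : ℂ, 0 < ‖z‖ → ‖z‖ < δ → AnalyticAt ℂ Φ (y, z))
    (hb : ∀ᶠ y in 𝓝 y₀, ∃ C : ℝ, ∀ᶠ z in 𝓝[≠] (0 : ℂ), ‖z • Φ (y, z)‖ ≤ C) :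
    ∃ (ρ : ℝ) (hρ : 0 < ρ) (Γ : P → SeqSpace V) (Γ' : P →L[ℂ] SeqSpace V),
      HasFDerivAt Γ Γ' y₀ ∧
      (∀ᶠ y in 𝓝 y₀, ∀ z : ℂ, 0 < ‖z‖ → ‖z‖ < ρ →
        (Loop.step 1 hρ (Γ y)).HasValue z ((coords V).symm (Φ (y, z)))) ∧
      ∀ (v : P) (z : ℂ), 0 < ‖z‖ → ‖z‖ < ρ → (Loop.step 1 hρ (Γ' v)).HasValue z
        ((coords V).symm (fderiv ℂ (fun y => Φ (y, z)) y₀ v)) := by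
  obtain ⟨s, hs, hsδ⟩ := exists_between hδ
  obtain ⟨ρ, hρ, hρs⟩ := exists_between hs
  have hsphere : ∀ z ∈ sphere (0 : ℂ) s, 0 < ‖z‖ ∧ ‖z‖ < δ := fun z hz => by
    rw [mem_sphere_zero_iff_norm] at hz
    exact ⟨hz ▸ hs, hz ▸ hsδ⟩
  have hder := hasFDerivAt_integral_of_analyticAt (a := 0) (b := 2 * Real.pi) (Φ := Φ) (y₀ := y₀)
    (continuous_circleMap 0 s) (continuous_coeffKernel hρ.le hρs) fun θ =>
      have hθ := hsphere _ (circleMap_mem_sphere 0 hs.le θ)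
      hA.self_of_nhds _ hθ.1 hθ.2
  have hval : ∀ᶠ y in 𝓝 y₀, ∀ z : ℂ, 0 < ‖z‖ → ‖z‖ < ρ →
      (Loop.step 1 hρ (∫ θ in (0 : ℝ)..2 * Real.pi, coeffKernel _ ρ s θ
        (Φ (y, circleMap 0 s θ)))).HasValue z ((coords V).symm (Φ (y, z))) := by
    filter_upwards [hA, hb] with y hAy ⟨C, hC⟩ z h0 h1
    obtain ⟨c, hc0, hc⟩ := exists_laurent_of_bounded_smul (F := fun z => Φ (y, z))
      (fun z h0 h1 => (hAy z h0 h1).differentiableAt.comp z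
        ((differentiableAt_const y).prodMk differentiableAt_id)) hC
    have hlaurent : HasLaurentSumOn c (fun z => Φ (y, z)) s :=
      hasLaurentSumOn_of_hasSum hs.le fun z hz => hc z (hsphere z hz).1 (hsphere z hz).2
    refine Loop.step_one_hasValue_of_hasSum hρ hc0
      (fun n => integral_coeffKernel_apply hρ.le hρs hlaurent n) ?_
    rw [LinearEquiv.apply_symm_apply]
    exact hc z h0 (h1.trans (hρs.trans hsδ))
  exact ⟨ρ, hρ, _, _, hder, hval, fun v z h0 h1 =>
    Loop.step_one_hasValue_fderiv hρ hder h0 h1 (hval.mono fun y hy => hy z h0 h1) v⟩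

end CoefficientSequences

section CoordinateBilinear

variable {V W : Type*} [AddCommGroup V] [Module ℂ V] [FiniteDimensional ℂ V]
  [AddCommGroup W] [Module ℂ W] [FiniteDimensional ℂ W]
  {E : Type*} [NormedAddCommGroup E] [NormedSpace ℂ E]

/-- A linear map on `V`, in coordinates. -/
noncomputable def coordsCLM (f : V →ₗ[ℂ] E) : (Fin (Module.finrank ℂ V) → ℂ) →L[ℂ] E :=
  LinearMap.toContinuousLinearMap (f ∘ₗ (coords V).symm.toLinearMap)

theorem coordsCLM_apply (f : V →ₗ[ℂ] E) (c : Fin (Module.finrank ℂ V) → ℂ) :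
    coordsCLM f c = f ((coords V).symm c) := rfl

@[simp] theorem coordsCLM_coords (f : V →ₗ[ℂ] E) (v : V) : coordsCLM f (coords V v) = f v := by
  rw [coordsCLM_apply, LinearEquiv.symm_apply_apply]

/-- A bilinear map on `V × W`, in coordinates. -/
noncomputable def coordsBilin (f : V →ₗ[ℂ] W →ₗ[ℂ] E) :
    (Fin (Module.finrank ℂ V) → ℂ) →L[ℂ] (Fin (Module.finrank ℂ W) → ℂ) →L[ℂ] E :=
  coordsCLM ((LinearMap.toContinuousLinearMap (𝕜 := ℂ) (E := Fin (Module.finrank ℂ W) → ℂ)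
    (F' := E)).toLinearMap ∘ₗ f.compl₂ (coords W).symm.toLinearMap)

theorem coordsBilin_apply (f : V →ₗ[ℂ] W →ₗ[ℂ] E) (c : Fin (Module.finrank ℂ V) → ℂ)
    (d : Fin (Module.finrank ℂ W) → ℂ) :
    coordsBilin f c d = f ((coords V).symm c) ((coords W).symm d) := rfl

@[simp] theorem coordsBilin_coords (f : V →ₗ[ℂ] W →ₗ[ℂ] E) (v : V) (w : W) :
    coordsBilin f (coords V v) (coords W w) = f v w := by
  rw [coordsBilin_apply, LinearEquiv.symm_apply_apply, LinearEquiv.symm_apply_apply]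

end CoordinateBilinear

/-! ### The residue pairing and ad-invariance -/

section Pairing

open Metric Complex

variable {V : Type*} [AddCommGroup V] [Module ℂ V] [FiniteDimensional ℂ V]

theorem Loop.finite_support_pairing {W : Type*} [AddCommGroup W] [Module ℂ W]
    [FiniteDimensional ℂ W] (X : Loop V) (Y : Loop W) {A : Type*} [Zero A] (b : V → W → A)
    (hb0 : ∀ w, b 0 w = 0) (hb1 : ∀ v, b v 0 = 0) (j : ℤ) :
    (Function.support fun n : ℤ => b (X.1 n) (Y.1 (j - n))).Finite := by
  obtain ⟨X, ⟨N, hN⟩, -⟩ := X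
  obtain ⟨Y, ⟨M, hM⟩, -⟩ := Y
  refine (Set.finite_Icc N (j - M)).subset fun i hi => ?_
  by_contra hcon
  rw [Set.mem_Icc, not_and_or, not_le, not_le] at hcon
  refine hi ?_
  rcases hcon with h | h
  · simp [hN i h, hb0]
  · simp [hM (j - i) (by lia), hb1]

theorem Loop.pairing_eq_finsum (M : Loop (Module.Dual ℂ V)) (Y : Loop V) :
    Loop.pairing M Y = ∑ᶠ n : ℤ, M.1 n (Y.1 (-1 - n)) := by
  unfold Loop.pairing
  rw [← finsum_comp_equiv (Equiv.subLeft (-1))]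
  refine finsum_congr fun n => ?_
  simp

theorem Loop.pairing_eq_circleIntegral (M : Loop (Module.Dual ℂ V)) (Y : Loop V) {s : ℝ}
    (hs : 0 < s) (hM : Summable fun n => ‖coords _ (M.1 n)‖ * s ^ n)
    (hY : Summable fun n => ‖coords _ (Y.1 n)‖ * s ^ n) :
    Loop.pairing M Y
      = (2 * Real.pi * I : ℂ)⁻¹ * ∮ w in C(0, s), M.eval w (Y.eval w) := by
  have h := HasLaurentSumOn.hasSum_circleIntegral_bilin
    (coordsBilin (LinearMap.id : Module.Dual ℂ V →ₗ[ℂ] _))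
    (Loop.hasLaurentSumOn hs.le fun z hz =>
      Loop.hasValue_eval (X := M) (by rwa [mem_sphere_zero_iff_norm.mp hz]))
    (Loop.hasLaurentSumOn hs.le fun z hz =>
      Loop.hasValue_eval (X := Y) (by rwa [mem_sphere_zero_iff_norm.mp hz])) hs
  simp only [coordsBilin_coords, LinearMap.id_apply] at h
  rw [← h.tsum_eq, tsum_eq_finsum, Loop.pairing_eq_finsum, ← smul_finsum, smul_eq_mul,
    inv_mul_cancel_left₀ two_pi_I_ne_zero]
  refine (Loop.finite_support_pairing M Y (fun a b => a b) (by simp) (by simp) (-1)).subset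
    fun n hn h0 => hn ?_
  beta_reduce at h0 ⊢
  rw [h0, smul_zero]

end Pairing

section Invariance

theorem clm_apply_eq_tsum_zpow_smul {E E₁ E₂ : Type*} [NormedAddCommGroup E] [NormedSpace ℂ E]
    [NormedAddCommGroup E₁] [NormedSpace ℂ E₁] [NormedAddCommGroup E₂] [NormedSpace ℂ E₂]
    [CompleteSpace E₂] (B : E →L[ℂ] E₁ →L[ℂ] E₂) {c : ℤ → E} {d : ℤ → E₁} {z : ℂ} (hz : z ≠ 0)
    (hc : Summable fun n => ‖c n‖ * ‖z‖ ^ n) (hd : Summable fun n => ‖d n‖ * ‖z‖ ^ n) {x : E}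
    {y : E₁} (hx : HasSum (fun n : ℤ => z ^ n • c n) x) (hy : HasSum (fun n : ℤ => z ^ n • d n) y) :
    B x y = ∑' j : ℤ, z ^ j • ∑' n : ℤ, B (c n) (d (j - n)) := by
  set f : ℤ × ℤ → E₂ := fun p => B (z ^ p.1 • c p.1) (z ^ p.2 • d p.2) with hf
  have hsum : Summable f := by
    refine Summable.of_norm_bounded
      ((hc.mul_of_nonneg hd (fun n => by positivity) (fun n => by positivity)).mul_left ‖B‖)
      fun p => (B.le_opNorm₂ _ _).trans (le_of_eq ?_)
    rw [norm_smul, norm_smul, norm_zpow, norm_zpow]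
    ring
  have hprod : ∑' p, f p = B x y := by
    rw [hsum.tsum_prod, ← B.flip_apply x y, ← ((B.flip y).hasSum hx).tsum_eq]
    exact tsum_congr fun n => ((B (z ^ n • c n)).hasSum hy).tsum_eq
  let e : ℤ × ℤ ≃ ℤ × ℤ :=
    ⟨fun p => (p.2, p.1 - p.2), fun p => (p.1 + p.2, p.1), fun p => by simp, fun p => by simp⟩
  rw [← hprod, ← e.tsum_eq f]
  refine (e.summable_iff.mpr hsum).tsum_prod.trans (tsum_congr fun j => ?_)
  rw [← tsum_const_smul'' (z ^ j)]
  refine tsum_congr fun n => ?_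
  simp only [hf, e, Function.comp_apply, Equiv.coe_fn_mk, map_smul, smul_apply, smul_smul,
    ← zpow_add₀ hz, sub_add_cancel]

variable {g : Type*} [LieRing g] [LieAlgebra ℂ g] [FiniteDimensional ℂ g]

theorem Loop.single_mem (k : ℤ) (y : g) :
    (fun n : ℤ => if n = k then y else 0) ∈ loopSubmodule g := by
  refine ⟨⟨k, fun n hn => if_neg hn.ne⟩, 1, one_pos, fun s _ _ => ?_⟩
  refine summable_of_ne_finset_zero (s := {k}) fun n hn => ?_
  simp [Finset.notMem_singleton.mp hn]

theorem Loop.AdInvariant.tsum_apply_lie_eq_zero {df : Loop g → Loop (Module.Dual ℂ g)}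
    (h : Loop.AdInvariant df) (X : Loop g) (y : g) (j : ℤ) :
    ∑' n : ℤ, (df X).1 n ⁅y, X.1 (j - n)⁆ = 0 := by
  have hpair := h X ⟨_, Loop.single_mem (-1 - j) y⟩
  rw [Loop.pairing_eq_finsum] at hpair
  rw [tsum_eq_finsum (Loop.finite_support_pairing (df X) X (fun a b => a ⁅y, b⁆) (by simp)
    (by simp) j), ← hpair]
  refine finsum_congr fun n => ?_
  change _ = (df X).1 n (∑ᶠ i : ℤ, ⁅(if i = -1 - j then y else 0), X.1 (-1 - n - i)⁆)
  rw [finsum_eq_single _ (-1 - j) fun i hi => by rw [if_neg hi, zero_lie], if_pos rfl]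
  congr 3
  lia

theorem Loop.AdInvariant.eval_lie_eq_zero {df : Loop g → Loop (Module.Dual ℂ g)}
    (h : Loop.AdInvariant df) (X : Loop g) {w : ℂ} (hw : w ≠ 0)
    (hM : Summable fun n => ‖coords _ ((df X).1 n)‖ * ‖w‖ ^ n)
    (hX : Summable fun n => ‖coords _ (X.1 n)‖ * ‖w‖ ^ n) (y : g) :
    (df X).eval w ⁅y, X.eval w⁆ = 0 := by
  have hsum := clm_apply_eq_tsum_zpow_smul (coordsBilin ((LinearMap.id :
    Module.Dual ℂ g →ₗ[ℂ] _).compl₂ (LieAlgebra.ad ℂ g y : g →ₗ[ℂ] g))) hw hM hX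
    (Loop.hasValue_eval hM) (Loop.hasValue_eval hX)
  simp only [coordsBilin_coords, LinearMap.compl₂_apply, LinearMap.id_apply,
    LieAlgebra.ad_apply] at hsum
  rw [hsum]
  simp only [h.tsum_apply_lie_eq_zero X y, smul_zero, tsum_zero]

end Invariance

/-! ### Holomorphic dependence on the base point -/

section Holomorphy

variable {V W : Type*} [AddCommGroup V] [Module ℂ V] [FiniteDimensional ℂ V]
  [AddCommGroup W] [Module ℂ W] [FiniteDimensional ℂ W]
  {P : Type*} [NormedAddCommGroup P] [NormedSpace ℂ P]

theorem HolAt.analyticAt_comp {F : V → W} {γ : P → V} {p : P} (hF : HolAt F (γ p))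
    (hγ : AnalyticAt ℂ (fun p => coords V (γ p)) p) :
    AnalyticAt ℂ (fun p => coords W (F (γ p))) p := by
  have h := AnalyticAt.comp (g := inCoords F) (f := fun p => coords V (γ p)) hF hγ
  simpa [Function.comp_def, inCoords] using h

theorem analyticAt_coords_linear [FiniteDimensional ℂ P] (f : P →ₗ[ℂ] V) (p : P) :
    AnalyticAt ℂ (fun p => coords V (f p)) p :=
  (LinearMap.toContinuousLinearMap ((coords V).toLinearMap ∘ₗ f)).analyticAt p

theorem hasDerivAt_coords_line (v w : V) :
    HasDerivAt (fun s : ℂ => coords V (v + s • w)) (coords V w) 0 := by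
  simpa only [map_add, map_smul] using hasDerivAt_const_add_smul (coords V v) (coords V w)

theorem tendsto_coords_line (v w : V) :
    Tendsto (fun s : ℂ => coords V (v + s • w)) (𝓝 0) (𝓝 (coords V v)) := by
  simpa using (hasDerivAt_coords_line v w).continuousAt.tendsto

end Holomorphy

section RMatrix

variable {g : Type*} [LieRing g] [LieAlgebra ℂ g] [FiniteDimensional ℂ g]
  {H : LieSubalgebra ℂ g} {r : Module.Dual ℂ H × ℂ → g ⊗[ℂ] g}

/-- `r` in coordinates on `h*` and on `g ⊗ g`. -/
noncomputable def rCoords (r : Module.Dual ℂ H × ℂ → g ⊗[ℂ] g)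
    (p : (Fin (Module.finrank ℂ (Module.Dual ℂ H)) → ℂ) × ℂ) :
    Fin (Module.finrank ℂ (g ⊗[ℂ] g)) → ℂ :=
  coords (g ⊗[ℂ] g) (r ((coords (Module.Dual ℂ H)).symm p.1, p.2))

theorem HolAt.analyticAt_rCoords {q : Module.Dual ℂ H} {z : ℂ} (h : HolAt r (q, z)) :
    AnalyticAt ℂ (rCoords r) (coords (Module.Dual ℂ H) q, z) :=
  HolAt.analyticAt_comp
    (γ := fun p : (Fin (Module.finrank ℂ (Module.Dual ℂ H)) → ℂ) × ℂ =>
      ((coords (Module.Dual ℂ H)).symm p.1, p.2))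
    (by rwa [LinearEquiv.symm_apply_apply])
    (analyticAt_coords_linear (((coords (Module.Dual ℂ H)).symm.toLinearMap).prodMap LinearMap.id)
      (coords (Module.Dual ℂ H) q, z))

theorem HolAt.of_analyticAt_rCoords {c : Fin (Module.finrank ℂ (Module.Dual ℂ H)) → ℂ} {z : ℂ}
    (h : AnalyticAt ℂ (rCoords r) (c, z)) : HolAt r ((coords (Module.Dual ℂ H)).symm c, z) := by
  let f : (Fin (Module.finrank ℂ (Module.Dual ℂ H × ℂ)) → ℂ) →ₗ[ℂ]
      (Fin (Module.finrank ℂ (Module.Dual ℂ H)) → ℂ) × ℂ :=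
    ((coords (Module.Dual ℂ H)).toLinearMap.prodMap LinearMap.id) ∘ₗ
      (coords (Module.Dual ℂ H × ℂ)).symm.toLinearMap
  have hf : f (coords _ ((coords (Module.Dual ℂ H)).symm c, z)) = (c, z) := by simp [f]
  have hcomp : rCoords r ∘ f = inCoords r := by
    funext d
    simp [f, rCoords, inCoords]
  have h' := AnalyticAt.comp (f := f) (g := rCoords r) (by rwa [hf])
    ((LinearMap.toContinuousLinearMap f).analyticAt _)
  rwa [hcomp] at h'

theorem HolAt.eventually {q : Module.Dual ℂ H} {z : ℂ} (h : HolAt r (q, z)) :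
    ∀ᶠ p : (Fin (Module.finrank ℂ (Module.Dual ℂ H)) → ℂ) × ℂ in
      𝓝 (coords (Module.Dual ℂ H) q, z), HolAt r ((coords (Module.Dual ℂ H)).symm p.1, p.2) :=
  h.analyticAt_rCoords.eventually_analyticAt.mono fun _ hp => HolAt.of_analyticAt_rCoords hp

/-- The differential of `r(·, z)` at `q`; its values are the derivatives `derivBase` along constant
vector fields, see `HolAt.derivBase_eq`. -/
noncomputable def baseDeriv (r : Module.Dual ℂ H × ℂ → g ⊗[ℂ] g) (q : Module.Dual ℂ H) (z : ℂ) :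
    Module.Dual ℂ H →ₗ[ℂ] g ⊗[ℂ] g :=
  (coords (g ⊗[ℂ] g)).symm.toLinearMap ∘ₗ
    (fderiv ℂ (fun c => rCoords r (c, z)) (coords (Module.Dual ℂ H) q)).toLinearMap ∘ₗ
      (coords (Module.Dual ℂ H)).toLinearMap

theorem coords_baseDeriv (q : Module.Dual ℂ H) (z : ℂ) (a : Module.Dual ℂ H) :
    coords (g ⊗[ℂ] g) (baseDeriv r q z a) = fderiv ℂ (fun c => rCoords r (c, z))
      (coords (Module.Dual ℂ H) q) (coords (Module.Dual ℂ H) a) := by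
  simp [baseDeriv]

theorem HolAt.hasDerivAt_base {q : Module.Dual ℂ H} {z : ℂ} (h : HolAt r (q, z))
    (a : Module.Dual ℂ H) :
    HasDerivAt (fun s : ℂ => coords (g ⊗[ℂ] g) (r (q + s • a, z)))
      (coords (g ⊗[ℂ] g) (baseDeriv r q z a)) 0 := by
  have hr := hasFDerivAt_prodMk_of_differentiableAt h.analyticAt_rCoords.differentiableAt
  have hline := HasFDerivAt.comp_hasDerivAt_of_eq (0 : ℂ) hr (hasDerivAt_coords_line q a) (by simp)
  rw [coords_baseDeriv, hr.fderiv]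
  simpa [rCoords, Function.comp_def] using hline

theorem HolAt.derivBase_eq {q : Module.Dual ℂ H} {z : ℂ} (h : HolAt r (q, z))
    (a : Module.Dual ℂ H) : derivBase r a q z = baseDeriv r q z a := by
  unfold derivBase derivZero
  rw [(h.hasDerivAt_base a).deriv, LinearEquiv.symm_apply_apply]

variable (g) in
/-- The contraction of the second factor, as a continuous bilinear map in coordinates. -/
noncomputable def contrSndCoords :
    (Fin (Module.finrank ℂ (Module.Dual ℂ g)) → ℂ) →L[ℂ]
      (Fin (Module.finrank ℂ (g ⊗[ℂ] g)) → ℂ) →L[ℂ] (Fin (Module.finrank ℂ g) → ℂ) :=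
  coordsBilin ((contrSndHom g).compr₂ (coords g).toLinearMap)

variable (g) in
/-- The contraction of the first factor, as a continuous bilinear map in coordinates. -/
noncomputable def contrFstCoords :
    (Fin (Module.finrank ℂ (Module.Dual ℂ g)) → ℂ) →L[ℂ]
      (Fin (Module.finrank ℂ (g ⊗[ℂ] g)) → ℂ) →L[ℂ] (Fin (Module.finrank ℂ g) → ℂ) :=
  coordsBilin ((contrFstHom g).compr₂ (coords g).toLinearMap)

theorem contrSndCoords_coords (ξ : Module.Dual ℂ g) (s : g ⊗[ℂ] g) :
    contrSndCoords g (coords _ ξ) (coords _ s) = coords g (contrSnd ξ s) :=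
  coordsBilin_coords _ _ _

theorem contrFstCoords_coords (ξ : Module.Dual ℂ g) (s : g ⊗[ℂ] g) :
    contrFstCoords g (coords _ ξ) (coords _ s) = coords g (contrFst ξ s) :=
  coordsBilin_coords _ _ _

theorem coords_laxAt (x : Phase H) (z : ℂ) :
    coords g (laxAt r x z) = coords g (x.2.1 : g)
      + contrSndCoords g (coords _ x.2.2) (coords _ (r (x.1, z))) := by
  rw [contrSndCoords_coords, laxAt, map_add]

theorem HolAt.hasDerivAt_laxAt {x : Phase H} {z : ℂ} (h : HolAt r (x.1, z)) (v : Phase H) :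
    HasDerivAt (fun s : ℂ => coords g (laxAt r (x + s • v) z))
      (coords g (laxDeriv x.2.2 (r (x.1, z)) (baseDeriv r x.1 z) v)) 0 := by
  have hspin := (contrSndCoords g).hasFDerivAt.comp_hasDerivAt (0 : ℂ)
    (hasDerivAt_coords_line x.2.2 v.2.2)
  have hsum := (hasDerivAt_coords_line (x.2.1 : g) (v.2.1 : g)).add
    (hspin.clm_apply (h.hasDerivAt_base v.1))
  refine (hsum.congr_of_eventuallyEq (Eventually.of_forall fun s => ?_)).congr_deriv ?_
  · simp [coords_laxAt]
  · simp only [Function.comp_apply, zero_smul, add_zero, contrSndCoords_coords]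
    simp only [laxDeriv_apply, map_add, add_assoc]

theorem HolAt.differentiableAt_spectral {q : Module.Dual ℂ H} {z : ℂ} (h : HolAt r (q, z)) :
    DifferentiableAt ℂ (fun z => coords (g ⊗[ℂ] g) (r (q, z))) z := by
  have hr := h.analyticAt_rCoords.differentiableAt.fun_comp' z
    ((differentiableAt_const (coords _ q)).prodMk differentiableAt_id)
  simpa [rCoords] using hr

theorem HolAt.differentiableAt_baseDeriv {q : Module.Dual ℂ H} {z : ℂ} (h : HolAt r (q, z))
    (a : Module.Dual ℂ H) :
    DifferentiableAt ℂ (fun z => coords (g ⊗[ℂ] g) (baseDeriv r q z a)) z := by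
  simpa only [coords_baseDeriv] using differentiableAt_fderiv_prodMk h.analyticAt_rCoords _

theorem HolAt.differentiableAt_laxAt {x : Phase H} {z : ℂ} (h : HolAt r (x.1, z)) :
    DifferentiableAt ℂ (fun z => coords g (laxAt r x z)) z := by
  simp only [coords_laxAt]
  exact ((contrSndCoords g _).differentiableAt.comp z h.differentiableAt_spectral).const_add _

theorem HolAt.differentiableAt_laxDeriv {x : Phase H} {z : ℂ} (h : HolAt r (x.1, z))
    (v : Phase H) : DifferentiableAt ℂ
      (fun z => coords g (laxDeriv x.2.2 (r (x.1, z)) (baseDeriv r x.1 z) v)) z := by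
  simp only [laxDeriv_apply, map_add, ← contrSndCoords_coords]
  exact (((contrSndCoords g _).differentiableAt.comp z h.differentiableAt_spectral).const_add _).add
    ((contrSndCoords g _).differentiableAt.comp z (h.differentiableAt_baseDeriv v.1))

theorem HolAt.dirDeriv_laxAt {x : Phase H} {z : ℂ} (h : HolAt r (x.1, z)) (η : Module.Dual ℂ g)
    (v : Phase H) : dirDeriv (fun y => η (laxAt r y z)) x v
      = η (laxDeriv x.2.2 (r (x.1, z)) (baseDeriv r x.1 z) v) := by
  have hη := (coordsCLM η).hasFDerivAt.comp_hasDerivAt (0 : ℂ) (h.hasDerivAt_laxAt v)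
  simp only [Function.comp_def, coordsCLM_coords] at hη
  exact hη.deriv

/-- The Lax function in coordinates on phase space and on `g`. -/
noncomputable def laxCoords (r : Module.Dual ℂ H × ℂ → g ⊗[ℂ] g)
    (p : (Fin (Module.finrank ℂ (Phase H)) → ℂ) × ℂ) : Fin (Module.finrank ℂ g) → ℂ :=
  coords g (laxAt r ((coords (Phase H)).symm p.1) p.2)

theorem HolAt.analyticAt_laxCoords {y : Fin (Module.finrank ℂ (Phase H)) → ℂ} {z : ℂ}
    (h : HolAt r (((coords (Phase H)).symm y).1, z)) : AnalyticAt ℂ (laxCoords r) (y, z) := by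
  let point : (Fin (Module.finrank ℂ (Phase H)) → ℂ) × ℂ →ₗ[ℂ] Phase H :=
    (coords (Phase H)).symm.toLinearMap ∘ₗ LinearMap.fst ℂ _ ℂ
  have hbase := analyticAt_coords_linear (LinearMap.fst ℂ _ _ ∘ₗ point) (y, z)
  have hmomentum := analyticAt_coords_linear
    (H.toSubmodule.subtype ∘ₗ LinearMap.fst ℂ _ _ ∘ₗ LinearMap.snd ℂ _ _ ∘ₗ point) (y, z)
  have hspin := analyticAt_coords_linear
    (LinearMap.snd ℂ _ _ ∘ₗ LinearMap.snd ℂ _ _ ∘ₗ point) (y, z)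
  have hr := AnalyticAt.comp (g := rCoords r) (f := fun p => (coords _ (point p).1, p.2))
    (x := (y, z)) h.analyticAt_rCoords (hbase.prod analyticAt_snd)
  refine (hmomentum.add (AnalyticAt.comp₂ ((contrSndCoords g).analyticAt_bilinear _) hspin
    hr)).congr (Eventually.of_forall fun p => ?_)
  rw [laxCoords, coords_laxAt, Pi.add_apply, Function.comp_apply, rCoords,
    LinearEquiv.symm_apply_apply]
  rfl

theorem HolAt.fderiv_laxCoords {x : Phase H} {z : ℂ} (h : HolAt r (x.1, z)) (v : Phase H) :
    fderiv ℂ (fun y => laxCoords r (y, z)) (coords _ x) (coords _ v)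
      = coords g (laxDeriv x.2.2 (r (x.1, z)) (baseDeriv r x.1 z) v) := by
  have hlax := hasFDerivAt_prodMk_of_differentiableAt (HolAt.analyticAt_laxCoords (r := r)
    (y := coords _ x) (z := z) (by rwa [LinearEquiv.symm_apply_apply])).differentiableAt
  have hline := HasFDerivAt.comp_hasDerivAt_of_eq (0 : ℂ) hlax (hasDerivAt_coords_line x v)
    (by simp)
  rw [hlax.fderiv]
  refine hline.unique ?_
  simpa [laxCoords, Function.comp_def] using h.hasDerivAt_laxAt v

end RMatrix

section LaxMap

variable {g : Type*} [LieRing g] [LieAlgebra ℂ g] [FiniteDimensional ℂ g]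
  {H : LieSubalgebra ℂ g} {r : Module.Dual ℂ H × ℂ → g ⊗[ℂ] g}

theorem eventually_mem_baseDomain {q : Module.Dual ℂ H} (hq : q ∈ baseDomain r) :
    ∀ᶠ c in 𝓝 (coords (Module.Dual ℂ H) q), (coords (Module.Dual ℂ H)).symm c ∈ baseDomain r := by
  obtain ⟨δ, hδ, h⟩ := hq
  filter_upwards [eventually_eventually_nhds.mpr h] with c hc
  exact ⟨δ, hδ, by rwa [LinearEquiv.apply_symm_apply]⟩

theorem exists_regularBelow_of_mem_baseDomain {q : Module.Dual ℂ H} (hq : q ∈ baseDomain r) :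
    ∃ δ > 0, RegularBelow r q δ := by
  obtain ⟨δ, hδ, h⟩ := hq
  refine ⟨δ, hδ, fun z h0 h1 => ?_⟩
  simpa using h.self_of_nhds z h0 h1

theorem tendsto_coords_base (x : Phase H) :
    Tendsto (fun y => coords (Module.Dual ℂ H) ((coords (Phase H)).symm y).1)
      (𝓝 (coords _ x)) (𝓝 (coords (Module.Dual ℂ H) x.1)) := by
  have h := (coordsCLM ((coords (Module.Dual ℂ H)).toLinearMap ∘ₗ
    LinearMap.fst ℂ _ (H × Module.Dual ℂ g))).continuous.tendsto (coords _ x)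
  rwa [coordsCLM_coords] at h

variable [LieAlgebra.IsSimple ℂ g]

theorem IsDynamicalRMatrix.exists_bound_laxAt (hr : IsDynamicalRMatrix H r) {x : Phase H}
    (hx : x.1 ∈ baseDomain r) :
    ∃ C : ℝ, ∀ᶠ z in 𝓝[≠] (0 : ℂ), ‖z • coords g (laxAt r x z)‖ ≤ C := by
  have hpole := ((contrSndCoords g (coords _ x.2.2)).continuous.tendsto _).comp (hr.residue x.1 hx)
  have hconst : Tendsto (fun z : ℂ => z • coords g (x.2.1 : g)) (𝓝[≠] 0) (𝓝 0) := by
    have hcont : Continuous fun z : ℂ => z • coords g (x.2.1 : g) := by fun_prop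
    simpa only [zero_smul] using (hcont.tendsto 0).mono_left nhdsWithin_le_nhds
  obtain ⟨C, hC⟩ := (hconst.add hpole).norm.isBoundedUnder_le
  refine ⟨C, (eventually_map.mp hC).mono fun z hz => ?_⟩
  simpa only [coords_laxAt, smul_add, Function.comp_apply, map_smul] using hz

theorem IsDynamicalRMatrix.lax_hasValue (hr : IsDynamicalRMatrix H r) {x : Phase H}
    (hx : x.1 ∈ baseDomain r) {ρ : ℝ} (hρ : RegularBelow r x.1 ρ) {z : ℂ} (h0 : 0 < ‖z‖)
    (h1 : ‖z‖ < ρ) : (lax r x).HasValue z (laxAt r x z) := by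
  obtain ⟨C, hC⟩ := hr.exists_bound_laxAt hx
  obtain ⟨X, -, hX⟩ := exists_loop_of_bounded_smul (h0.trans h1)
    (fun z h0 h1 => (hρ z h0 h1).differentiableAt_laxAt) hC
  rw [lax, Loop.ofFun_eq (eventually_punctured_of_forall (h0.trans h1) hX)]
  exact hX z h0 h1

theorem IsDynamicalRMatrix.laxBracket_eq (hr : IsDynamicalRMatrix H r) (x : Phase H) {z w : ℂ}
    (hz : HolAt r (x.1, z)) (hw : HolAt r (x.1, w)) (hzw : HolAt r (x.1, z - w)) :
    laxBracket x.2.2 (r (x.1, z)) (r (x.1, w)) (baseDeriv r x.1 z) (baseDeriv r x.1 w) =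
      -(lieSlotOne (r (x.1, z - w)) (laxAt r x z) + lieSlotTwo (r (x.1, z - w)) (laxAt r x w))
        - baseDeriv r x.1 (z - w) (restrictDual H x.2.2) := by
  refine laxBracket_eq_of_yangBaxter x.2.2 (hr.zeroWeight _ _ hzw _ x.2.1.2) ?_
  have hyb := hr.cdybe x.1 z w 0 hzw (by rwa [sub_zero]) (by rwa [sub_zero])
  simpa only [altDeriv, sub_zero, hz.derivBase_eq, hw.derivBase_eq, hzw.derivBase_eq] using hyb

theorem IsDynamicalRMatrix.poissonTensor_eq (hr : IsDynamicalRMatrix H r) (x : Phase H) {z w : ℂ}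
    (hz : HolAt r (x.1, z)) (hw : HolAt r (x.1, w)) (hzw : HolAt r (x.1, z - w)) :
    poissonTensor (fun y => laxAt r y z) (fun y => laxAt r y w) x =
      -(lieSlotOne (r (x.1, z - w)) (laxAt r x z) + lieSlotTwo (r (x.1, z - w)) (laxAt r x w))
        - derivBase r (restrictDual H x.2.2) x.1 (z - w) := by
  rw [hzw.derivBase_eq, ← hr.laxBracket_eq x hz hw hzw]
  exact poissonTensor_eq_laxBracket hz.dirDeriv_laxAt hw.dirDeriv_laxAt

theorem IsDynamicalRMatrix.flipTensor_eq (hr : IsDynamicalRMatrix H r) {q : Module.Dual ℂ H}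
    {z w : ℂ} (hzw : HolAt r (q, z - w)) (hwz : HolAt r (q, w - z)) :
    flipTensor (r (q, w - z)) = -r (q, z - w) := by
  have h := hr.unitarity q (z - w) hzw (by rwa [neg_sub])
  rw [neg_sub] at h
  exact eq_neg_of_add_eq_zero_right h

theorem IsDynamicalRMatrix.poissonTensor_eq_flip (hr : IsDynamicalRMatrix H r) (x : Phase H)
    {z w : ℂ} (hz : HolAt r (x.1, z)) (hw : HolAt r (x.1, w)) (hzw : HolAt r (x.1, z - w))
    (hwz : HolAt r (x.1, w - z)) :
    poissonTensor (fun y => laxAt r y z) (fun y => laxAt r y w) x =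
      -lieSlotOne (r (x.1, z - w)) (laxAt r x z)
        + lieSlotTwo (flipTensor (r (x.1, w - z))) (laxAt r x w)
        - derivBase r (restrictDual H x.2.2) x.1 (z - w) := by
  rw [hr.poissonTensor_eq x hz hw hzw, hr.flipTensor_eq hzw hwz, neg_add]
  simp only [lieSlotTwo, map_neg]

theorem Loop.step_one_hasValue_of_eventually {V : Type*} [AddCommGroup V] [Module ℂ V]
    [FiniteDimensional ℂ V] {ρ : ℝ} {hρ : 0 < ρ} {c : SeqSpace V} {F : ℂ → V}
    (hc : ∀ᶠ z in 𝓝[≠] (0 : ℂ), (Loop.step 1 hρ c).HasValue z (F z)) {R : ℝ}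
    (hF : ∀ z, 0 < ‖z‖ → ‖z‖ < R → DifferentiableAt ℂ (fun z => coords V (F z)) z) {z : ℂ}
    (h0 : 0 < ‖z‖) (h1 : ‖z‖ < R) : (Loop.step 1 hρ c).HasValue z (F z) := by
  obtain ⟨ε, hε, hval⟩ := exists_pos_forall_of_eventually_punctured hc
  obtain ⟨s, hs, hsε⟩ := exists_between hε
  have hnorm : ‖(s : ℂ)‖ = s := Complex.norm_of_nonneg hs.le
  have hsum := (hval s (by rwa [hnorm]) (by rwa [hnorm])).summable
  rw [hnorm] at hsum
  refine Loop.hasValue_of_eventually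
    (C := s * ∑' k : ℤ, ‖coords V ((Loop.step 1 hρ c).1 k)‖ * s ^ k) hF
    (eventually_punctured_of_forall hs fun z h0 h1 => ?_) hc h0 h1
  exact Loop.norm_smul_coords_le (fun n hn => Loop.step_one_apply_of_lt hρ c hn) hsum h0 h1.le
    (hval z h0 (h1.trans hsε))

/-- Near a point over `baseDomain r` the Lax map factors through a single step of the inductive
limit, in a differentiable way: `Γ` is the lift and `Γ'` its derivative. -/
structure IsLaxLift (r : Module.Dual ℂ H × ℂ → g ⊗[ℂ] g) (x : Phase H) {ρ : ℝ} (hρ : 0 < ρ)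
    (Γ : (Fin (Module.finrank ℂ (Phase H)) → ℂ) → SeqSpace g)
    (Γ' : (Fin (Module.finrank ℂ (Phase H)) → ℂ) →L[ℂ] SeqSpace g) : Prop where
  hasFDerivAt : HasFDerivAt Γ Γ' (coords _ x)
  step_eq : ∀ᶠ y in 𝓝 (coords _ x), Loop.step 1 hρ (Γ y) = lax r ((coords (Phase H)).symm y)
  hasValue : ∀ (v : Phase H) (R : ℝ), RegularBelow r x.1 R → ∀ z : ℂ, 0 < ‖z‖ → ‖z‖ < R →
    (Loop.step 1 hρ (Γ' (coords _ v))).HasValue z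
      (laxDeriv x.2.2 (r (x.1, z)) (baseDeriv r x.1 z) v)

theorem IsDynamicalRMatrix.exists_isLaxLift (hr : IsDynamicalRMatrix H r) {x : Phase H}
    (hx : x.1 ∈ baseDomain r) : ∃ (ρ : ℝ) (hρ : 0 < ρ)
      (Γ : (Fin (Module.finrank ℂ (Phase H)) → ℂ) → SeqSpace g)
      (Γ' : (Fin (Module.finrank ℂ (Phase H)) → ℂ) →L[ℂ] SeqSpace g), IsLaxLift r x hρ Γ Γ' := by
  have hbounded : ∀ᶠ y in 𝓝 (coords _ x), ∃ C : ℝ, ∀ᶠ z in 𝓝[≠] (0 : ℂ),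
      ‖z • laxCoords r (y, z)‖ ≤ C := by
    filter_upwards [(tendsto_coords_base x).eventually (eventually_mem_baseDomain hx)] with y hy
    rw [LinearEquiv.symm_apply_apply] at hy
    exact hr.exists_bound_laxAt (x := (coords (Phase H)).symm y) hy
  obtain ⟨δ, hδ, hhol⟩ := id hx
  have hanalytic : ∀ᶠ y in 𝓝 (coords _ x), ∀ z : ℂ, 0 < ‖z‖ → ‖z‖ < δ →
      AnalyticAt ℂ (laxCoords r) (y, z) := by
    filter_upwards [(tendsto_coords_base x).eventually hhol] with y hy z h0 h1
    rw [LinearEquiv.symm_apply_apply] at hy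
    exact HolAt.analyticAt_laxCoords (hy z h0 h1)
  obtain ⟨ρ, hρ, Γ, Γ', hΓ, hval, hval'⟩ := exists_hasFDerivAt_step_one hδ hanalytic hbounded
  refine ⟨ρ, hρ, Γ, Γ', hΓ, ?_, fun v R hR z h0 h1 => ?_⟩
  · filter_upwards [hval] with y hy
    refine (Loop.ofFun_eq (eventually_punctured_of_forall hρ fun z h0 h1 => ?_)).symm
    simpa only [laxCoords, LinearEquiv.symm_apply_apply] using hy z h0 h1
  · obtain ⟨δ', hδ', hreg⟩ := exists_regularBelow_of_mem_baseDomain hx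
    refine Loop.step_one_hasValue_of_eventually (F := fun z =>
      laxDeriv x.2.2 (r (x.1, z)) (baseDeriv r x.1 z) v) ?_
      (fun z h0 h1 => (hR z h0 h1).differentiableAt_laxDeriv v) h0 h1
    filter_upwards [eventually_punctured_of_forall hρ (hval' (coords _ v)),
      eventually_punctured_of_forall hδ' hreg] with z hz hz'
    rwa [hz'.fderiv_laxCoords, LinearEquiv.symm_apply_apply] at hz

end LaxMap

/-! ### Hamiltonian flows -/

section Hamiltonian

theorem Loop.Smooth.differentiable_step {V : Type*} [AddCommGroup V] [Module ℂ V]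
    [FiniteDimensional ℂ V] {f : Loop V → ℂ} (hf : Loop.Smooth f) (N : ℕ) {ρ : ℝ} (hρ : 0 < ρ) :
    Differentiable ℂ fun x : SeqSpace V => f (Loop.step N hρ x) :=
  (hf N ρ hρ).differentiable (by simp)

theorem Loop.Smooth.fderiv_step {V : Type*} [AddCommGroup V] [Module ℂ V] [FiniteDimensional ℂ V]
    {f : Loop V → ℂ} {df : Loop V → Loop (Module.Dual ℂ V)} (hf : Loop.Smooth f)
    (hdf : Loop.IsDifferential f df) (N : ℕ) {ρ : ℝ} (hρ : 0 < ρ) (x y : SeqSpace V) :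
    fderiv ℂ (fun x : SeqSpace V => f (Loop.step N hρ x)) x y
      = Loop.pairing (df (Loop.step N hρ x)) (Loop.step N hρ y) := by
  have hline := HasFDerivAt.comp_hasDerivAt_of_eq (0 : ℂ)
    (hf.differentiable_step N hρ x).hasFDerivAt (hasDerivAt_const_add_smul x y) (by simp)
  simp only [Function.comp_def, Loop.step_add_smul] at hline
  exact hline.unique (hdf _ _)

variable {g : Type*} [LieRing g] [LieAlgebra ℂ g] [FiniteDimensional ℂ g]
  {H : LieSubalgebra ℂ g}

theorem exists_hamiltonian_vector (l : Module.Dual ℂ (Phase H)) (x : Phase H) :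
    ∃ X : Phase H, ∀ m : Module.Dual ℂ (Phase H), poisson l m x = m X := by
  let bracketWith : Module.Dual ℂ (Module.Dual ℂ (Phase H)) :=
    { toFun := fun m => poisson l m x
      map_add' := fun m m' => by
        simp only [poisson, dP, dQ, gradXi, dirDeriv_dual, LinearMap.add_apply, add_smul, mul_add,
          Finset.sum_add_distrib, lie_add, map_add, Finset.sum_sub_distrib]
        ring
      map_smul' := fun c m => by
        simp only [poisson, dP, dQ, gradXi, dirDeriv_dual, LinearMap.smul_apply, smul_eq_mul,
          mul_smul, ← Finset.smul_sum, lie_smul, map_smul, RingHom.id_apply, mul_add,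
          Finset.mul_sum]
        congr 1
        exact Finset.sum_congr rfl fun i _ => by ring }
  obtain ⟨X, hX⟩ := (Module.evalEquiv ℂ (Phase H)).surjective bracketWith
  exact ⟨X, fun m => (LinearMap.congr_fun hX m).symm⟩

theorem poisson_eq_of_dirDeriv_eq {l : Module.Dual ℂ (Phase H)} {x X : Phase H}
    (hX : ∀ m : Module.Dual ℂ (Phase H), poisson l m x = m X) {F : Phase H → ℂ}
    (m : Module.Dual ℂ (Phase H)) (hF : ∀ v, dirDeriv F x v = m v) :
    poisson l F x = dirDeriv F x X := by
  rw [hF, ← hX]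
  exact poisson_congr (fun _ => rfl) fun v => (hF v).trans (dirDeriv_dual _ _ _).symm

theorem SatisfiesHamiltonAt.exists_velocity {F : Phase H → ℂ} {φ : ℝ → Phase H} {t : ℝ}
    (h : SatisfiesHamiltonAt F φ t) :
    ∃ v : Phase H, HasDerivAt (fun s => coords (Phase H) (φ s)) (coords (Phase H) v) t ∧
      ∀ l : Module.Dual ℂ (Phase H), l v = poisson l F (φ t) := by
  let coord (i : Fin (Module.finrank ℂ (Phase H))) : Module.Dual ℂ (Phase H) :=
    LinearMap.proj i ∘ₗ (coords (Phase H)).toLinearMap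
  have hφ : HasDerivAt (fun s => coords (Phase H) (φ s)) (fun i => poisson (coord i) F (φ t)) t :=
    hasDerivAt_pi.mpr fun i => h (coord i)
  refine ⟨(coords (Phase H)).symm fun i => poisson (coord i) F (φ t),
    by rwa [LinearEquiv.apply_symm_apply], fun l => ?_⟩
  have hl := ((coordsCLM l).hasFDerivAt.restrictScalars ℝ).comp_hasDerivAt t hφ
  simp only [Function.comp_def, coordsCLM_coords] at hl
  exact hl.unique (h l)

end Hamiltonian

section LaxHamiltonian

variable {g : Type*} [LieRing g] [LieAlgebra ℂ g] [FiniteDimensional ℂ g]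
  {H : LieSubalgebra ℂ g} {r : Module.Dual ℂ H × ℂ → g ⊗[ℂ] g} {x : Phase H}
  {ρ : ℝ} {hρ : 0 < ρ} {Γ : (Fin (Module.finrank ℂ (Phase H)) → ℂ) → SeqSpace g}
  {Γ' : (Fin (Module.finrank ℂ (Phase H)) → ℂ) →L[ℂ] SeqSpace g}
  {f : Loop g → ℂ} {df : Loop g → Loop (Module.Dual ℂ g)}

theorem IsLaxLift.hasFDerivAt_comp_lax (h : IsLaxLift r x hρ Γ Γ') (hf : Loop.Smooth f) :
    HasFDerivAt (fun c => f (lax r ((coords (Phase H)).symm c)))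
      ((fderiv ℂ (fun x : SeqSpace g => f (Loop.step 1 hρ x)) (Γ (coords _ x))).comp Γ')
      (coords (Phase H) x) := by
  refine ((hf.differentiable_step 1 hρ (Γ (coords _ x))).hasFDerivAt.comp _
    h.hasFDerivAt).congr_of_eventuallyEq ?_
  filter_upwards [h.step_eq] with y hy
  rw [Function.comp_apply, hy]

theorem IsLaxLift.dirDeriv_comp_lax (h : IsLaxLift r x hρ Γ Γ') (hf : Loop.Smooth f)
    (v : Phase H) : dirDeriv (fun y => f (lax r y)) x v
      = fderiv ℂ (fun c => f (lax r ((coords (Phase H)).symm c))) (coords _ x) (coords _ v) := by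
  have hlax := h.hasFDerivAt_comp_lax hf
  have hline := HasFDerivAt.comp_hasDerivAt_of_eq (0 : ℂ) hlax (hasDerivAt_coords_line x v)
    (by simp)
  simp only [Function.comp_def, LinearEquiv.symm_apply_apply] at hline
  rw [hlax.fderiv]
  exact hline.deriv

theorem IsLaxLift.dirDeriv_comp_lax_eq_pairing (h : IsLaxLift r x hρ Γ Γ') (hf : Loop.Smooth f)
    (hdf : Loop.IsDifferential f df) (v : Phase H) : dirDeriv (fun y => f (lax r y)) x v
      = Loop.pairing (df (lax r x)) (Loop.step 1 hρ (Γ' (coords _ v))) := by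
  have hx := h.step_eq.self_of_nhds
  rw [LinearEquiv.symm_apply_apply] at hx
  rw [h.dirDeriv_comp_lax hf, (h.hasFDerivAt_comp_lax hf).fderiv, ← hx, ← hf.fderiv_step hdf]
  rfl

theorem IsLaxLift.dirDeriv_comp_lax_eq_circleIntegral (h : IsLaxLift r x hρ Γ Γ')
    (hf : Loop.Smooth f) (hdf : Loop.IsDifferential f df) {R σ : ℝ} (hreg : RegularBelow r x.1 R)
    (hM : ConvergesOn (df (lax r x)).1 R) (hσ : 0 < σ) (hσR : σ < R) (v : Phase H) :
    dirDeriv (fun y => f (lax r y)) x v = (2 * Real.pi * Complex.I : ℂ)⁻¹ * ∮ w in C(0, σ),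
      (df (lax r x)).eval w (laxDeriv x.2.2 (r (x.1, w)) (baseDeriv r x.1 w) v) := by
  have hval : ∀ w : ℂ, ‖w‖ = σ → (Loop.step 1 hρ (Γ' (coords _ v))).HasValue w
      (laxDeriv x.2.2 (r (x.1, w)) (baseDeriv r x.1 w) v) := fun w hw =>
    h.hasValue v R hreg w (hw ▸ hσ) (hw ▸ hσR)
  have hnorm : ‖(σ : ℂ)‖ = σ := Complex.norm_of_nonneg hσ.le
  have hsum := (hval σ hnorm).summable
  rw [hnorm] at hsum
  rw [h.dirDeriv_comp_lax_eq_pairing hf hdf,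
    Loop.pairing_eq_circleIntegral _ _ hσ (hM σ hσ hσR) hsum]
  congr 1
  refine circleIntegral.integral_congr hσ.le fun w hw => ?_
  simp only [(hval w (mem_sphere_zero_iff_norm.mp hw)).eval_eq]

theorem IsLaxLift.hasDerivAtLoop (h : IsLaxLift r x hρ Γ Γ') {φ : ℝ → Phase H} {t : ℝ}
    (hφt : φ t = x) {v : Phase H}
    (hv : HasDerivAt (fun s => coords (Phase H) (φ s)) (coords _ v) t) :
    Loop.HasDerivAtLoop (fun s => lax r (φ s)) (Loop.step 1 hρ (Γ' (coords _ v))) t := by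
  subst hφt
  refine ⟨1, ρ, hρ, fun s => Γ (coords _ (φ s)), Γ' (coords _ v), ?_, rfl,
    HasFDerivAt.comp_hasDerivAt (f := fun s => coords (Phase H) (φ s)) t
      (h.hasFDerivAt.restrictScalars ℝ) hv⟩
  filter_upwards [hv.continuousAt.eventually h.step_eq] with s hs
  rwa [LinearEquiv.symm_apply_apply] at hs

end LaxHamiltonian

/-! ### The operator `R` -/

section OperatorR

open Complex Metric

variable {g : Type*} [LieRing g] [LieAlgebra ℂ g] [FiniteDimensional ℂ g]
  {H : LieSubalgebra ℂ g} {r : Module.Dual ℂ H × ℂ → g ⊗[ℂ] g}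
  {q : Module.Dual ℂ H} {M : Loop (Module.Dual ℂ g)} {ρ σ : ℝ} {z : ℂ}

theorem ConvergesOn.differentiableAt_eval {V : Type*} [AddCommGroup V] [Module ℂ V]
    [FiniteDimensional ℂ V] {M : Loop V} (hM : ConvergesOn M.1 ρ) {w : ℂ} (h0 : 0 < ‖w‖)
    (h1 : ‖w‖ < ρ) : DifferentiableAt ℂ (fun w => coords V (M.eval w)) w :=
  differentiableAt_of_hasLaurentSumOn (fun s hs0 hs1 => Loop.hasLaurentSumOn hs0.le fun z hz =>
    Loop.hasValue_eval (by
      rw [mem_sphere_zero_iff_norm.mp hz]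
      exact hM s hs0 hs1)) h0 h1

theorem ConvergesOn.differentiableAt_contrFst_eval (hM : ConvergesOn M.1 ρ) {s : ℂ → g ⊗[ℂ] g}
    {w : ℂ} (h0 : 0 < ‖w‖) (h1 : ‖w‖ < ρ)
    (hs : DifferentiableAt ℂ (fun w => coords (g ⊗[ℂ] g) (s w)) w) :
    DifferentiableAt ℂ (fun w => coords g (contrFst (M.eval w) (s w))) w := by
  simp only [← contrFstCoords_coords]
  exact ((contrFstCoords g).differentiableAt.comp w (hM.differentiableAt_eval h0 h1)).clm_apply hs

theorem ConvergesOn.continuousOn_contrFst_eval (hM : ConvergesOn M.1 ρ) (hσ : 0 < σ) (hσρ : σ < ρ)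
    {s : ℂ → g ⊗[ℂ] g}
    (hs : ∀ w : ℂ, ‖w‖ = σ → DifferentiableAt ℂ (fun w => coords (g ⊗[ℂ] g) (s w)) w) :
    ContinuousOn (fun w => coords g (contrFst (M.eval w) (s w))) (sphere 0 σ) := by
  intro w hw
  have hw := mem_sphere_zero_iff_norm.mp hw
  exact (hM.differentiableAt_contrFst_eval (by rwa [hw]) (by rwa [hw])
    (hs w hw)).continuousAt.continuousWithinAt

theorem RegularBelow.holAt_sub {R : ℝ} (h : RegularBelow r q R) {w : ℂ} (hwz : w ≠ z)
    (hR : ‖w‖ + ‖z‖ < R) : HolAt r (q, w - z) :=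
  h _ (norm_pos_iff.mpr (sub_ne_zero.mpr hwz)) ((norm_sub_le w z).trans_lt hR)

theorem HolAt.differentiableAt_spectral_sub {w : ℂ} (h : HolAt r (q, w - z)) :
    DifferentiableAt ℂ (fun w => coords (g ⊗[ℂ] g) (r (q, w - z))) w :=
  DifferentiableAt.comp (g := fun z => coords (g ⊗[ℂ] g) (r (q, z))) (f := fun w => w - z) w
    h.differentiableAt_spectral (differentiableAt_id.sub_const z)

theorem HolAt.differentiableAt_baseDeriv_sub {w : ℂ} (h : HolAt r (q, w - z))
    (a : Module.Dual ℂ H) :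
    DifferentiableAt ℂ (fun w => coords (g ⊗[ℂ] g) (baseDeriv r q (w - z) a)) w :=
  DifferentiableAt.comp (g := fun z => coords (g ⊗[ℂ] g) (baseDeriv r q z a)) (f := fun w => w - z)
    w (h.differentiableAt_baseDeriv a) (differentiableAt_id.sub_const z)

theorem RegularBelow.eventually {R R' : ℝ} (hq : q ∈ baseDomain r) (h : RegularBelow r q R)
    (hR : R' < R) : ∀ᶠ c in 𝓝 (coords (Module.Dual ℂ H) q),
      RegularBelow r ((coords (Module.Dual ℂ H)).symm c) R' := by
  obtain ⟨δ, hδ, hsmall⟩ := hq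
  have hK : IsCompact (closedBall (0 : ℂ) R' \ ball 0 (δ / 2)) :=
    (isCompact_closedBall 0 R').diff isOpen_ball
  have hannulus : ∀ᶠ c in 𝓝 (coords (Module.Dual ℂ H) q),
      ∀ u ∈ closedBall (0 : ℂ) R' \ ball 0 (δ / 2),
        HolAt r ((coords (Module.Dual ℂ H)).symm c, u) := by
    refine hK.eventually_forall_of_forall_eventually fun u hu => ?_
    have hu1 : ‖u‖ ≤ R' := by simpa using hu.1
    have hu2 : δ / 2 ≤ ‖u‖ := by simpa using hu.2
    exact (h u ((half_pos hδ).trans_le hu2) (hu1.trans_lt hR)).eventually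
  filter_upwards [hsmall, hannulus] with c hc1 hc2 u h0 hu
  rcases lt_or_ge ‖u‖ (δ / 2) with hlt | hge
  · exact hc1 u h0 (hlt.trans (half_lt_self hδ))
  · exact hc2 u ⟨by simpa using hu.le, by simpa using hge⟩

/-- `(2πi)⁻¹ ∮ ⟨M(w) ⊗ 1, s(w)⟩ dw` over the circle `|w| = σ`, with values in `g`. -/
noncomputable def contrIntegral (M : Loop (Module.Dual ℂ g)) (s : ℂ → g ⊗[ℂ] g) (σ : ℝ) : g :=
  (coords g).symm ((2 * Real.pi * I : ℂ)⁻¹ • ∮ w in C(0, σ), coords g (contrFst (M.eval w) (s w)))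

theorem apply_contrIntegral_add {s t : ℂ → g ⊗[ℂ] g} (hσ : 0 ≤ σ)
    (hs : ContinuousOn (fun w => coords g (contrFst (M.eval w) (s w))) (sphere 0 σ))
    (ht : ContinuousOn (fun w => coords g (contrFst (M.eval w) (t w))) (sphere 0 σ))
    (φ ψ : Module.Dual ℂ g) :
    φ (contrIntegral M s σ) + ψ (contrIntegral M t σ) = (2 * Real.pi * I : ℂ)⁻¹ *
      ∮ w in C(0, σ), (φ (contrFst (M.eval w) (s w)) + ψ (contrFst (M.eval w) (t w))) := by
  have hs' : CircleIntegrable (fun w => coordsCLM φ (coords g (contrFst (M.eval w) (s w)))) 0 σ :=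
    ((coordsCLM φ).continuous.comp_continuousOn hs).circleIntegrable hσ
  have ht' : CircleIntegrable (fun w => coordsCLM ψ (coords g (contrFst (M.eval w) (t w)))) 0 σ :=
    ((coordsCLM ψ).continuous.comp_continuousOn ht).circleIntegrable hσ
  simp only [contrIntegral, ← coordsCLM_apply, map_smul, smul_eq_mul,
    ← circleIntegral_clm_comp_comm _ (hs.circleIntegrable hσ),
    ← circleIntegral_clm_comp_comm _ (ht.circleIntegrable hσ), ← mul_add]
  rw [← circleIntegral.integral_add hs' ht']
  simp only [coordsCLM_coords]

theorem HasValueR.opR_eq {v : g} (h : HasValueR r q M z v) : opR r q M z = v := by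
  unfold opR
  rw [Tendsto.limUnder_eq h, LinearEquiv.symm_apply_apply]

section PrincipalValue

variable [LieAlgebra.IsSimple ℂ g]

theorem IsDynamicalRMatrix.tendsto_smul_contrFst_eval (hr : IsDynamicalRMatrix H r)
    (hq : q ∈ baseDomain r) (hM : ConvergesOn M.1 ρ) (h0 : 0 < ‖z‖) (h1 : ‖z‖ < ρ) :
    Tendsto (fun w => (w - z) • coords g (contrFst (M.eval w) (r (q, w - z)))) (𝓝[≠] z)
      (𝓝 (coords g (contrFst (M.eval z) (casimir g)))) := by
  have heval : Tendsto (fun w => coords _ (M.eval w)) (𝓝[≠] z) (𝓝 (coords _ (M.eval z))) :=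
    (hM.differentiableAt_eval h0 h1).continuousAt.tendsto.mono_left nhdsWithin_le_nhds
  have hsub : Tendsto (fun w : ℂ => w - z) (𝓝[≠] z) (𝓝[≠] 0) := by
    refine tendsto_nhdsWithin_iff.mpr ⟨?_, ?_⟩
    · have hcont : Continuous fun w : ℂ => w - z := by fun_prop
      simpa only [sub_self] using (hcont.tendsto z).mono_left nhdsWithin_le_nhds
    · filter_upwards [self_mem_nhdsWithin] with w hw
      exact sub_ne_zero.mpr hw
  have hcontr := ((contrFstCoords g).isBoundedBilinearMap.continuous.tendsto
    (coords _ (M.eval z), coords _ (casimir g))).comp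
      (heval.prodMk_nhds ((hr.residue q hq).comp hsub))
  simpa only [Function.comp_def, map_smul, contrFstCoords_coords] using hcontr

theorem IsDynamicalRMatrix.hasValueR (hr : IsDynamicalRMatrix H r) (hq : q ∈ baseDomain r)
    (hreg : RegularBelow r q (ρ + ‖z‖)) (hM : ConvergesOn M.1 ρ) (hσ : 0 < σ) (hσz : σ < ‖z‖)
    (hzρ : ‖z‖ < ρ) :
    HasValueR r q M z (contrIntegral M (fun w => r (q, w - z)) σ
      + (2⁻¹ : ℂ) • contrFst (M.eval z) (casimir g)) := by
  have hdiff : ∀ w, 0 < ‖w‖ → ‖w‖ < ρ → w ≠ z → DifferentiableAt ℂ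
      (fun w => coords g (contrFst (M.eval w) (r (q, w - z)))) w := fun w h0 h1 hwz =>
    hM.differentiableAt_contrFst_eval h0 h1
      (hreg.holAt_sub hwz (by linarith)).differentiableAt_spectral_sub
  have hpole := hr.tendsto_smul_contrFst_eval hq hM (hσ.trans hσz) hzρ
  have hvalue : coords g (contrIntegral M (fun w => r (q, w - z)) σ
      + (2⁻¹ : ℂ) • contrFst (M.eval z) (casimir g))
      = (2 * Real.pi * I : ℂ)⁻¹ • ((∮ w in C(0, σ), coords g (contrFst (M.eval w) (r (q, w - z))))
        + (Real.pi * I : ℂ) • coords g (contrFst (M.eval z) (casimir g))) := by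
    rw [contrIntegral, map_add, LinearEquiv.apply_symm_apply, smul_add, smul_smul, map_smul]
    have hpi : (Real.pi : ℂ) ≠ 0 := ofReal_ne_zero.mpr Real.pi_ne_zero
    have hhalf : (2⁻¹ : ℂ) = (2 * Real.pi * I : ℂ)⁻¹ * (Real.pi * I) := by
      field_simp
    rw [hhalf]
  unfold HasValueR
  rw [hvalue]
  exact (tendsto_circleIntegral_truncate_inner hzρ hσ hσz hdiff hpole).const_smul _

end PrincipalValue

/-- The kernel of `s ↦ contrIntegral M s σ` with respect to the angle on the circle `|w| = σ`. -/
noncomputable def contrKernel (M : Loop (Module.Dual ℂ g)) (σ : ℝ) (θ : ℝ) :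
    (Fin (Module.finrank ℂ (g ⊗[ℂ] g)) → ℂ) →L[ℂ] (Fin (Module.finrank ℂ g) → ℂ) :=
  (2 * Real.pi * I : ℂ)⁻¹ • deriv (circleMap 0 σ) θ •
    contrFstCoords g (coords _ (M.eval (circleMap 0 σ θ)))

theorem coords_contrIntegral (M : Loop (Module.Dual ℂ g)) (s : ℂ → g ⊗[ℂ] g) (σ : ℝ) :
    coords g (contrIntegral M s σ)
      = ∫ θ in (0 : ℝ)..2 * Real.pi, contrKernel M σ θ (coords _ (s (circleMap 0 σ θ))) := by
  rw [contrIntegral, LinearEquiv.apply_symm_apply, circleIntegral, ← intervalIntegral.integral_smul]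
  simp only [contrKernel, _root_.smul_apply, contrFstCoords_coords]

theorem ConvergesOn.continuous_contrKernel (hM : ConvergesOn M.1 ρ) (hσ : 0 < σ) (hσρ : σ < ρ) :
    Continuous (contrKernel M σ) := by
  have hnorm (θ : ℝ) : ‖circleMap 0 σ θ‖ = σ := by simp [abs_of_pos hσ]
  have heval : Continuous fun θ => coords _ (M.eval (circleMap 0 σ θ)) :=
    continuous_iff_continuousAt.mpr fun θ => ContinuousAt.comp
      (g := fun w => coords (Module.Dual ℂ g) (M.eval w)) (f := circleMap 0 σ)
      (hM.differentiableAt_eval (by rwa [hnorm]) (by rwa [hnorm])).continuousAt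
      (continuous_circleMap 0 σ).continuousAt
  exact ((continuous_deriv_circleMap 0 σ).smul ((contrFstCoords g).continuous.comp
    heval)).const_smul (2 * Real.pi * I : ℂ)⁻¹

theorem hasDerivAt_contrIntegral (hM : ConvergesOn M.1 ρ) (hσ : 0 < σ) (hσρ : σ < ρ)
    (hreg : ∀ w : ℂ, ‖w‖ = σ → HolAt r (q, w - z)) (a : Module.Dual ℂ H) :
    HasDerivAt (fun s : ℂ => coords g (contrIntegral M (fun w => r (q + s • a, w - z)) σ))
      (coords g (contrIntegral M (fun w => baseDeriv r q (w - z) a) σ)) 0 := by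
  have hcircle : Continuous fun θ => circleMap 0 σ θ - z :=
    (continuous_circleMap 0 σ).sub continuous_const
  have hkernel := hM.continuous_contrKernel hσ hσρ
  have hanalytic (θ : ℝ) : AnalyticAt ℂ (rCoords r) (coords _ q, circleMap 0 σ θ - z) :=
    (hreg _ (by simp [abs_of_pos hσ])).analyticAt_rCoords
  have hline := HasFDerivAt.comp_hasDerivAt_of_eq (0 : ℂ)
    (hasFDerivAt_integral_of_analyticAt (a := 0) (b := 2 * Real.pi) hcircle hkernel
      hanalytic).differentiableAt.hasFDerivAt (hasDerivAt_coords_line q a) (by simp)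
  rw [fderiv_integral_apply_of_analyticAt hcircle hkernel hanalytic] at hline
  simp only [coords_contrIntegral, coords_baseDeriv]
  simpa only [Function.comp_def, rCoords, LinearEquiv.symm_apply_apply] using hline

theorem IsDynamicalRMatrix.hasDerivAt_opR [LieAlgebra.IsSimple ℂ g] (hr : IsDynamicalRMatrix H r)
    (hq : q ∈ baseDomain r) (hreg : RegularBelow r q (2 * ρ)) (hM : ConvergesOn M.1 ρ)
    (hσ : 0 < σ) (hσz : σ < ‖z‖) (hzρ : ‖z‖ < ρ) (a : Module.Dual ℂ H) :
    HasDerivAt (fun s : ℂ => coords g (opR r (q + s • a) M z))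
      (coords g (contrIntegral M (fun w => baseDeriv r q (w - z) a) σ)) 0 := by
  have hinner := hasDerivAt_contrIntegral hM hσ (hσz.trans hzρ) (fun w hw =>
    hreg.holAt_sub (z := z) (by rintro rfl; exact hσz.ne hw.symm) (by linarith)) a
  refine (hinner.add_const (coords g ((2⁻¹ : ℂ) •
    contrFst (M.eval z) (casimir g)))).congr_of_eventuallyEq ?_
  have hline := tendsto_coords_line q a
  filter_upwards [hline.eventually (eventually_mem_baseDomain hq),
    hline.eventually (hreg.eventually hq (by linarith : ρ + ‖z‖ < 2 * ρ))] with s hdom hregs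
  rw [LinearEquiv.symm_apply_apply] at hdom hregs
  rw [(hr.hasValueR hdom hregs hM hσ hσz hzρ).opR_eq, map_add]

end OperatorR

section QuasiLax

open Complex Metric

variable {g : Type*} [LieRing g] [LieAlgebra ℂ g] [FiniteDimensional ℂ g]
  {H : LieSubalgebra ℂ g} {r : Module.Dual ℂ H × ℂ → g ⊗[ℂ] g}

theorem HolAt.eventually_line {q : Module.Dual ℂ H} {z : ℂ} (h : HolAt r (q, z))
    (a : Module.Dual ℂ H) : ∀ᶠ s : ℂ in 𝓝 0, HolAt r (q + s • a, z) := by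
  have hs := ((tendsto_coords_line q a).prodMk_nhds tendsto_const_nhds).eventually h.eventually
  simpa only [LinearEquiv.symm_apply_apply] using hs

variable [LieAlgebra.IsSimple ℂ g]

theorem IsDynamicalRMatrix.flipTensor_baseDeriv (hr : IsDynamicalRMatrix H r)
    {q : Module.Dual ℂ H} {z w : ℂ} (hzw : HolAt r (q, z - w)) (hwz : HolAt r (q, w - z))
    (a : Module.Dual ℂ H) :
    flipTensor (baseDeriv r q (w - z) a) = -baseDeriv r q (z - w) a := by
  have hflip := (coordsCLM ((coords (g ⊗[ℂ] g)).toLinearMap ∘ₗ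
    (TensorProduct.comm ℂ g g).toLinearMap)).hasFDerivAt.comp_hasDerivAt (0 : ℂ)
      (hwz.hasDerivAt_base a)
  simp only [Function.comp_def, coordsCLM_coords] at hflip
  refine (coords (g ⊗[ℂ] g)).injective ?_
  rw [map_neg]
  refine hflip.unique ((hzw.hasDerivAt_base a).neg.congr_of_eventuallyEq ?_)
  filter_upwards [hzw.eventually_line a, hwz.eventually_line a] with s hs1 hs2
  exact (congrArg (coords (g ⊗[ℂ] g)) (hr.flipTensor_eq hs1 hs2)).trans (map_neg _ _)

variable {x : Phase H} {z w : ℂ} {ζ : Module.Dual ℂ g}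

theorem IsDynamicalRMatrix.contrSnd_laxBracket (hr : IsDynamicalRMatrix H r)
    (hz : HolAt r (x.1, z)) (hw : HolAt r (x.1, w)) (hzw : HolAt r (x.1, z - w))
    (hwz : HolAt r (x.1, w - z)) (hζ : ∀ y : g, ζ ⁅y, laxAt r x w⁆ = 0) :
    contrSnd ζ (laxBracket x.2.2 (r (x.1, z)) (r (x.1, w)) (baseDeriv r x.1 z)
      (baseDeriv r x.1 w)) = ⁅contrFst ζ (r (x.1, w - z)), laxAt r x z⁆
        + contrFst ζ (baseDeriv r x.1 (w - z) (restrictDual H x.2.2)) := by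
  rw [hr.laxBracket_eq x hz hw hzw, map_sub, map_neg, map_add, contrSnd_lieSlotOne,
    contrSnd_lieSlotTwo_eq_zero hζ, add_zero, ← contrSnd_flipTensor, ← contrSnd_flipTensor,
    hr.flipTensor_eq hzw hwz, hr.flipTensor_baseDeriv hzw hwz, map_neg, map_neg, neg_lie,
    sub_eq_add_neg]

theorem IsDynamicalRMatrix.laxDeriv_hamiltonian_vector (hr : IsDynamicalRMatrix H r)
    (hz : HolAt r (x.1, z)) (hw : HolAt r (x.1, w)) (hzw : HolAt r (x.1, z - w))
    (hwz : HolAt r (x.1, w - z)) (hζ : ∀ y : g, ζ ⁅y, laxAt r x w⁆ = 0) {η : Module.Dual ℂ g}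
    {X : Phase H} (hX : ∀ m : Module.Dual ℂ (Phase H),
      poisson (η ∘ₗ laxDeriv x.2.2 (r (x.1, z)) (baseDeriv r x.1 z)) m x = m X) :
    ζ (laxDeriv x.2.2 (r (x.1, w)) (baseDeriv r x.1 w) X)
      = η ⁅contrFst ζ (r (x.1, w - z)), laxAt r x z⁆
        + η (contrFst ζ (baseDeriv r x.1 (w - z) (restrictDual H x.2.2))) := by
  rw [← map_add, ← hr.contrSnd_laxBracket hz hw hzw hwz hζ, ← poisson_laxDeriv, hX,
    LinearMap.comp_apply]

/-- Testing the velocity `v` against the Hamiltonian vector `X` of a matrix entry `η(L(z))` turns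
`{L(z), F}` into an integral of the brackets `{L(z), L(w)}`, to which the Yang-Baxter equation
applies. -/
theorem IsDynamicalRMatrix.laxDeriv_velocity_eq (hr : IsDynamicalRMatrix H r) {v : Phase H}
    {M : Loop (Module.Dual ℂ g)} {F : Phase H → ℂ} {ρ σ : ℝ}
    (hreg : RegularBelow r x.1 (2 * ρ)) (hM : ConvergesOn M.1 ρ)
    (hinv : ∀ w : ℂ, 0 < ‖w‖ → ‖w‖ < ρ → ∀ y : g, M.eval w ⁅y, laxAt r x w⁆ = 0)
    {m : Module.Dual ℂ (Phase H)} (hm : ∀ u, dirDeriv F x u = m u)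
    (hF : ∀ u, dirDeriv F x u = (2 * Real.pi * I : ℂ)⁻¹ * ∮ w in C(0, σ),
      M.eval w (laxDeriv x.2.2 (r (x.1, w)) (baseDeriv r x.1 w) u))
    (hv : ∀ l : Module.Dual ℂ (Phase H), l v = poisson l F x)
    (hσ : 0 < σ) (hσz : σ < ‖z‖) (hzρ : ‖z‖ < ρ) :
    laxDeriv x.2.2 (r (x.1, z)) (baseDeriv r x.1 z) v
      = ⁅contrIntegral M (fun w => r (x.1, w - z)) σ, laxAt r x z⁆
        + contrIntegral M (fun w => baseDeriv r x.1 (w - z) (restrictDual H x.2.2)) σ := by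
  have hne {w : ℂ} (hw : ‖w‖ = σ) : w ≠ z := by
    rintro rfl
    exact hσz.ne hw.symm
  have hwz (w : ℂ) (hw : ‖w‖ = σ) : HolAt r (x.1, w - z) :=
    hreg.holAt_sub (hne hw) (by linarith)
  have hcont := hM.continuousOn_contrFst_eval hσ (hσz.trans hzρ) fun w hw =>
    (hwz w hw).differentiableAt_spectral_sub
  have hcont' := hM.continuousOn_contrFst_eval hσ (hσz.trans hzρ) fun w hw =>
    (hwz w hw).differentiableAt_baseDeriv_sub (restrictDual H x.2.2)
  rw [← sub_eq_zero, ← Module.forall_dual_apply_eq_zero_iff ℂ]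
  intro η
  rw [map_sub, sub_eq_zero, map_add]
  obtain ⟨X, hX⟩ := exists_hamiltonian_vector
    (η ∘ₗ laxDeriv x.2.2 (r (x.1, z)) (baseDeriv r x.1 z)) x
  have hv' := hv (η ∘ₗ laxDeriv x.2.2 (r (x.1, z)) (baseDeriv r x.1 z))
  rw [poisson_eq_of_dirDeriv_eq hX m hm, hF, LinearMap.comp_apply] at hv'
  refine (hv'.trans ?_).trans (apply_contrIntegral_add hσ.le hcont hcont'
    (η ∘ₗ (LieModule.toEnd ℂ g g : g →ₗ[ℂ] g →ₗ[ℂ] g).flip (laxAt r x z)) η).symm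
  congr 1
  refine circleIntegral.integral_congr hσ.le fun w hw => ?_
  replace hw := mem_sphere_zero_iff_norm.mp hw
  exact hr.laxDeriv_hamiltonian_vector (hreg z (by linarith) (by linarith))
    (hreg w (by linarith) (by linarith)) (hreg.holAt_sub (hne hw).symm (by linarith)) (hwz w hw)
    (hinv w (by linarith) (by linarith)) hX

theorem IsDynamicalRMatrix.eval_lie_laxAt_eq_zero (hr : IsDynamicalRMatrix H r)
    (hx : x.1 ∈ baseDomain r) {ρ : ℝ} (hreg : RegularBelow r x.1 ρ)
    {df : Loop g → Loop (Module.Dual ℂ g)} (hdf : Loop.AdInvariant df)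
    (hM : ConvergesOn (df (lax r x)).1 ρ) (h0 : 0 < ‖w‖) (h1 : ‖w‖ < ρ) (y : g) :
    (df (lax r x)).eval w ⁅y, laxAt r x w⁆ = 0 := by
  have hL := hr.lax_hasValue hx hreg h0 h1
  rw [← hL.eval_eq]
  exact hdf.eval_lie_eq_zero _ (norm_pos_iff.mp h0) (hM _ h0 h1) hL.summable y

theorem IsLaxLift.laxDeriv_velocity_eq (hr : IsDynamicalRMatrix H r) (hx : x.1 ∈ baseDomain r)
    {ρ₀ : ℝ} {hρ₀ : 0 < ρ₀} {Γ : (Fin (Module.finrank ℂ (Phase H)) → ℂ) → SeqSpace g}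
    {Γ' : (Fin (Module.finrank ℂ (Phase H)) → ℂ) →L[ℂ] SeqSpace g} (h : IsLaxLift r x hρ₀ Γ Γ')
    {f : Loop g → ℂ} {df : Loop g → Loop (Module.Dual ℂ g)} (hf : Loop.Smooth f)
    (hdf : Loop.IsDifferential f df) (hinv : Loop.AdInvariant df) {v : Phase H}
    (hv : ∀ l : Module.Dual ℂ (Phase H), l v = poisson l (fun y => f (lax r y)) x) {ρ : ℝ}
    (hreg : RegularBelow r x.1 (2 * ρ)) (hM : ConvergesOn (df (lax r x)).1 ρ)
    (h0 : 0 < ‖z‖) (h1 : ‖z‖ < ρ) :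
    laxDeriv x.2.2 (r (x.1, z)) (baseDeriv r x.1 z) v
      = ⁅opR r x.1 (df (lax r x)) z, laxAt r x z⁆
        + derivOpR r (restrictDual H x.2.2) x.1 (df (lax r x)) z := by
  have hσ : 0 < ‖z‖ / 2 := half_pos h0
  have hσz : ‖z‖ / 2 < ‖z‖ := half_lt_self h0
  have hregρ : RegularBelow r x.1 ρ := fun u hu0 hu1 => hreg u hu0 (by linarith)
  have hinvM (w : ℂ) (hw0 : 0 < ‖w‖) (hw1 : ‖w‖ < ρ) :=
    hr.eval_lie_laxAt_eq_zero hx hregρ hinv hM hw0 hw1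
  have hR := hr.hasValueR hx (fun u hu0 hu1 => hreg u hu0 (by linarith)) hM hσ hσz h1
  have hderiv := hr.hasDerivAt_opR hx hreg hM hσ hσz h1 (restrictDual H x.2.2)
  rw [hr.laxDeriv_velocity_eq hreg hM hinvM (m := (fderiv ℂ (fun c => f (lax r
      ((coords (Phase H)).symm c))) (coords _ x)).toLinearMap ∘ₗ (coords (Phase H)).toLinearMap)
    (h.dirDeriv_comp_lax hf) (h.dirDeriv_comp_lax_eq_circleIntegral hf hdf hregρ hM hσ
      (hσz.trans h1)) hv hσ hσz h1, hR.opR_eq, add_lie, smul_lie,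
    lie_contrFst_casimir_eq_zero (hinvM z h0 h1), smul_zero, add_zero, derivOpR, derivZero,
    hderiv.deriv, LinearEquiv.symm_apply_apply]

end QuasiLax

theorem theoremA_general {g : Type*} [LieRing g] [LieAlgebra ℂ g] [FiniteDimensional ℂ g]
    [LieAlgebra.IsSimple ℂ g] (H : LieSubalgebra ℂ g)
    (r : Module.Dual ℂ H × ℂ → g ⊗[ℂ] g) (hr : IsDynamicalRMatrix H r) :
    (∀ x : Phase H, x.1 ∈ baseDomain r → ∀ ρ : ℝ, RegularBelow r x.1 ρ →
      ∀ z : ℂ, 0 < ‖z‖ → ‖z‖ < ρ → (lax r x).HasValue z (laxAt r x z)) ∧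
    (∀ (x : Phase H) (z w : ℂ), HolAt r (x.1, z) → HolAt r (x.1, w) → HolAt r (x.1, z - w) →
      poissonTensor (fun y => laxAt r y z) (fun y => laxAt r y w) x =
          -(lieSlotOne (r (x.1, z - w)) (laxAt r x z) + lieSlotTwo (r (x.1, z - w)) (laxAt r x w))
            - derivBase r (restrictDual H x.2.2) x.1 (z - w) ∧
      (HolAt r (x.1, w - z) →
        poissonTensor (fun y => laxAt r y z) (fun y => laxAt r y w) x =
          -lieSlotOne (r (x.1, z - w)) (laxAt r x z)
            + lieSlotTwo (flipTensor (r (x.1, w - z))) (laxAt r x w)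
            - derivBase r (restrictDual H x.2.2) x.1 (z - w))) ∧
    (∀ (f : Loop g → ℂ) (df : Loop g → Loop (Module.Dual ℂ g)),
      Loop.Smooth f → Loop.IsDifferential f df → Loop.AdInvariant df →
      (∀ x : Phase H, x.1 ∈ baseDomain r →
        DifferentiableAt ℂ (fun c => f (lax r ((coords (Phase H)).symm c))) (coords (Phase H) x)) ∧
      ∀ (φ : ℝ → Phase H) (t : ℝ), (φ t).1 ∈ baseDomain r →
        SatisfiesHamiltonAt (fun y => f (lax r y)) φ t →
        ∃ v : Loop g, Loop.HasDerivAtLoop (fun s => lax r (φ s)) v t ∧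
          ∀ ρ : ℝ, RegularBelow r (φ t).1 (2 * ρ) → ConvergesOn (df (lax r (φ t))).1 ρ →
          ∀ z : ℂ, 0 < ‖z‖ → ‖z‖ < ρ →
            HasValueR r (φ t).1 (df (lax r (φ t))) z (opR r (φ t).1 (df (lax r (φ t))) z) ∧
            DifferentiableAt ℂ (fun s : ℂ => coords g
              (opR r ((φ t).1 + s • restrictDual H (φ t).2.2) (df (lax r (φ t))) z)) 0 ∧
            v.HasValue z (⁅opR r (φ t).1 (df (lax r (φ t))) z, laxAt r (φ t) z⁆
                + derivOpR r (restrictDual H (φ t).2.2) (φ t).1 (df (lax r (φ t))) z)) := by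
  refine ⟨fun x hx ρ hρ z h0 h1 => hr.lax_hasValue hx hρ h0 h1,
    fun x z w hz hw hzw => ⟨hr.poissonTensor_eq x hz hw hzw,
      hr.poissonTensor_eq_flip x hz hw hzw⟩,
    fun f df hf hdf hinv => ⟨fun x hx => ?_, fun φ t hq hφ => ?_⟩⟩
  · obtain ⟨ρ, hρ, Γ, Γ', h⟩ := hr.exists_isLaxLift hx
    exact (h.hasFDerivAt_comp_lax hf).differentiableAt
  · obtain ⟨ρ₀, hρ₀, Γ, Γ', h⟩ := hr.exists_isLaxLift hq
    obtain ⟨v, hv, hvl⟩ := hφ.exists_velocity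
    refine ⟨_, h.hasDerivAtLoop rfl hv, fun ρ hreg hM z h0 h1 => ?_⟩
    have hσ : 0 < ‖z‖ / 2 := half_pos h0
    have hσz : ‖z‖ / 2 < ‖z‖ := half_lt_self h0
    have hR := hr.hasValueR hq (fun u hu0 hu1 => hreg u hu0 (by linarith)) hM hσ hσz h1
    refine ⟨by rwa [hR.opR_eq],
      (hr.hasDerivAt_opR hq hreg hM hσ hσz h1 (restrictDual H (φ t).2.2)).differentiableAt, ?_⟩
    rw [← h.laxDeriv_velocity_eq hr hq hf hdf hinv hvl hreg hM h0 h1]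
    exact h.hasValue v (2 * ρ) hreg z h0 (by linarith)

theorem theoremA {g : Type*} [LieRing g] [LieAlgebra ℂ g] [FiniteDimensional ℂ g]
    [LieAlgebra.IsSimple ℂ g] (H : LieSubalgebra ℂ g) [H.IsCartanSubalgebra]
    (r : Module.Dual ℂ H × ℂ → g ⊗[ℂ] g) (hr : IsDynamicalRMatrix H r) :
    -- the Lax map takes values in the loop algebra
    (∀ x : Phase H, x.1 ∈ baseDomain r → ∀ ρ : ℝ, RegularBelow r x.1 ρ →
      ∀ z : ℂ, 0 < ‖z‖ → ‖z‖ < ρ → (lax r x).HasValue z (laxAt r x z)) ∧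
    -- the fundamental Poisson bracket relations
    (∀ (x : Phase H) (z w : ℂ), HolAt r (x.1, z) → HolAt r (x.1, w) → HolAt r (x.1, z - w) →
      poissonTensor (fun y => laxAt r y z) (fun y => laxAt r y w) x =
          -(lieSlotOne (r (x.1, z - w)) (laxAt r x z) + lieSlotTwo (r (x.1, z - w)) (laxAt r x w))
            - derivBase r (restrictDual H x.2.2) x.1 (z - w) ∧
      (HolAt r (x.1, w - z) →
        poissonTensor (fun y => laxAt r y z) (fun y => laxAt r y w) x =
          -lieSlotOne (r (x.1, z - w)) (laxAt r x z)
            + lieSlotTwo (flipTensor (r (x.1, w - z))) (laxAt r x w)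
            - derivBase r (restrictDual H x.2.2) x.1 (z - w))) ∧
    -- the quasi-Lax equation
    (∀ (f : Loop g → ℂ) (df : Loop g → Loop (Module.Dual ℂ g)),
      Loop.Smooth f → Loop.IsDifferential f df → Loop.AdInvariant df →
      (∀ x : Phase H, x.1 ∈ baseDomain r →
        DifferentiableAt ℂ (fun c => f (lax r ((coords (Phase H)).symm c))) (coords (Phase H) x)) ∧
      ∀ (J : Set ℝ) (φ : ℝ → Phase H), IsOpen J → (∀ t ∈ J, (φ t).1 ∈ baseDomain r) →
        (∀ t ∈ J, SatisfiesHamiltonAt (fun y => f (lax r y)) φ t) →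
        ∀ t ∈ J, ∃ v : Loop g, Loop.HasDerivAtLoop (fun s => lax r (φ s)) v t ∧
          ∀ ρ : ℝ, RegularBelow r (φ t).1 (2 * ρ) → ConvergesOn (df (lax r (φ t))).1 ρ →
          ∀ z : ℂ, 0 < ‖z‖ → ‖z‖ < ρ →
            HasValueR r (φ t).1 (df (lax r (φ t))) z (opR r (φ t).1 (df (lax r (φ t))) z) ∧
            DifferentiableAt ℂ (fun s : ℂ => coords g
              (opR r ((φ t).1 + s • restrictDual H (φ t).2.2) (df (lax r (φ t))) z)) 0 ∧
            v.HasValue z (⁅opR r (φ t).1 (df (lax r (φ t))) z, laxAt r (φ t) z⁆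
                + derivOpR r (restrictDual H (φ t).2.2) (φ t).1 (df (lax r (φ t))) z)) := by
  obtain ⟨hval, hbracket, hflow⟩ := theoremA_general H r hr
  exact ⟨hval, hbracket, fun f df hf hdf hinv => ⟨(hflow f df hf hdf hinv).1,
    fun _ φ _ hq hφ t ht => (hflow f df hf hdf hinv).2 φ t (hq t ht) (hφ t ht)⟩⟩
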